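/- Let $p>3$ be a prime and let $k$ be an algebraically closed field whose characteristic is different from $2$, $3$ and $p$. Fix a generator $\gamma$ of $\mathbb{F}_{p^2}^\times$. For a two-dimensional $\mathbb{F}_p$-vector space $V$ let $\mathcal{C}_\gamma\subset \mathrm{PGL}(V)$ be the conjugacy class of the elements that have a representative in $\mathrm{GL}(V)$ whose characteristic polynomial is the minimal polynomial of $\gamma$ over $\mathbb{F}_p$. An \emph{oriented necklace} of $V$ is a list $(C_0,\dots,C_p)$ of all the $p+1$ points of $\mathbb{P}(V)$, up to cyclic permutation, such that some $h\in\mathcal{C}_\gamma$ satisfies $h(C_i)=C_{i+1}$ for all $i$ modulo $p+1$; put $w(C_0,\dots,C_p)=(C_p,\dots,C_0)$. A \emph{necklace} is a $w$-orbit $\{\mathfrak v,w(\mathfrak v)\}$ of oriented necklaces. Let $\mathcal N$ be the normaliser of a non-split Cartan subgroup of $\mathrm{GL}_2(\mathbb{F}_p)$ and let $X_{\mathrm{nsp}}^+=X(p)/\mathcal N$. Its non-cuspidal points over $k$ are the $\mathcal N$-orbits of isomorphism classes of pairs $(E,(P,Q))$, where $E/k$ is an elliptic curve and $(P,Q)$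 is an $\mathbb{F}_p$-basis of $E[p]$; equivalently, they are the isomorphism classes of pairs $(E,\{\mathfrak v,w(\mathfrak v)\})$ of an elliptic curve $E/k$ and a necklace of $E[p]$. For $r=2$ or $3$, let $e_r^+$ be the number of elliptic points of $X_{\mathrm{nsp}}^+$ with $g$ of order $r$, that is, of the points represented by a pair $(E,\{\mathfrak v,w(\mathfrak v)\})$ for which some automorphism of $E$ induces an element $g\in\mathrm{PGL}(E[p])$ of order $r$ with $g(\mathfrak v)=\mathfrak v$ (fixed) or $g(\mathfrak v)=w(\mathfrak v)$ (flipped). Then \[ e_2^+=\frac{p+1}{2}-\left(\frac{-1}{p}\right)=\begin{cases}\frac{p-1}{2}&\text{if }p\equiv1\pmod 4,\\ \frac{p+3}{2}&\text{if }p\equiv3\pmod 4,\end{cases} \qquad e_3^+=\frac12-\frac12\left(\frac{-3}{p}\right)=\begin{cases}0&\text{if }p\equiv1\pmod 3,\\ 1&\text{if }p\equiv2\pmod 3.\end{cases} \] These counts are finite, and the same numbers are obtained when the points are described as $\mathcal N$-orbits of pairs $(E,(P,Q))$, a point being counted if some automorphism of $E$ inducing an element of order $r$ of $\mathrm{PGL}(E[p])$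 maps the orbit $(P,Q)\mathcal N$ to itself. -/

import Mathlib

open scoped LinearAlgebra.Projectivization

noncomputable section

namespace NspNecklace

/-! ### Necklaces in a plane over `𝔽_p` -/

section Necklaces

variable {p : ℕ} [Fact p.Prime]

/-- Elements of `GL(V)` whose characteristic polynomial is the minimal polynomial of `γ` over `𝔽_p`.
The classes of these elements in `PGL(V)` form the conjugacy class `𝒞_γ`. The chosen basis only
serves to write the characteristic polynomial (it does not depend on it), and its existence says
that `V` has dimension two. -/
def rotations (γ : (GaloisField p 2)ˣ) (V : Type*) [AddCommGroup V] [Module (ZMod p) V] :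
    Set (LinearMap.GeneralLinearGroup (ZMod p) V) :=
  {g | ∃ b : Module.Basis (Fin 2) (ZMod p) V,
    (LinearMap.toMatrix b b (g : V →ₗ[ZMod p] V)).charpoly =
      minpoly (ZMod p) (γ : GaloisField p 2)}

/-- A list `(C_0, …, C_p)`, indexed by `ℤ/(p+1)`, of all the points of `ℙ(V)` (the lines of `V`),
for which some element of `𝒞_γ ⊆ PGL(V)` sends `C_i` to `C_{i+1}`. -/
@[ext]
structure NecklaceList (γ : (GaloisField p 2)ˣ) (V : Type*) [AddCommGroup V]
    [Module (ZMod p) V] where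
  pearl : ZMod (p + 1) ≃ ℙ (ZMod p) V
  exists_rotation : ∃ g ∈ rotations γ V, ∀ i, g • pearl i = pearl (i + 1)

variable {γ : (GaloisField p 2)ˣ}
variable {V W U : Type*} [AddCommGroup V] [Module (ZMod p) V] [AddCommGroup W]
  [Module (ZMod p) W] [AddCommGroup U] [Module (ZMod p) U]

/-- Two lists are equivalent if they differ by a cyclic permutation. -/
instance NecklaceList.setoid (γ : (GaloisField p 2)ˣ) (V : Type*) [AddCommGroup V]
    [Module (ZMod p) V] : Setoid (NecklaceList γ V) where
  r c d := ∃ a, ∀ i, d.pearl i = c.pearl (i + a)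
  iseqv :=
    { refl := fun c => ⟨0, fun i => by rw [add_zero]⟩
      symm := fun {c d} ⟨a, h⟩ => ⟨-a, fun i => by rw [h, neg_add_cancel_right]⟩
      trans := fun {c d e} ⟨a, h⟩ ⟨a', h'⟩ => ⟨a' + a, fun i => by rw [h', h, add_assoc]⟩ }

/-- Oriented `γ`-necklaces of `V`. -/
def OrientedNecklace (γ : (GaloisField p 2)ˣ) (V : Type*) [AddCommGroup V]
    [Module (ZMod p) V] : Type _ :=
  Quotient (NecklaceList.setoid γ V)

/-- The class `𝒞_γ` is stable under inversion. -/
lemma exists_rotations_inv {g : LinearMap.GeneralLinearGroup (ZMod p) V}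
    (hg : g ∈ rotations γ V) :
    ∃ g' ∈ rotations γ V, ∀ x : ℙ (ZMod p) V, g' • x = g⁻¹ • x := by
  obtain ⟨b, hb⟩ := hg
  set M := LinearMap.toMatrix b b (g : V →ₗ[ZMod p] V) with hM
  set M' := LinearMap.toMatrix b b ((g⁻¹ : LinearMap.GeneralLinearGroup (ZMod p) V) :
    V →ₗ[ZMod p] V) with hM'
  have hMM' : M * M' = 1 := by
    rw [hM, hM', ← LinearMap.toMatrix_mul, ← Units.val_mul, mul_inv_cancel, Units.val_one,
      LinearMap.toMatrix_one]
  have hdet : M.det * M'.det = 1 := by rw [← Matrix.det_mul, hMM', Matrix.det_one]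
  have hadj : M.det • M' = M.adjugate := by
    have h := congrArg (fun X => M.adjugate * X) hMM'
    simp only [← mul_assoc, Matrix.adjugate_mul, mul_one] at h
    rw [← h, Matrix.smul_mul, one_mul]
  let d : (ZMod p)ˣ := ⟨M.det, M'.det, hdet, by rw [mul_comm]; exact hdet⟩
  let s : LinearMap.GeneralLinearGroup (ZMod p) V :=
    Units.map (algebraMap (ZMod p) (Module.End (ZMod p) V)).toMonoidHom d
  refine ⟨s * g⁻¹, ⟨b, ?_⟩, fun x => ?_⟩
  · have hs : LinearMap.toMatrix b b
        ((s * g⁻¹ : LinearMap.GeneralLinearGroup (ZMod p) V) : V →ₗ[ZMod p] V) =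
        M.adjugate := by
      rw [← hadj, hM', ← map_smul]
      congr 1
    rw [hs, ← hb, Matrix.charpoly_fin_two, Matrix.charpoly_fin_two, Matrix.adjugate_fin_two,
      Matrix.trace_fin_two_of, Matrix.det_fin_two_of, Matrix.trace_fin_two, Matrix.det_fin_two,
      add_comm (M 1 1), neg_mul_neg, mul_comm (M 1 1)]
  · rw [mul_smul]
    induction g⁻¹ • x using Projectivization.ind with
    | h v hv =>
      rw [Projectivization.smul_mk, Projectivization.mk_eq_mk_iff]
      exact ⟨d, rfl⟩

/-- Reading a list backwards: `(C_0, …, C_p) ↦ (C_p, …, C_0)`. -/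
def NecklaceList.reverse (c : NecklaceList γ V) : NecklaceList γ V where
  pearl := (Equiv.subLeft (-1)).trans c.pearl
  exists_rotation := by
    obtain ⟨g, hg, h⟩ := c.exists_rotation
    obtain ⟨g', hg', h'⟩ := exists_rotations_inv hg
    refine ⟨g', hg', fun i => ?_⟩
    rw [h', inv_smul_eq_iff]
    simp only [Equiv.trans_apply, Equiv.subLeft_apply]
    rw [h]
    congr 1
    ring

lemma NecklaceList.reverse_apply (c : NecklaceList γ V) (i : ZMod (p + 1)) :
    c.reverse.pearl i = c.pearl (-1 - i) := rfl

/-- The involution `w`, which changes the orientation. -/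
def OrientedNecklace.w : OrientedNecklace γ V → OrientedNecklace γ V :=
  Quotient.map NecklaceList.reverse fun c d ⟨a, h⟩ => ⟨-a, fun i => by
    rw [NecklaceList.reverse_apply, NecklaceList.reverse_apply, h]
    congr 1
    ring⟩

lemma OrientedNecklace.w_w (v : OrientedNecklace γ V) : v.w.w = v := by
  induction v using Quotient.inductionOn with
  | h c =>
    refine Quotient.sound ⟨0, fun i => ?_⟩
    rw [NecklaceList.reverse_apply, NecklaceList.reverse_apply]
    congr 1
    ring

/-- Two oriented necklaces are in the same `w`-orbit. -/
instance OrientedNecklace.setoid (γ : (GaloisField p 2)ˣ) (V : Type*) [AddCommGroup V]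
    [Module (ZMod p) V] : Setoid (OrientedNecklace γ V) where
  r v v' := v' = v ∨ v' = v.w
  iseqv :=
    { refl := fun v => Or.inl rfl
      symm := by
        rintro v _ (rfl | rfl)
        · exact Or.inl rfl
        · exact Or.inr v.w_w.symm
      trans := by
        rintro v _ _ (rfl | rfl) (rfl | rfl)
        · exact Or.inl rfl
        · exact Or.inr rfl
        · exact Or.inr rfl
        · exact Or.inl v.w_w }

/-- `γ`-necklaces of `V`: the `w`-orbits `{v, w(v)}` of oriented necklaces. -/
def Necklace (γ : (GaloisField p 2)ˣ) (V : Type*) [AddCommGroup V] [Module (ZMod p) V] : Type _ :=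
  Quotient (OrientedNecklace.setoid γ V)

/-- The necklace `{v, w(v)}`. -/
def OrientedNecklace.toNecklace (v : OrientedNecklace γ V) : Necklace γ V :=
  Quotient.mk _ v

/-- The bijection `ℙ(V) → ℙ(W)` induced by a linear isomorphism. -/
def projEquiv (e : V ≃ₗ[ZMod p] W) : ℙ (ZMod p) V ≃ ℙ (ZMod p) W where
  toFun := Projectivization.map e.toLinearMap e.injective
  invFun := Projectivization.map e.symm.toLinearMap e.symm.injective
  left_inv x := by
    induction x using Projectivization.ind with
    | h v hv => simp [Projectivization.map_mk]
  right_inv x := by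
    induction x using Projectivization.ind with
    | h v hv => simp [Projectivization.map_mk]

/-- A linear isomorphism sends `(C_0, …, C_p)` to `(e(C_0), …, e(C_p))`. -/
def NecklaceList.map (e : V ≃ₗ[ZMod p] W) (c : NecklaceList γ V) : NecklaceList γ W where
  pearl := c.pearl.trans (projEquiv e)
  exists_rotation := by
    obtain ⟨g, ⟨b, hb⟩, h⟩ := c.exists_rotation
    refine ⟨LinearMap.GeneralLinearGroup.congrLinearEquiv e g, ⟨b.map e, ?_⟩, fun i => ?_⟩
    · rw [← hb]
      congr 1
      ext i j
      simp [LinearMap.toMatrix_apply]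
    · simp only [Equiv.trans_apply]
      rw [← h i]
      induction c.pearl i using Projectivization.ind with
      | h v hv =>
        simp [projEquiv, Projectivization.map_mk, Projectivization.smul_mk, Units.smul_def]

/-- The action of a linear isomorphism on oriented necklaces. -/
def OrientedNecklace.map (e : V ≃ₗ[ZMod p] W) : OrientedNecklace γ V → OrientedNecklace γ W :=
  Quotient.map (NecklaceList.map e) fun _ _ ⟨a, h⟩ =>
    ⟨a, fun i => congrArg (projEquiv e) (h i)⟩

lemma OrientedNecklace.map_w (e : V ≃ₗ[ZMod p] W) (v : OrientedNecklace γ V) :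
    v.w.map e = (v.map e).w := by
  induction v using Quotient.inductionOn with
  | h c => rfl

/-- The action of a linear isomorphism on necklaces. -/
def Necklace.map (e : V ≃ₗ[ZMod p] W) : Necklace γ V → Necklace γ W :=
  Quotient.map (OrientedNecklace.map e) (by
    rintro v _ (rfl | rfl)
    · exact Or.inl rfl
    · exact Or.inr (v.map_w e))

lemma Necklace.map_refl (v : Necklace γ V) : v.map (LinearEquiv.refl (ZMod p) V) = v := by
  induction v using Quotient.inductionOn with
  | h v =>
    induction v using Quotient.inductionOn with
    | h c =>
      refine congrArg OrientedNecklace.toNecklace (congrArg (Quotient.mk _) ?_)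
      ext i
      simp only [NecklaceList.map, Equiv.trans_apply]
      induction c.pearl i using Projectivization.ind with
      | h v hv => simp [projEquiv]

lemma Necklace.map_trans (e : V ≃ₗ[ZMod p] W) (f : W ≃ₗ[ZMod p] U) (v : Necklace γ V) :
    v.map (e.trans f) = (v.map e).map f := by
  induction v using Quotient.inductionOn with
  | h v =>
    induction v using Quotient.inductionOn with
    | h c =>
      refine congrArg OrientedNecklace.toNecklace (congrArg (Quotient.mk _) ?_)
      ext i
      simp only [NecklaceList.map, Equiv.trans_apply]
      induction c.pearl i using Projectivization.ind with
      | h v hv => simp [projEquiv, Projectivization.map_mk]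

/-- The class in `PGL(V) = GL(V) / center` of a linear automorphism. -/
def toPGL (e : V ≃ₗ[ZMod p] V) :
    LinearMap.GeneralLinearGroup (ZMod p) V ⧸
      Subgroup.center (LinearMap.GeneralLinearGroup (ZMod p) V) :=
  QuotientGroup.mk (LinearMap.GeneralLinearGroup.ofLinearEquiv e)

end Necklaces

/-! ### Elliptic curves, their isomorphisms and their `p`-torsion -/

section EllipticCurves

variable {k : Type*} [Field k] [DecidableEq k]

/-- A group isomorphism `E(k) ≃ E'(k)` is an isomorphism of elliptic curves (with `k`
algebraically closed) if it is given by an admissible change of Weierstrass coordinates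
`(x, y) ↦ (u² x + r, u³ y + u² s x + t)`. -/
def IsIsom (E E' : WeierstrassCurve k) (f : E.toAffine.Point ≃+ E'.toAffine.Point) : Prop :=
  ∃ C : WeierstrassCurve.VariableChange k, C • E' = E ∧
    ∀ (x y : k) (h : E.toAffine.Nonsingular x y),
      ∃ h', f (.some x y h) =
        .some ((C.u : k) ^ 2 * x + C.r) ((C.u : k) ^ 3 * y + (C.u : k) ^ 2 * C.s * x + C.t) h'

variable {E E' E'' : WeierstrassCurve k}

lemma IsIsom.refl (E : WeierstrassCurve k) : IsIsom E E (AddEquiv.refl _) :=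
  ⟨1, one_smul _ _, fun x y h => by
    have hx : ((1 : WeierstrassCurve.VariableChange k).u : k) ^ 2 * x +
        (1 : WeierstrassCurve.VariableChange k).r = x := by
      simp [WeierstrassCurve.VariableChange.one_def]
    have hy : ((1 : WeierstrassCurve.VariableChange k).u : k) ^ 3 * y +
        ((1 : WeierstrassCurve.VariableChange k).u : k) ^ 2 *
          (1 : WeierstrassCurve.VariableChange k).s * x +
        (1 : WeierstrassCurve.VariableChange k).t = y := by
      simp [WeierstrassCurve.VariableChange.one_def]
    rw [hx, hy]
    exact ⟨h, rfl⟩⟩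

lemma IsIsom.trans {f : E.toAffine.Point ≃+ E'.toAffine.Point}
    {g : E'.toAffine.Point ≃+ E''.toAffine.Point} (hf : IsIsom E E' f) (hg : IsIsom E' E'' g) :
    IsIsom E E'' (f.trans g) := by
  obtain ⟨C, hC, h⟩ := hf
  obtain ⟨D, hD, h'⟩ := hg
  refine ⟨C * D, by rw [mul_smul, hD, hC], fun x y hxy => ?_⟩
  obtain ⟨h₁, e₁⟩ := h x y hxy
  obtain ⟨h₂, e₂⟩ := h' _ _ h₁
  have hx : ((C * D).u : k) ^ 2 * x + (C * D).r =
      (D.u : k) ^ 2 * ((C.u : k) ^ 2 * x + C.r) + D.r := by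
    simp only [WeierstrassCurve.VariableChange.mul_def, Units.val_mul]
    ring
  have hy : ((C * D).u : k) ^ 3 * y + ((C * D).u : k) ^ 2 * (C * D).s * x + (C * D).t =
      (D.u : k) ^ 3 * ((C.u : k) ^ 3 * y + (C.u : k) ^ 2 * C.s * x + C.t) +
        (D.u : k) ^ 2 * D.s * ((C.u : k) ^ 2 * x + C.r) + D.t := by
    simp only [WeierstrassCurve.VariableChange.mul_def, Units.val_mul]
    ring
  rw [hx, hy, AddEquiv.trans_apply, e₁, e₂]
  exact ⟨h₂, rfl⟩

lemma IsIsom.symm {f : E.toAffine.Point ≃+ E'.toAffine.Point} (hf : IsIsom E E' f) :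
    IsIsom E' E f.symm := by
  obtain ⟨C, hC, h⟩ := hf
  refine ⟨C⁻¹, by rw [← hC, inv_smul_smul], fun x y hxy => ?_⟩
  rcases hQ : f.symm (.some x y hxy) with _ | ⟨x', y', h'⟩
  · have h0 := congrArg f hQ
    rw [AddEquiv.apply_symm_apply] at h0
    exact absurd (h0.trans (map_zero f)) (by simp [WeierstrassCurve.Affine.Point.zero_def])
  · obtain ⟨h₁, e₁⟩ := h x' y' h'
    have h0 := congrArg f hQ
    rw [AddEquiv.apply_symm_apply, e₁, WeierstrassCurve.Affine.Point.some.injEq] at h0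
    have hu : (C.u : k) ≠ 0 := C.u.ne_zero
    have hx : ((C⁻¹).u : k) ^ 2 * x + (C⁻¹).r = x' := by
      simp only [WeierstrassCurve.VariableChange.inv_def, h0.1, Units.val_inv_eq_inv_val]
      field_simp
      ring
    have hy : ((C⁻¹).u : k) ^ 3 * y + ((C⁻¹).u : k) ^ 2 * (C⁻¹).s * x + (C⁻¹).t = y' := by
      simp only [WeierstrassCurve.VariableChange.inv_def, h0.1, h0.2, Units.val_inv_eq_inv_val]
      field_simp
      ring
    rw [hx, hy]
    exact ⟨h', rfl⟩

/-- The `p`-torsion subgroup `E[p]` of `E(k)`. -/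
abbrev Torsion (p : ℕ) (E : WeierstrassCurve k) : Type _ :=
  AddSubgroup.torsionBy E.toAffine.Point (p : ℤ)

instance (p : ℕ) (E : WeierstrassCurve k) : Module (ZMod p) (Torsion p E) :=
  AddSubgroup.torsionBy.zmodModule

/-- The `𝔽_p`-linear isomorphism `E[p] ≃ E'[p]` obtained by restriction. -/
def torsionEquiv (p : ℕ) (f : E.toAffine.Point ≃+ E'.toAffine.Point) :
    Torsion p E ≃ₗ[ZMod p] Torsion p E' :=
  { (AddMonoidHom.toZModLinearMap p
      ((f.toAddMonoidHom.comp (AddSubgroup.subtype _)).codRestrict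
        (AddSubgroup.torsionBy E'.toAffine.Point (p : ℤ)) fun x => by
          rw [AddSubgroup.torsionBy.nsmul_iff]
          have h := AddSubgroup.torsionBy.nsmul_iff.mp x.2
          exact (map_nsmul f p (x : E.toAffine.Point)).symm.trans
            ((congrArg f h).trans (map_zero f)))) with
    invFun := fun y => ⟨f.symm y, by
      rw [AddSubgroup.torsionBy.nsmul_iff]
      have h := AddSubgroup.torsionBy.nsmul_iff.mp y.2
      exact (map_nsmul f.symm p (y : E'.toAffine.Point)).symm.trans
        ((congrArg f.symm h).trans (map_zero f.symm))⟩
    left_inv := fun x => Subtype.ext (f.symm_apply_apply x)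
    right_inv := fun y => Subtype.ext (f.apply_symm_apply y) }

lemma coe_torsionEquiv (p : ℕ) (f : E.toAffine.Point ≃+ E'.toAffine.Point) (x : Torsion p E) :
    (torsionEquiv p f x : E'.toAffine.Point) = f x := rfl

end EllipticCurves

/-! ### The points of `X_nsp⁺` away from the cusps -/

section Curves

variable (p : ℕ) [Fact p.Prime] (k : Type*) [Field k] [DecidableEq k]

/-- Pairs `(E, 𝔳)` of an elliptic curve over `k` and a `γ`-necklace in `E[p]`. -/
structure NecklacePair (γ : (GaloisField p 2)ˣ) where
  E : WeierstrassCurve k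
  isElliptic : E.IsElliptic
  necklace : Necklace γ (Torsion p E)

/-- Isomorphism of pairs `(E, 𝔳)`. -/
instance NecklacePair.setoid (γ : (GaloisField p 2)ˣ) : Setoid (NecklacePair p k γ) where
  r x y := ∃ f : x.E.toAffine.Point ≃+ y.E.toAffine.Point, IsIsom x.E y.E f ∧
    x.necklace.map (torsionEquiv p f) = y.necklace
  iseqv :=
    { refl := fun x => ⟨AddEquiv.refl _, IsIsom.refl _, x.necklace.map_refl⟩
      symm := by
        rintro x y ⟨f, hf, h⟩
        refine ⟨f.symm, hf.symm, ?_⟩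
        rw [← h, ← Necklace.map_trans]
        have : (torsionEquiv p f).trans (torsionEquiv p f.symm) =
            LinearEquiv.refl (ZMod p) (Torsion p x.E) :=
          LinearEquiv.ext fun z => Subtype.ext (f.symm_apply_apply z)
        rw [this, Necklace.map_refl]
      trans := by
        rintro x y z ⟨f, hf, h⟩ ⟨g, hg, h'⟩
        refine ⟨f.trans g, hf.trans hg, ?_⟩
        rw [← h', ← h, ← Necklace.map_trans]
        rfl }

/-- The non-cuspidal points of `X_nsp⁺` over `k`, as isomorphism classes of elliptic curves
with a necklace. -/
def NecklaceModuli (γ : (GaloisField p 2)ˣ) : Type _ := Quotient (NecklacePair.setoid p k γ)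

/-- The elliptic points with `g` of order `r`: points represented by `(E, {v, w(v)})` for which an
automorphism of `E` induces an element `g` of order `r` of `PGL(E[p])` that either fixes `v`
or flips it. -/
def ellipticPoints (γ : (GaloisField p 2)ˣ) (r : ℕ) : Set (NecklaceModuli p k γ) :=
  {x | ∃ (E : WeierstrassCurve k) (hE : E.IsElliptic) (v : OrientedNecklace γ (Torsion p E))
      (f : E.toAffine.Point ≃+ E.toAffine.Point),
    x = Quotient.mk _ ⟨E, hE, v.toNecklace⟩ ∧ IsIsom E E f ∧
      orderOf (toPGL (torsionEquiv p f)) = r ∧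
      (v.map (torsionEquiv p f) = v ∨ v.map (torsionEquiv p f) = v.w)}

/-- The non-split Cartan subgroup of `GL_2(𝔽_p)` attached to an `𝔽_p`-basis of `𝔽_{p²}`: the matrices
of the multiplications by elements of `𝔽_{p²}ˣ`. Every non-split Cartan subgroup is of this form. -/
def nonsplitCartan (b : Module.Basis (Fin 2) (ZMod p) (GaloisField p 2)) :
    Subgroup (GL (Fin 2) (ZMod p)) :=
  (Units.map (Algebra.leftMulMatrix b).toRingHom.toMonoidHom).range

/-- Pairs `(E, (P, Q))` of an elliptic curve over `k` and an `𝔽_p`-basis of `E[p]`. -/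
structure FullLevelPair where
  E : WeierstrassCurve k
  isElliptic : E.IsElliptic
  basis : Module.Basis (Fin 2) (ZMod p) (Torsion p E)

/-- Two pairs are equivalent modulo `H ≤ GL_2(𝔽_p)` if the second is isomorphic to a translate of
the first under the right action
`(E, (P, Q)) · !![a, b; c, d] = (E, (a P + c Q, b P + d Q))` of an element of `H`. -/
def FullLevelPair.setoid (H : Subgroup (GL (Fin 2) (ZMod p))) : Setoid (FullLevelPair p k) where
  r x y := ∃ f : x.E.toAffine.Point ≃+ y.E.toAffine.Point, IsIsom x.E y.E f ∧
    ∃ M ∈ H, ∀ j, y.basis j = torsionEquiv p f (∑ i, M.val i j • x.basis i)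
  iseqv :=
    { refl := fun x => ⟨AddEquiv.refl _, IsIsom.refl _, 1, one_mem _, fun j => by
        have : torsionEquiv p (AddEquiv.refl x.E.toAffine.Point) =
          LinearEquiv.refl (ZMod p) (Torsion p x.E) := rfl
        rw [this]
        simp [Matrix.one_apply]⟩
      symm := by
        rintro x y ⟨f, hf, M, hM, h⟩
        refine ⟨f.symm, hf.symm, M⁻¹, inv_mem hM, fun j => ?_⟩
        have hfs : torsionEquiv p f.symm = (torsionEquiv p f).symm := rfl
        rw [hfs, LinearEquiv.eq_symm_apply]
        simp_rw [h, ← map_smul, ← map_sum, Finset.smul_sum, smul_smul]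
        congr 1
        rw [Finset.sum_comm]
        simp_rw [← Finset.sum_smul]
        have hl : ∀ l, ∑ i, M⁻¹.val i j * M.val l i = (1 : Matrix (Fin 2) (Fin 2) (ZMod p)) l j := by
          intro l
          rw [← Units.val_one, ← mul_inv_cancel M, Units.val_mul, Matrix.mul_apply]
          exact Finset.sum_congr rfl fun i _ => mul_comm _ _
        simp_rw [hl]
        simp [Matrix.one_apply]
      trans := by
        rintro x y z ⟨f, hf, M, hM, h⟩ ⟨g, hg, M', hM', h'⟩
        refine ⟨f.trans g, hf.trans hg, M * M', mul_mem hM hM', fun j => ?_⟩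
        have hfg : torsionEquiv p (f.trans g) = (torsionEquiv p f).trans (torsionEquiv p g) := rfl
        rw [h', hfg, LinearEquiv.trans_apply]
        simp_rw [h, ← map_smul, ← map_sum, Finset.smul_sum, smul_smul]
        congr 2
        rw [Finset.sum_comm]
        simp_rw [← Finset.sum_smul]
        refine Finset.sum_congr rfl fun l _ => ?_
        rw [Units.val_mul, Matrix.mul_apply]
        congr 1
        exact Finset.sum_congr rfl fun i _ => mul_comm _ _ }

/-- The points of `Y_H` over `k`: the `H`-orbits of isomorphism classes of pairs `(E, (P, Q))`. -/
def LevelModuli (H : Subgroup (GL (Fin 2) (ZMod p))) : Type _ :=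
  Quotient (FullLevelPair.setoid p k H)

/-- The elliptic points of `Y_H` with `g` of order `r`: points represented by `(E, (P, Q))` for which
an automorphism of `E` induces an element `g` of order `r` of `PGL(E[p])` that preserves
the orbit `(P, Q) H`. -/
def ellipticLevelPoints (H : Subgroup (GL (Fin 2) (ZMod p))) (r : ℕ) : Set (LevelModuli p k H) :=
  {x | ∃ (E : WeierstrassCurve k) (hE : E.IsElliptic)
      (b : Module.Basis (Fin 2) (ZMod p) (Torsion p E))
      (f : E.toAffine.Point ≃+ E.toAffine.Point),
    x = Quotient.mk _ ⟨E, hE, b⟩ ∧ IsIsom E E f ∧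
      orderOf (toPGL (torsionEquiv p f)) = r ∧
      ∃ M ∈ H, ∀ j, torsionEquiv p f (b j) = ∑ i, M.val i j • b i}

end Curves

end NspNecklace

end

/-! Up to isomorphism, an automorphism whose image in `PGL(E[p])` has order 2 lives on y² = x³ + x,
and one whose image has order 3 lives on y² = x³ + 1. On either curve all automorphisms are, up to
sign, powers of a single one, g. Signs act trivially on the lines of E[p], and a power of g fixes
every necklace that g fixes. Hence, when g has the required order, the elliptic points are in
bijection with the necklaces of E[p] fixed by g (`IsStandard.ellipticPoints_eq`,
`IsStandard.injOn`).

Necklaces reduce to linear algebra. Let X² - tX + n be the minimal polynomial of γ and δ = t²/4 - n,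
a nonsquare. A rotation is t/2 + N with N² = δ; since t ≠ 0, it is determined by its class in PGL.
Thus oriented necklaces are the square roots N of δ, the involution w is N ↦ -N, and a necklace is a
pair ±N. It is fixed by g exactly when N commutes or anticommutes with g
(`HasTraceNorm.two_mul_ncard_fixed`). Let χ be the quadratic character of 𝔽_p. If g² = -1 and g is
not scalar, there are 1 - χ(-1) commuting N and p - χ(-1) anticommuting ones, the latter being the
solutions of x² + y² = δ. If 1 + g + g² = 0 and g is not scalar, there are 1 - χ(-3) commuting N and
no anticommuting one. Halving gives the two formulas.

It remains to see whether g is scalar on E[p]. In the first case it never is (`not_scalar_two`):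
otherwise p = m² + m'² with m + m'g killing all p² points of E[p], whereas its kernel has order m² +
m'² = p. In the second case it may be, but then there are no elliptic points, and -3 is a square, so
the formula also gives 0.

The orders of E[p] and of ker(m + m'g) come from a degree theory. Rational maps E → E that commute
with negation are points, over k(X), of the twist of E by its own cubic f. The degree of the
x-coordinate is a quadratic form on these points (`HasHeight.parallelogram`), and it counts the
kernel when it is nonzero in k (`Interpolates.card_ker`).

For the second description, a basis of E[p] is sent to the endomorphism whose matrix in it is that
of multiplication by γ - t/2. The normaliser of the Cartan subgroup consists of the matrices that
commute or anticommute with this one, so orbits of bases are necklaces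
(`HasTraceNorm.necklaceOfBasis_eq_iff`). -/

open scoped LinearAlgebra.Projectivization

noncomputable section

namespace NspNecklace

/-! ### The x-coordinates of P + Q and P - Q on a short Weierstrass curve. -/

section ParallelogramLaw

open Polynomial WeierstrassCurve

/-- The short Weierstrass curve `y² = x³ + ax + b`. -/
abbrev shortCurve {R : Type*} [CommRing R] (a b : R) : WeierstrassCurve R := ⟨0, 0, 0, a, b⟩

lemma shortCurve_equation_iff {R : Type*} [CommRing R] (a b x y : R) :
    (shortCurve a b).toAffine.Equation x y ↔ y ^ 2 = x ^ 3 + a * x + b := by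
  rw [Affine.equation_iff]
  simp

lemma shortCurve_nonsingular_iff {F : Type*} [Field F] (h2 : (2 : F) ≠ 0) {a b : F}
    (hΔ : 4 * a ^ 3 + 27 * b ^ 2 ≠ 0) (x y : F) :
    (shortCurve a b).toAffine.Nonsingular x y ↔ y ^ 2 = x ^ 3 + a * x + b := by
  rw [Affine.nonsingular_iff, shortCurve_equation_iff]
  refine ⟨And.left, fun h => ⟨h, ?_⟩⟩
  simp only [zero_mul, sub_zero, mul_zero, add_zero]
  by_contra! hc
  have hy : y = 0 := by
    have h' : 2 * y = 0 := by linear_combination hc.2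
    exact (mul_eq_zero.mp h').resolve_left h2
  have h1 : 3 * x ^ 2 + a = 0 := by linear_combination -hc.1
  have h3 : x ^ 3 + a * x + b = 0 := by rw [← h, hy]; ring
  -- The discriminant is a polynomial combination of the cubic and its derivative.
  exact hΔ (by linear_combination (4 * a ^ 2 + 6 * a * x ^ 2 - 9 * b * x) * h1 + (27 * b - 18 * a * x) * h3)

variable {F : Type*} [Field F] [DecidableEq F] {a b : F}

omit [DecidableEq F] in
lemma shortCurve_neg_some {x y : F} (h : (shortCurve a b).toAffine.Nonsingular x y) :
    ∃ h', -Affine.Point.some x y h = .some x (-y) h' := by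
  have e : (shortCurve a b).toAffine.negY x y = -y := by simp [Affine.negY]
  have h' := (Affine.nonsingular_neg x y).mpr h
  rw [e] at h'
  refine ⟨h', ?_⟩
  rw [Affine.Point.neg_some, Affine.Point.some.injEq]
  exact ⟨rfl, e⟩

/-- The slope enters through a relation without division. The same formula can then be used over
k(X) and, after specialising ℓ, over k. -/
lemma shortCurve_add_some {x₁ y₁ x₂ y₂ ℓ x₃ : F}
    (h₁ : (shortCurve a b).toAffine.Nonsingular x₁ y₁)
    (h₂ : (shortCurve a b).toAffine.Nonsingular x₂ y₂)
    (hℓ : x₁ ≠ x₂ ∧ ℓ * (x₁ - x₂) = y₁ - y₂ ∨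
      x₁ = x₂ ∧ y₁ = y₂ ∧ 2 * y₁ ≠ 0 ∧ ℓ * (2 * y₁) = 3 * x₁ ^ 2 + a)
    (hx : x₃ = ℓ ^ 2 - x₁ - x₂) :
    ∃ h, Affine.Point.some x₁ y₁ h₁ + .some x₂ y₂ h₂ = .some x₃ (-(ℓ * (x₃ - x₁) + y₁)) h := by
  have hxy : ¬(x₁ = x₂ ∧ y₁ = (shortCurve a b).toAffine.negY x₂ y₂) := by
    rintro ⟨e, e'⟩
    simp only [Affine.negY, zero_mul, sub_zero] at e'
    rcases hℓ with ⟨h, -⟩ | ⟨-, h, h', -⟩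
    · exact h e
    · exact h' (by rw [two_mul]; nth_rw 2 [h]; rw [e']; ring)
  have hs : (shortCurve a b).toAffine.slope x₁ x₂ y₁ y₂ = ℓ := by
    rcases hℓ with ⟨h, h'⟩ | ⟨rfl, rfl, h', h''⟩
    · rw [Affine.slope_of_X_ne h, div_eq_iff (sub_ne_zero.mpr h), h']
    · rw [Affine.slope_of_Y_ne rfl (fun h => hxy ⟨rfl, h⟩), div_eq_iff]
      · simp only [Affine.negY]
        linear_combination -h''
      · simp only [Affine.negY]
        intro h
        exact h' (by linear_combination h)
  have hadd := Affine.Point.add_some hxy (h₁ := h₁) (h₂ := h₂)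
  have hX : (shortCurve a b).toAffine.addX x₁ x₂
      ((shortCurve a b).toAffine.slope x₁ x₂ y₁ y₂) = x₃ := by
    rw [hs, hx]; simp [Affine.addX]
  have hY : (shortCurve a b).toAffine.addY x₁ x₂ y₁
      ((shortCurve a b).toAffine.slope x₁ x₂ y₁ y₂) = -(ℓ * (x₃ - x₁) + y₁) := by
    rw [Affine.addY, Affine.negAddY, hX, hs]
    simp [Affine.negY]
  have h₃ := Affine.nonsingular_add h₁ h₂ hxy
  rw [hX, hY] at h₃
  refine ⟨h₃, ?_⟩
  rw [hadd, Affine.Point.some.injEq]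
  exact ⟨hX, hY⟩

/-- The duplication formula in projective form. The free factor c absorbs the denominator 4y² and
also covers the case 2P = 0. -/
lemma exists_mul_sym2x_self (h2 : (2 : F) ≠ 0) {x y : F} (h : (shortCurve a b).toAffine.Nonsingular x y) :
    ∃ c : F, c • (Affine.Point.some x y h + .some x y h).xRep =
      ![(x ^ 2 - a) ^ 2 - 8 * b * x, 4 * (x ^ 3 + a * x + b)] := by
  have e := (shortCurve_equation_iff a b x y).mp h.1
  by_cases hy : y = 0
  · refine ⟨(x ^ 2 - a) ^ 2 - 8 * b * x, ?_⟩
    rw [Affine.Point.add_self_of_Y_eq (by simp [Affine.negY, hy]), Affine.Point.xRep_zero,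
      ← e, hy]
    simp
  · obtain ⟨h', e'⟩ := shortCurve_add_some (ℓ := (3 * x ^ 2 + a) / (2 * y)) h h
      (Or.inr ⟨rfl, rfl, mul_ne_zero h2 hy, by field_simp⟩) rfl
    refine ⟨4 * y ^ 2, ?_⟩
    rw [e', Affine.Point.xRep_some, ← e]
    ext i
    fin_cases i
    · simp
      field_simp
      linear_combination (-4*(8*x)) * e
    · simp

/-- The polynomial map giving `(x(P+Q) x(P-Q) : x(P+Q) + x(P-Q) : 1)` in terms of
`(s : t : u) = (x(P) x(Q) : x(P) + x(Q) : 1)`. -/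
lemma exists_mul_sym2x (h2 : (2 : F) ≠ 0) (P Q : (shortCurve a b).toAffine.Point) :
    ∃ c : F, ∀ s t u, P.sym2x Q = ![s, t, u] →
      c • (P + Q).sym2x (P - Q) =
        ![s ^ 2 - 2 * a * s * u - 4 * b * t * u + a ^ 2 * u ^ 2,
          2 * t * s + 2 * a * t * u + 4 * b * u ^ 2, t ^ 2 - 4 * s * u] := by
  rcases P with _ | ⟨x₁, y₁, h₁⟩
  · refine ⟨1, fun s t u h => ?_⟩
    rw [← Affine.Point.zero_def] at h ⊢
    rw [zero_add, zero_sub, Affine.Point.sym2x_neg_right]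
    simp only [Affine.Point.sym2x, Affine.Point.xRep_zero] at h ⊢
    obtain ⟨hs, ht, hu⟩ : Q.xRep 0 = s ∧ Q.xRep 1 = t ∧ 0 = u := by simpa using h
    subst hs ht hu
    ext i
    fin_cases i <;> simp <;> ring
  rcases Q with _ | ⟨x₂, y₂, h₂⟩
  · refine ⟨1, fun s t u h => ?_⟩
    rw [← Affine.Point.zero_def] at h ⊢
    rw [add_zero, sub_zero]
    simp only [Affine.Point.sym2x, Affine.Point.xRep_zero, Affine.Point.xRep_some] at h ⊢
    obtain ⟨hs, ht, hu⟩ : x₁ = s ∧ 1 = t ∧ 0 = u := by simpa using h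
    subst hs ht hu
    ext i
    fin_cases i <;> simp <;> ring
  have e₁ := (shortCurve_equation_iff a b x₁ y₁).mp h₁.1
  have e₂ := (shortCurve_equation_iff a b x₂ y₂).mp h₂.1
  have hstu : ∀ s t u : F, (Affine.Point.some x₁ y₁ h₁).sym2x (.some x₂ y₂ h₂) = ![s, t, u] →
      x₁ * x₂ = s ∧ x₁ + x₂ = t ∧ 1 = u := fun s t u h => by simpa using h
  by_cases hx : x₁ = x₂
  -- Here Q = ±P, so one of P + Q and P - Q is zero and the other is ±2P.
  · subst hx
    obtain ⟨c, hc⟩ := exists_mul_sym2x_self h2 h₁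
    have hc0 := congrFun hc 0
    have hc1 := congrFun hc 1
    simp only [Pi.smul_apply, smul_eq_mul, Matrix.cons_val_zero, Matrix.cons_val_one] at hc0 hc1
    refine ⟨c, fun s t u h => ?_⟩
    obtain ⟨rfl, rfl, rfl⟩ := hstu s t u h
    rcases (Affine.Point.X_eq_iff (h₁ := h₁) (h₂ := h₂)).mp rfl with h' | h'
    · rw [← h', sub_self]
      ext i
      fin_cases i
      · simp [Affine.Point.sym2x]; linear_combination hc0
      · simp [Affine.Point.sym2x]; linear_combination hc1
      · simp [Affine.Point.sym2x]; ring
    · have h'' : Affine.Point.some x₁ y₂ h₂ = -Affine.Point.some x₁ y₁ h₁ := by rw [h', neg_neg]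
      rw [h'', add_neg_cancel, sub_neg_eq_add]
      ext i
      fin_cases i
      · simp [Affine.Point.sym2x]; linear_combination hc0
      · simp [Affine.Point.sym2x]; linear_combination hc1
      · simp [Affine.Point.sym2x]; ring
  · have hx' := sub_ne_zero.mpr hx
    refine ⟨(x₁ - x₂) ^ 2, fun s t u h => ?_⟩
    obtain ⟨rfl, rfl, rfl⟩ := hstu s t u h
    obtain ⟨h₂', e₂'⟩ := shortCurve_neg_some h₂
    obtain ⟨h₃, e₃⟩ := shortCurve_add_some (ℓ := (y₁ - y₂) / (x₁ - x₂)) h₁ h₂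
      (Or.inl ⟨hx, by field_simp⟩) rfl
    obtain ⟨h₄, e₄⟩ := shortCurve_add_some (ℓ := (y₁ - -y₂) / (x₁ - x₂)) h₁ h₂'
      (Or.inl ⟨hx, by field_simp⟩) rfl
    rw [sub_eq_add_neg (Affine.Point.some x₁ y₁ h₁), e₂', e₃, e₄]
    ext i
    fin_cases i
    · simp
      field_simp
      linear_combination ((y₁ ^ 2 + (x₁ ^ 3 + a * x₁ + b)) - 2 * y₂ ^ 2 -
        2 * (x₁ + x₂) * (x₁ - x₂) ^ 2) * e₁ + ((y₂ ^ 2 + (x₂ ^ 3 + a * x₂ + b)) -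
        2 * (x₁ ^ 3 + a * x₁ + b) - 2 * (x₁ + x₂) * (x₁ - x₂) ^ 2) * e₂
    · simp
      field_simp
      linear_combination 2 * e₁ + 2 * e₂
    · simp
      ring

end ParallelogramLaw

/-! ### The degree of the x-coordinate as a quadratic form on the twist over k(X). -/

section Heights

open Polynomial WeierstrassCurve

/-- These are the coefficients of the product of two nonzero linear forms. -/
lemma sym_ne_zero {k : Type*} [Field k] {a b c d : k} (h : a ≠ 0 ∨ b ≠ 0) (h' : c ≠ 0 ∨ d ≠ 0) :
    a * c ≠ 0 ∨ a * d + b * c ≠ 0 ∨ b * d ≠ 0 := by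
  by_contra! hc
  obtain ⟨h1, h2, h3⟩ := hc
  rcases mul_eq_zero.mp h1 with rfl | rfl <;> rcases mul_eq_zero.mp h3 with rfl | rfl <;> simp_all

section addSub

variable {R : Type*} [CommRing R] (a b s t u : R)

/-- The three coordinates of the map giving `(x(P+Q) x(P-Q) : x(P+Q) + x(P-Q) : 1)`. -/
def addSubS : R := s ^ 2 - 2 * a * s * u - 4 * b * t * u + a ^ 2 * u ^ 2

/-- See `addSubS`. -/
def addSubT : R := 2 * t * s + 2 * a * t * u + 4 * b * u ^ 2

/-- See `addSubS`. -/
def addSubU : R := t ^ 2 - 4 * s * u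

/-- The fourth powers of s, t and u, multiplied by 16(4a³ + 27b²), lie in the ideal generated by the
three quadratic forms. Hence the forms have no common zero in the projective plane. -/
lemma addSub_ne_zero {k : Type*} [Field k] (h2 : (2 : k) ≠ 0) {a b s t u : k}
    (hΔ : 4 * a ^ 3 + 27 * b ^ 2 ≠ 0) (h : s ≠ 0 ∨ t ≠ 0 ∨ u ≠ 0) :
    addSubS a b s t u ≠ 0 ∨ addSubT a b s t u ≠ 0 ∨ addSubU s t u ≠ 0 := by
  by_contra! hc
  obtain ⟨hS, hT, hU⟩ := hc
  simp only [addSubS, addSubT, addSubU] at hS hT hU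
  have h16 : (16 : k) * (4 * a ^ 3 + 27 * b ^ 2) ≠ 0 :=
    mul_ne_zero (by convert pow_ne_zero 4 h2; norm_num) hΔ
  have hs : 16 * (4 * a ^ 3 + 27 * b ^ 2) * s ^ 4 = 0 := by
    linear_combination
      (-1) * ((-64*a^3-432*b^2)*s^2 + (-32*a^2*b+40*a^2*b)*s*t + (32*a*b^2)*s*u +
        (-12*a^4-96*a*b^2)*t^2 + (-24*a^3*b-192*b^3)*t*u) * hS
      - ((16*a^2*b-20*a^2*b)*s^2 + (-64*a*b^2-10*a^4)*s*t + (-8*a^3*b)*s*u +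
        (-24*a^3*b-192*b^3)*t^2 + (6*a^5+48*a^2*b^2)*t*u) * hT
      - ((32*a^4+224*a*b^2)*s^2 + (48*a^3*b+384*b^3)*s*t + (-16*a^5-128*a^2*b^2)*s*u) * hU
  have ht : 16 * (4 * a ^ 3 + 27 * b ^ 2) * t ^ 4 = 0 := by
    linear_combination
      (-1) * (384*b*s*t + 64*a^2*t^2 + 128*a*b*t*u) * hS
      - (-192*b*s^2 - 32*a^2*s*t + 128*a*b*t^2 - 32*a^3*t*u) * hT
      - (-256*a*b*s*t - 192*b^2*s*u + (-64*a^3-432*b^2)*t^2) * hU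
  have hu : 16 * (4 * a ^ 3 + 27 * b ^ 2) * u ^ 4 = 0 := by
    linear_combination
      (-1) * (-12*t^2 - 64*a*u^2) * hS - (6*s*t - 10*a*t*u - 108*b*u^2) * hT
      - (-16*a*s*u - 48*b*t*u + 32*a^2*u^2) * hU
  simp [h16] at hs ht hu
  simp_all

end addSub

variable {k : Type*} [Field k]

/-- `N` is the largest degree of the components of a nonzero vector of polynomials. -/
def HasMaxDegree {ι : Type*} (v : ι → k[X]) (N : ℕ) : Prop :=
  (∀ i, (v i).natDegree ≤ N) ∧ ∃ i, (v i).coeff N ≠ 0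

lemma HasMaxDegree.unique {ι : Type*} {v : ι → k[X]} {M N : ℕ} (hM : HasMaxDegree v M)
    (hN : HasMaxDegree v N) : M = N := by
  obtain ⟨h₁, i, hi⟩ := hM
  obtain ⟨h₂, j, hj⟩ := hN
  exact le_antisymm ((le_natDegree_of_ne_zero hi).trans (h₂ i))
    ((le_natDegree_of_ne_zero hj).trans (h₁ j))

lemma HasMaxDegree.of_smul {ι : Type*} {v w : ι → k[X]} {N : ℕ} {c : k} (hc : c ≠ 0)
    (h : ∀ i, v i = C c * w i) (hv : HasMaxDegree v N) : HasMaxDegree w N := by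
  obtain ⟨h₁, i, hi⟩ := hv
  refine ⟨fun i => ?_, i, fun h0 => hi ?_⟩
  · have := h₁ i
    rwa [h, natDegree_C_mul hc] at this
  · rw [h, coeff_C_mul, h0, mul_zero]

lemma hasMaxDegree_pair {A B : k[X]} (h : A ≠ 0 ∨ B ≠ 0) :
    HasMaxDegree ![A, B] (max A.natDegree B.natDegree) := by
  refine ⟨fun i => by fin_cases i <;> simp, ?_⟩
  by_contra! hc
  have h0 : A.coeff (max A.natDegree B.natDegree) = 0 := hc 0
  have h1 : B.coeff (max A.natDegree B.natDegree) = 0 := hc 1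
  rcases le_total A.natDegree B.natDegree with hle | hle
  · rw [max_eq_right hle] at h0 h1
    have hB : B = 0 := by simpa using h1
    subst hB
    simp only [natDegree_zero, nonpos_iff_eq_zero] at hle h0
    have hA : A = 0 := by
      rw [← hle] at h0; simpa using h0
    simp_all
  · rw [max_eq_left hle] at h0 h1
    have hA : A = 0 := by simpa using h0
    subst hA
    simp only [natDegree_zero, nonpos_iff_eq_zero] at hle h1
    have hB : B = 0 := by
      rw [← hle] at h1; simpa using h1
    simp_all

/-- The coefficients in top degree are the values at infinity. By `sym_ne_zero` they do not all
cancel. -/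
lemma HasMaxDegree.sym {A B E F : k[X]} {M N : ℕ} (h : HasMaxDegree ![A, B] M)
    (h' : HasMaxDegree ![E, F] N) :
    HasMaxDegree ![A * E, A * F + B * E, B * F] (M + N) := by
  obtain ⟨hle, hne⟩ := h
  obtain ⟨hle', hne'⟩ := h'
  simp only [Fin.forall_fin_two, Fin.exists_fin_two, Matrix.cons_val_zero,
    Matrix.cons_val_one] at hle hne hle' hne'
  obtain ⟨hA, hB⟩ := hle
  obtain ⟨hE, hF⟩ := hle'
  refine ⟨fun i => ?_, ?_⟩
  · fin_cases i
    · exact natDegree_mul_le_of_le hA hE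
    · exact natDegree_add_le_of_degree_le (natDegree_mul_le_of_le hA hF)
        (natDegree_mul_le_of_le hB hE)
    · exact natDegree_mul_le_of_le hB hF
  · simp only [Fin.exists_fin_succ, Matrix.cons_val_zero, Matrix.cons_val_succ, coeff_add,
      coeff_mul_add_eq_of_natDegree_le hA hE, coeff_mul_add_eq_of_natDegree_le hA hF,
      coeff_mul_add_eq_of_natDegree_le hB hE, coeff_mul_add_eq_of_natDegree_le hB hF]
    simpa using sym_ne_zero hne hne'

/-- Quadratic forms without a common zero exactly double the degree: `addSub_ne_zero` applies to the
vector of top coefficients. -/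
lemma HasMaxDegree.addSub (h2 : (2 : k) ≠ 0) {a b : k} (hΔ : 4 * a ^ 3 + 27 * b ^ 2 ≠ 0)
    {s t u : k[X]} {M : ℕ} (h : HasMaxDegree ![s, t, u] M) :
    HasMaxDegree ![addSubS (C a) (C b) s t u, addSubT (C a) (C b) s t u, addSubU s t u]
      (M + M) := by
  obtain ⟨hle, hne⟩ := h
  simp only [Fin.forall_fin_succ, Fin.exists_fin_succ, Matrix.cons_val_zero,
    Matrix.cons_val_succ] at hle hne
  obtain ⟨hs, ht, hu, -⟩ := hle
  have hne : s.coeff M ≠ 0 ∨ t.coeff M ≠ 0 ∨ u.coeff M ≠ 0 := by simpa using hne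
  have eS : addSubS (C a) (C b) s t u = s * s - C (2 * a) * (s * u) - C (4 * b) * (t * u) +
      C (a ^ 2) * (u * u) := by simp only [addSubS, map_mul, map_pow, map_ofNat]; ring
  have eT : addSubT (C a) (C b) s t u = C 2 * (t * s) + C (2 * a) * (t * u) +
      C (4 * b) * (u * u) := by simp only [addSubT, map_mul, map_ofNat]; ring
  have eU : addSubU s t u = t * t - C 4 * (s * u) := by
    simp only [addSubU, map_ofNat]; ring
  have hd : ∀ (c : k) {f g : k[X]}, f.natDegree ≤ M → g.natDegree ≤ M →
      (C c * (f * g)).natDegree ≤ M + M := fun c f g hf hg =>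
    (natDegree_C_mul_le _ _).trans (natDegree_mul_le_of_le hf hg)
  have hsub : ∀ {f g : k[X]}, f.natDegree ≤ M + M → g.natDegree ≤ M + M →
      (f - g).natDegree ≤ M + M := fun hf hg =>
    (natDegree_sub_le_of_le hf hg).trans (max_self _).le
  refine ⟨fun i => ?_, ?_⟩
  · fin_cases i
    · change (addSubS (C a) (C b) s t u).natDegree ≤ M + M
      rw [eS]
      exact natDegree_add_le_of_degree_le (hsub (hsub
        (natDegree_mul_le_of_le hs hs) (hd _ hs hu)) (hd _ ht hu)) (hd _ hu hu)
    · change (addSubT (C a) (C b) s t u).natDegree ≤ M + M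
      rw [eT]
      exact natDegree_add_le_of_degree_le (natDegree_add_le_of_degree_le (hd _ ht hs)
        (hd _ ht hu)) (hd _ hu hu)
    · change (addSubU s t u).natDegree ≤ M + M
      rw [eU]
      exact hsub (natDegree_mul_le_of_le ht ht) (hd _ hs hu)
  · have := addSub_ne_zero h2 hΔ hne
    simp only [Fin.exists_fin_succ, Matrix.cons_val_zero, Matrix.cons_val_succ, eS, eT, eU,
      coeff_add, coeff_sub, coeff_C_mul,
      coeff_mul_add_eq_of_natDegree_le hs hs, coeff_mul_add_eq_of_natDegree_le hs hu,
      coeff_mul_add_eq_of_natDegree_le ht hu, coeff_mul_add_eq_of_natDegree_le hu hu,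
      coeff_mul_add_eq_of_natDegree_le ht hs, coeff_mul_add_eq_of_natDegree_le ht ht]
    simp only [addSubS, addSubT, addSubU] at this
    rcases this with h | h | h
    · left; convert h using 1; ring
    · right; left; convert h using 1; ring
    · right; right; left; convert h using 1; ring

/-- Two coprime pairs of polynomials give a primitive triple. -/
lemma isCoprime_pair_eval {A B : k[X]} (h : IsCoprime A B) (z : k) : A.eval z ≠ 0 ∨ B.eval z ≠ 0 := by
  obtain ⟨α, β, h⟩ := h
  by_contra! hc
  have := congrArg (eval z) h
  simp [hc.1, hc.2] at this

/-- A zero of the denominator of c would be a common zero of w, and a zero of its numerator a common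
zero of v. So c has neither zeros nor poles and is constant. -/
lemma exists_smul_eq_of_smul_eq [IsAlgClosed k] {v w : Fin 3 → k[X]}
    (hv : ∀ z, ∃ i, (v i).eval z ≠ 0) (hw : ∀ z, ∃ i, (w i).eval z ≠ 0) {c : RatFunc k}
    (h : ∀ i, c * algebraMap k[X] (RatFunc k) (w i) = algebraMap k[X] (RatFunc k) (v i)) :
    ∃ e : k, e ≠ 0 ∧ ∀ i, v i = C e * w i := by
  have hcop := RatFunc.isCoprime_num_denom c
  have hnd : ∀ i, c.num * w i = c.denom * v i := fun i => by
    apply RatFunc.algebraMap_injective k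
    have hd : algebraMap k[X] (RatFunc k) c.denom ≠ 0 :=
      RatFunc.algebraMap_ne_zero c.denom_ne_zero
    have hc : c * algebraMap k[X] (RatFunc k) c.denom = algebraMap k[X] (RatFunc k) c.num :=
      (eq_div_iff hd).mp (RatFunc.num_div_denom c).symm
    rw [map_mul, map_mul, ← h i, ← hc]
    ring
  have hunit : ∀ {f : k[X]}, (∀ z, f.eval z ≠ 0) → ∃ e : k, e ≠ 0 ∧ f = C e := fun {f} hf => by
    have hdeg : f.degree = 0 := by
      by_contra hd
      obtain ⟨z, hz⟩ := IsAlgClosed.exists_root f hd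
      exact hf z hz
    have := eq_C_of_degree_eq_zero hdeg
    refine ⟨f.coeff 0, fun h0 => ?_, this⟩
    rw [h0, C_0] at this
    simp [this] at hdeg
  obtain ⟨d, hd0, hd⟩ := hunit (f := c.denom) fun z hz => by
    rcases isCoprime_pair_eval hcop z with hn | hn
    · obtain ⟨i, hi⟩ := hw z
      have := congrArg (eval z) (hnd i)
      rw [eval_mul, eval_mul, hz, zero_mul] at this
      exact mul_ne_zero hn hi this
    · exact hn hz
  obtain ⟨n, hn0, hn⟩ := hunit (f := c.num) fun z hz => by
    rcases isCoprime_pair_eval hcop z with hn | hn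
    · exact hn hz
    · obtain ⟨i, hi⟩ := hv z
      have := congrArg (eval z) (hnd i)
      rw [eval_mul, eval_mul, hz, zero_mul] at this
      exact mul_ne_zero hn hi this.symm
  refine ⟨d⁻¹ * n, mul_ne_zero (inv_ne_zero hd0) hn0, fun i => ?_⟩
  rw [map_mul, mul_assoc, ← hn, hnd i, hd, ← mul_assoc, ← C_mul, inv_mul_cancel₀ hd0, C_1, one_mul]

instance : DecidableEq (RatFunc k) := Classical.decEq _

variable (a b : k)

/-- The cubic `X³ + aX + b`, as a rational function. -/
def cubic : RatFunc k := algebraMap k[X] (RatFunc k) (X ^ 3 + C a * X + C b)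

/-- The twist of `y² = x³ + ax + b` over `k(X)` by the cubic `f = X³ + aX + b`: its points
correspond to the points `(x, y √f)` with `x` and `y` in `k(X)`. -/
abbrev genericTwist : WeierstrassCurve (RatFunc k) :=
  shortCurve (RatFunc.C a * cubic a b ^ 2) (RatFunc.C b * cubic a b ^ 3)

variable {a b}

lemma cubic_ne_zero : cubic a b ≠ 0 := by
  refine RatFunc.algebraMap_ne_zero fun h => ?_
  have := congrArg (coeff · 3) h
  simp at this

/-- The degree of the `x`-coordinate of a point of the twist. -/
def HasHeight (P : (genericTwist a b).toAffine.Point) (N : ℕ) : Prop :=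
  ∃ A B : k[X], IsCoprime A B ∧ HasMaxDegree ![A, B] N ∧
    ∃ c : RatFunc k, c ≠ 0 ∧ P.xRep 0 = c * (cubic a b * algebraMap k[X] (RatFunc k) A) ∧
      P.xRep 1 = c * algebraMap k[X] (RatFunc k) B

lemma exists_hasHeight (P : (genericTwist a b).toAffine.Point) : ∃ N, HasHeight P N := by
  rcases P with _ | ⟨x, y, h⟩
  · refine ⟨_, 1, 0, isCoprime_one_left, hasMaxDegree_pair (Or.inl one_ne_zero),
      (cubic a b)⁻¹, inv_ne_zero cubic_ne_zero, ?_, ?_⟩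
    · rw [← Affine.Point.zero_def, Affine.Point.xRep_zero]
      simp [cubic_ne_zero]
    · rw [← Affine.Point.zero_def, Affine.Point.xRep_zero]
      simp
  · set r := x / cubic a b with hr
    have hd : algebraMap k[X] (RatFunc k) r.denom ≠ 0 :=
      RatFunc.algebraMap_ne_zero r.denom_ne_zero
    refine ⟨_, r.num, r.denom, r.isCoprime_num_denom,
      hasMaxDegree_pair (Or.inr r.denom_ne_zero), (algebraMap k[X] (RatFunc k) r.denom)⁻¹,
      inv_ne_zero hd, ?_, ?_⟩
    · rw [Affine.Point.xRep_some]
      have : x = cubic a b * r := by rw [hr]; field_simp [cubic_ne_zero]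
      simp only [Matrix.cons_val_zero]
      nth_rw 1 [this, ← RatFunc.num_div_denom r]
      field_simp
    · rw [Affine.Point.xRep_some]
      simp [hd]

/-- The triple of (P + Q, P - Q) is proportional to the quadratic forms in the triple of (P, Q).
Both are primitive, so they agree up to a constant. The degree of the first is m' + n', and that of
the second is 2(m + n). -/
lemma HasHeight.parallelogram [IsAlgClosed k] (h2 : (2 : k) ≠ 0) (hΔ : 4 * a ^ 3 + 27 * b ^ 2 ≠ 0)
    {P Q : (genericTwist a b).toAffine.Point} {m n m' n' : ℕ} (hP : HasHeight P m)
    (hQ : HasHeight Q n) (hadd : HasHeight (P + Q) m') (hsub : HasHeight (P - Q) n') :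
    m' + n' = 2 * m + 2 * n := by
  obtain ⟨A₁, B₁, hc₁, hd₁, c₁, hc₁0, hA₁, hB₁⟩ := hP
  obtain ⟨A₂, B₂, hc₂, hd₂, c₂, hc₂0, hA₂, hB₂⟩ := hQ
  obtain ⟨A₃, B₃, hc₃, hd₃, c₃, hc₃0, hA₃, hB₃⟩ := hadd
  obtain ⟨A₄, B₄, hc₄, hd₄, c₄, hc₄0, hA₄, hB₄⟩ := hsub
  have h2' : (2 : RatFunc k) ≠ 0 := by
    rw [← map_ofNat (RatFunc.C (K := k)) 2]
    simpa using h2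
  obtain ⟨c, hc⟩ := exists_mul_sym2x h2' P Q
  have hf := cubic_ne_zero (a := a) (b := b)
  have hc := hc _ _ _ rfl
  have hC : ∀ e : k, algebraMap k[X] (RatFunc k) (C e) = RatFunc.C e := fun e => RatFunc.algebraMap_C e
  set f := cubic a b with hfdef
  have h0 := congrFun hc 0
  have h1 := congrFun hc 1
  have h3 := congrFun hc 2
  simp only [Affine.Point.sym2x, hA₁, hB₁, hA₂, hB₂, hA₃, hB₃, hA₄, hB₄, Pi.smul_apply, smul_eq_mul,
    Matrix.cons_val] at h0 h1 h3
  have hsym := hd₁.sym hd₂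
  -- The coefficients a f² and b f³ of the twist make the three forms weighted homogeneous in f, so
  -- dividing by f² leaves the same ratio in every coordinate.
  set d := c * (c₃ * c₄) / ((c₁ * c₂) ^ 2 * f ^ 2) with hd
  have hd' : (c₁ * c₂) ^ 2 * f ^ 2 * d = c * (c₃ * c₄) := by
    rw [hd]
    field_simp
  obtain ⟨e, he, hev⟩ := exists_smul_eq_of_smul_eq
    (v := ![addSubS (C a) (C b) (A₁ * A₂) (A₁ * B₂ + B₁ * A₂) (B₁ * B₂),
      addSubT (C a) (C b) (A₁ * A₂) (A₁ * B₂ + B₁ * A₂) (B₁ * B₂),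
      addSubU (A₁ * A₂) (A₁ * B₂ + B₁ * A₂) (B₁ * B₂)])
    (w := ![A₃ * A₄, A₃ * B₄ + B₃ * A₄, B₃ * B₄]) (c := d)
    (fun z => by
      have := addSub_ne_zero h2 hΔ
        (sym_ne_zero (isCoprime_pair_eval hc₁ z) (isCoprime_pair_eval hc₂ z))
      simpa [Fin.exists_fin_succ, addSubS, addSubT, addSubU] using this)
    (fun z => by
      have := sym_ne_zero (isCoprime_pair_eval hc₃ z) (isCoprime_pair_eval hc₄ z)
      simpa [Fin.exists_fin_succ] using this) (by
      have hcc : (c₁ * c₂) ^ 2 ≠ 0 := pow_ne_zero 2 (mul_ne_zero hc₁0 hc₂0)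
      intro i
      fin_cases i
      · simp only [addSubS, hC, map_add, map_sub, map_mul, map_pow, map_ofNat, Matrix.cons_val,
          Fin.zero_eta]
        refine mul_left_cancel₀ (mul_ne_zero hcc (pow_ne_zero 4 hf)) ?_
        linear_combination h0 + f ^ 2 * algebraMap k[X] (RatFunc k) A₃ *
          algebraMap k[X] (RatFunc k) A₄ * hd'
      · simp only [addSubT, hC, map_add, map_mul, map_pow, map_ofNat, Matrix.cons_val,
          Fin.mk_one]
        refine mul_left_cancel₀ (mul_ne_zero hcc (pow_ne_zero 3 hf)) ?_
        linear_combination h1 + f * (algebraMap k[X] (RatFunc k) A₃ *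
          algebraMap k[X] (RatFunc k) B₄ + algebraMap k[X] (RatFunc k) B₃ *
          algebraMap k[X] (RatFunc k) A₄) * hd'
      · simp only [addSubU, map_add, map_sub, map_mul, map_pow, map_ofNat, Matrix.cons_val,
          Fin.reduceFinMk]
        refine mul_left_cancel₀ (mul_ne_zero hcc (pow_ne_zero 2 hf)) ?_
        linear_combination h3 + algebraMap k[X] (RatFunc k) B₃ *
          algebraMap k[X] (RatFunc k) B₄ * hd')
  have := ((hsym.addSub h2 hΔ).of_smul he hev).unique (hd₃.sym hd₄)
  omega

/-- The degree of the `x`-coordinate of a point of the twist. -/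
def height (P : (genericTwist a b).toAffine.Point) : ℕ := (exists_hasHeight P).choose

lemma hasHeight_height (P : (genericTwist a b).toAffine.Point) : HasHeight P (height P) :=
  (exists_hasHeight P).choose_spec

lemma hasHeight_zero : HasHeight (0 : (genericTwist a b).toAffine.Point) 0 := by
  refine ⟨1, 0, isCoprime_one_left, ⟨fun i => by fin_cases i <;> simp, 0, by simp⟩,
      (cubic a b)⁻¹, inv_ne_zero cubic_ne_zero, ?_, ?_⟩ <;> rw [Affine.Point.xRep_zero] <;>
    simp [cubic_ne_zero]

/-- The law with Q = 0 reads 2 h(P) = 2n, so the height does not depend on the chosen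
representation. -/
lemma HasHeight.height_eq [IsAlgClosed k] (h2 : (2 : k) ≠ 0) (hΔ : 4 * a ^ 3 + 27 * b ^ 2 ≠ 0)
    {P : (genericTwist a b).toAffine.Point} {n : ℕ} (h : HasHeight P n) : height P = n := by
  have h0 := hasHeight_zero (a := a) (b := b)
  have h1 := hasHeight_height P
  have := HasHeight.parallelogram h2 hΔ h h0 (m' := height P) (n' := height P)
    (by rwa [add_zero]) (by rwa [sub_zero])
  omega

lemma eq_of_second_difference {g : ℤ → ℤ} {c : ℤ}
    (h : ∀ n, g (n + 1) + g (n - 1) = 2 * g n + 2 * c) (n : ℤ) :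
    g n = g 0 + n * (g 1 - g 0 - c) + n ^ 2 * c := by
  suffices H : ∀ n : ℕ, (g n = g 0 + n * (g 1 - g 0 - c) + n ^ 2 * c ∧
      g (n + 1) = g 0 + (n + 1) * (g 1 - g 0 - c) + (n + 1) ^ 2 * c) ∧
      g (-n) = g 0 + (-n) * (g 1 - g 0 - c) + (-n) ^ 2 * c ∧
      g (-n - 1) = g 0 + (-n - 1) * (g 1 - g 0 - c) + (-n - 1) ^ 2 * c by
    obtain ⟨m, rfl | rfl⟩ := n.eq_nat_or_neg
    · exact (H m).1.1
    · exact (H m).2.1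
  intro n
  induction n with
  | zero =>
    have := h 0
    simp only [zero_add, zero_sub] at this
    refine ⟨⟨by simp, by simp; ring⟩, by simp, ?_⟩
    simp only [Nat.cast_zero, neg_zero, zero_sub]
    linear_combination this
  | succ n ih =>
    obtain ⟨⟨h1, h2⟩, h3, h4⟩ := ih
    have e1 := h (n + 1)
    have e2 := h (-n - 1)
    rw [add_sub_cancel_right] at e1
    rw [sub_add_cancel] at e2
    push_cast
    refine ⟨⟨h2, ?_⟩, ?_, ?_⟩
    · linear_combination e1 + 2 * h2 - h1
    · rw [neg_add, ← sub_eq_add_neg]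
      exact h4
    · rw [neg_add, ← sub_eq_add_neg]
      linear_combination e2 + 2 * h4 - h3

lemma height_parallelogram [IsAlgClosed k] (h2 : (2 : k) ≠ 0) (hΔ : 4 * a ^ 3 + 27 * b ^ 2 ≠ 0)
    (P Q : (genericTwist a b).toAffine.Point) :
    (height (P + Q) : ℤ) + height (P - Q) = 2 * height P + 2 * height Q := by
  exact_mod_cast (hasHeight_height P).parallelogram h2 hΔ (hasHeight_height Q)
    (hasHeight_height _) (hasHeight_height _)

/-- By the parallelogram law, n ↦ h(R + nS) has constant second difference 2 h(S), hence is a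
quadratic polynomial. This is used in each of the two variables. -/
lemma height_zsmul_add_zsmul [IsAlgClosed k] (h2 : (2 : k) ≠ 0)
    (hΔ : 4 * a ^ 3 + 27 * b ^ 2 ≠ 0) (P Q : (genericTwist a b).toAffine.Point) (m n : ℤ) :
    (height (m • P + n • Q) : ℤ) = m ^ 2 * height P + n ^ 2 * height Q +
      m * n * (height (P + Q) - height P - height Q) := by
  have hpar := height_parallelogram h2 hΔ
  have hrec : ∀ R S : (genericTwist a b).toAffine.Point, ∀ n : ℤ, (height (R + n • S) : ℤ) =
      height R + n * (height (R + S) - height R - height S) + n ^ 2 * height S := fun R S n => by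
    have := eq_of_second_difference (g := fun n => (height (R + n • S) : ℤ))
      (c := height S) (fun n => by
        have := hpar (R + n • S) S
        rw [add_zsmul, sub_zsmul, one_zsmul, ← sub_eq_add_neg, ← add_assoc, ← add_sub_assoc, this]) n
    simpa using this
  have h0 : (height (0 : (genericTwist a b).toAffine.Point) : ℤ) = 0 := by
    exact_mod_cast hasHeight_zero.height_eq h2 hΔ
  have h1 := hrec 0 P m
  have h3 := hrec Q P m
  rw [zero_add, zero_add, h0] at h1
  rw [hrec (m • P) Q n, add_comm (m • P) Q, h3, h1, add_comm Q P]
  ring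

end Heights

/-! ### Specialising points of the twist to endomorphisms of the curve. -/

section Kernels

open Polynomial WeierstrassCurve Filter

variable {k : Type*} [Field k] {a b : k}

/-- The value of a rational function. -/
def ev (t : k) (r : RatFunc k) : k := r.eval (RingHom.id k) t

lemma eventually_eval_ne_zero {f : k[X]} (hf : f ≠ 0) : ∀ᶠ t in cofinite, f.eval t ≠ 0 := by
  rw [eventually_cofinite]
  simpa using f.rootSet_finite k |>.subset fun t ht => by
    simpa [mem_rootSet, hf] using ht

lemma eventually_denom_ne_zero (r : RatFunc k) :
    ∀ᶠ t in cofinite, eval₂ (RingHom.id k) t r.denom ≠ 0 :=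
  eventually_eval_ne_zero r.denom_ne_zero

/-- Evaluation takes the default value 0 at a pole, so it respects sums and products only away from
poles. The cofinite filter discards those points. -/
lemma eventually_ev_add (r s : RatFunc k) : ∀ᶠ t in cofinite, ev t (r + s) = ev t r + ev t s := by
  filter_upwards [eventually_denom_ne_zero r, eventually_denom_ne_zero s] with t hr hs
  exact RatFunc.eval_add _ _ hr hs

lemma eventually_ev_mul (r s : RatFunc k) : ∀ᶠ t in cofinite, ev t (r * s) = ev t r * ev t s := by
  filter_upwards [eventually_denom_ne_zero r, eventually_denom_ne_zero s] with t hr hs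
  exact RatFunc.eval_mul _ _ hr hs

lemma ev_algebraMap (t : k) (f : k[X]) : ev t (algebraMap k[X] (RatFunc k) f) = f.eval t := by
  simp [ev]

lemma ev_C (t c : k) : ev t (RatFunc.C c) = c := by simp [ev]

lemma eventually_ev_neg (r : RatFunc k) : ∀ᶠ t in cofinite, ev t (-r) = -ev t r := by
  filter_upwards [eventually_ev_mul (RatFunc.C (-1)) r] with t h
  rw [ev_C, map_neg, map_one] at h
  simpa using h

lemma eventually_ev_sub (r s : RatFunc k) : ∀ᶠ t in cofinite, ev t (r - s) = ev t r - ev t s := by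
  filter_upwards [eventually_ev_add r (-s), eventually_ev_neg s] with t h h'
  rw [sub_eq_add_neg, h, h', sub_eq_add_neg]

lemma eventually_ev_ne_zero {r : RatFunc k} (hr : r ≠ 0) : ∀ᶠ t in cofinite, ev t r ≠ 0 := by
  filter_upwards [eventually_denom_ne_zero r, eventually_eval_ne_zero (RatFunc.num_ne_zero hr)]
    with t h h'
  exact div_ne_zero h' h

lemma eventually_ev_ne {r s : RatFunc k} (h : r ≠ s) : ∀ᶠ t in cofinite, ev t r ≠ ev t s := by
  filter_upwards [eventually_ev_ne_zero (sub_ne_zero.mpr h), eventually_ev_sub r s] with t h h'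
  rw [h'] at h
  exact sub_ne_zero.mp h

lemma ev_cubic (t : k) : ev t (cubic a b) = t ^ 3 + a * t + b := by
  rw [cubic, ev_algebraMap]
  simp

variable [DecidableEq k]

/-- The specialisation at `(t, y)` of a point of the twist, on the curve `y² = x³ + ax + b`. -/
def SpecializesTo (t y : k) (p : (shortCurve a b).toAffine.Point) :
    (genericTwist a b).toAffine.Point → Prop
  | .zero => p = 0
  | .some X Y _ => ∃ h, p = .some (ev t X / ev t (cubic a b)) (y * ev t Y / ev t (cubic a b) ^ 2) h

/-- A point of the twist interpolates `φ` if it specialises to the values of `φ` at all but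
finitely many points. -/
def Interpolates (R : (genericTwist a b).toAffine.Point)
    (φ : (shortCurve a b).toAffine.Point →+ (shortCurve a b).toAffine.Point) : Prop :=
  ∀ᶠ t in cofinite, ∀ y, ∀ h : (shortCurve a b).toAffine.Nonsingular t y,
    SpecializesTo t y (φ (.some t y h)) R

lemma Interpolates.zero : Interpolates (0 : (genericTwist a b).toAffine.Point) 0 :=
  Eventually.of_forall fun _ _ _ => rfl

lemma Interpolates.neg {R : (genericTwist a b).toAffine.Point}
    {φ : (shortCurve a b).toAffine.Point →+ (shortCurve a b).toAffine.Point}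
    (hR : Interpolates R φ) : Interpolates (-R) (-φ) := by
  rcases R with _ | ⟨X, Y, hXY⟩
  · filter_upwards [hR] with t ht y h
    have : φ (.some t y h) = 0 := ht y h
    change -(φ (.some t y h)) = 0
    rw [this, neg_zero]
  · obtain ⟨h', e⟩ := shortCurve_neg_some hXY
    rw [e]
    filter_upwards [hR, eventually_ev_neg Y] with t ht hY y h
    obtain ⟨h'', e'⟩ := ht y h
    obtain ⟨h₃, e₃⟩ := shortCurve_neg_some h''
    have hy : y * ev t (-Y) / ev t (cubic a b) ^ 2 = -(y * ev t Y / ev t (cubic a b) ^ 2) := by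
      rw [hY]; ring
    change ∃ h, -(φ (.some t y _)) = _
    rw [e', e₃, hy]
    exact ⟨h₃, rfl⟩

/-- The addition law over k(X) specialises to the one over k wherever the slope, its defining
relation and its nonvanishing conditions survive evaluation, that is, for all but finitely many t.
-/
lemma Interpolates.add (h2 : (2 : k) ≠ 0) {R S : (genericTwist a b).toAffine.Point}
    {φ ψ : (shortCurve a b).toAffine.Point →+ (shortCurve a b).toAffine.Point}
    (hR : Interpolates R φ) (hS : Interpolates S ψ) : Interpolates (R + S) (φ + ψ) := by
  have h2' : (2 : RatFunc k) ≠ 0 := by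
    rw [← map_ofNat (RatFunc.C (K := k)) 2]
    simpa using h2
  rcases R with _ | ⟨X₁, Y₁, h₁⟩
  · rw [← Affine.Point.zero_def, zero_add]
    filter_upwards [hR, hS] with t ht ht' y h
    have : φ (.some t y h) = 0 := ht y h
    rw [AddMonoidHom.add_apply, this, zero_add]
    exact ht' y h
  rcases S with _ | ⟨X₂, Y₂, h₂⟩
  · rw [← Affine.Point.zero_def, add_zero]
    filter_upwards [hR, hS] with t ht ht' y h
    have : ψ (.some t y h) = 0 := ht' y h
    rw [AddMonoidHom.add_apply, this, add_zero]
    exact ht y h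
  by_cases hneg : Affine.Point.some X₁ Y₁ h₁ = -.some X₂ Y₂ h₂
  · have hR' := hR
    rw [hneg] at hR' ⊢
    have hS' := hS.neg
    rw [neg_add_cancel]
    obtain ⟨h₂', e₂⟩ := shortCurve_neg_some h₂
    rw [e₂] at hR' hS'
    filter_upwards [hR', hS'] with t ht ht' y h
    obtain ⟨h₃, e₃⟩ := ht y h
    obtain ⟨h₄, e₄⟩ := ht' y h
    have : φ (.some t y h) = -ψ (.some t y h) := by
      rw [e₃]; exact e₄.symm
    rw [AddMonoidHom.add_apply, this, neg_add_cancel]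
    rfl
  · have hℓ : ∃ ℓ, X₁ ≠ X₂ ∧ ℓ * (X₁ - X₂) = Y₁ - Y₂ ∨ X₁ = X₂ ∧ Y₁ = Y₂ ∧ 2 * Y₁ ≠ 0 ∧
        ℓ * (2 * Y₁) = 3 * X₁ ^ 2 + RatFunc.C a * cubic a b ^ 2 := by
      by_cases hX : X₁ = X₂
      · have hY : Y₁ = Y₂ := by
          rcases (Affine.Point.X_eq_iff (h₁ := h₁) (h₂ := h₂)).mp hX with h | h
          · rw [Affine.Point.some.injEq] at h
            exact h.2
          · exact absurd h hneg
        subst hX hY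
        have hY0 : 2 * Y₁ ≠ 0 := by
          intro h0
          obtain ⟨h₁', e⟩ := shortCurve_neg_some h₁
          rw [e, Affine.Point.some.injEq] at hneg
          exact hneg ⟨rfl, by linear_combination h0⟩
        exact ⟨(3 * X₁ ^ 2 + RatFunc.C a * cubic a b ^ 2) / (2 * Y₁),
          Or.inr ⟨rfl, rfl, hY0, div_mul_cancel₀ _ hY0⟩⟩
      · exact ⟨(Y₁ - Y₂) / (X₁ - X₂), Or.inl ⟨hX, div_mul_cancel₀ _ (sub_ne_zero.mpr hX)⟩⟩
    obtain ⟨ℓ, hℓ⟩ := hℓ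
    obtain ⟨h₃, e₃⟩ := shortCurve_add_some h₁ h₂ hℓ rfl
    rw [e₃]
    set X₃ := ℓ ^ 2 - X₁ - X₂ with hX₃
    have hev : ∀ᶠ t in cofinite, (ev t X₁ ≠ ev t X₂ ∧ ev t ℓ * (ev t X₁ - ev t X₂) =
        ev t Y₁ - ev t Y₂ ∨ ev t X₁ = ev t X₂ ∧ ev t Y₁ = ev t Y₂ ∧ 2 * ev t Y₁ ≠ 0 ∧
        ev t ℓ * (2 * ev t Y₁) = 3 * ev t X₁ ^ 2 + a * ev t (cubic a b) ^ 2) := by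
      rcases hℓ with ⟨hX, hs⟩ | ⟨hX, hY, hY0, hs⟩
      · filter_upwards [eventually_ev_ne hX, eventually_ev_mul ℓ (X₁ - X₂),
          eventually_ev_sub X₁ X₂, eventually_ev_sub Y₁ Y₂] with t e1 e2 e3 e4
        refine Or.inl ⟨e1, ?_⟩
        rw [← e3, ← e2, hs, e4]
      · have hs' : ℓ * (Y₁ + Y₁) = (X₁ * X₁ + X₁ * X₁ + X₁ * X₁) +
            RatFunc.C a * (cubic a b * cubic a b) := by linear_combination hs
        filter_upwards [eventually_ev_ne_zero (right_ne_zero_of_mul hY0),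
          eventually_ev_mul ℓ (Y₁ + Y₁), eventually_ev_add Y₁ Y₁, eventually_ev_add
          (X₁ * X₁ + X₁ * X₁ + X₁ * X₁) (RatFunc.C a * (cubic a b * cubic a b)),
          eventually_ev_add (X₁ * X₁ + X₁ * X₁) (X₁ * X₁), eventually_ev_add (X₁ * X₁) (X₁ * X₁),
          eventually_ev_mul X₁ X₁, eventually_ev_mul (RatFunc.C a) (cubic a b * cubic a b),
          eventually_ev_mul (cubic a b) (cubic a b)] with t e1 e2 e3 e4 e5 e6 e7 e8 e9
        refine Or.inr ⟨by rw [hX], by rw [hY], mul_ne_zero h2 e1, ?_⟩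
        have := congrArg (ev t) hs'
        rw [e2, e3, e4, e5, e6, e7, e8, e9, ev_C] at this
        linear_combination this
    filter_upwards [hR, hS, hev, eventually_ev_neg (ℓ * (X₃ - X₁) + Y₁),
      eventually_ev_add (ℓ * (X₃ - X₁)) Y₁, eventually_ev_mul ℓ (X₃ - X₁),
      eventually_ev_sub X₃ X₁, eventually_ev_sub (ℓ ^ 2 - X₁) X₂, eventually_ev_sub (ℓ ^ 2) X₁,
      eventually_ev_mul ℓ ℓ, eventually_ev_ne_zero (cubic_ne_zero (a := a) (b := b))]
      with t hR hS hev e1 e2 e3 e4 e5 e6 e7 hf y h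
    obtain ⟨h₄, e₄⟩ := hR y h
    obtain ⟨h₅, e₅⟩ := hS y h
    have hy := (shortCurve_equation_iff a b t y).mp h.1
    rw [← ev_cubic] at hy
    have eX₃ : ev t X₃ = ev t ℓ ^ 2 - ev t X₁ - ev t X₂ := by
      rw [hX₃, e5, e6, pow_two, e7, pow_two]
    have hy0 : y ≠ 0 := by
      rintro rfl
      exact hf (by rw [← hy]; ring)
    -- In the coordinates (X/f, yY/f²) a slope ℓ becomes yℓ/f; the relation y² = f turns ℓ²/f into
    -- its square.
    obtain ⟨h₆, e₆⟩ := shortCurve_add_some (ℓ := y * ev t ℓ / ev t (cubic a b))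
      (x₃ := ev t X₃ / ev t (cubic a b)) h₄ h₅ (by
        set f := ev t (cubic a b)
        rcases hev with ⟨hX, hs⟩ | ⟨hX, hY, hY0, hs⟩
        · refine Or.inl ⟨fun e => hX ((div_left_inj' hf).mp e), ?_⟩
          field_simp
          linear_combination hs
        · refine Or.inr ⟨by rw [hX], by rw [hY], ?_, ?_⟩
          · have : 2 * (y * ev t Y₁ / f ^ 2) = (2 * ev t Y₁) * y / f ^ 2 := by ring
            rw [this]
            exact div_ne_zero (mul_ne_zero hY0 hy0) (pow_ne_zero 2 hf)
          · field_simp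
            linear_combination f * hs + (ev t ℓ * (2 * ev t Y₁)) * hy) (by
        rw [eX₃]
        field_simp
        linear_combination -ev t ℓ ^ 2 * hy)
    refine ⟨by convert h₆ using 1; rw [e1, e2, e3, e4]; field_simp, ?_⟩
    rw [AddMonoidHom.add_apply, e₄, e₅, e₆, Affine.Point.some.injEq]
    refine ⟨rfl, ?_⟩
    rw [e1, e2, e3, e4]
    field_simp

lemma Interpolates.zsmul (h2 : (2 : k) ≠ 0) {R : (genericTwist a b).toAffine.Point}
    {φ : (shortCurve a b).toAffine.Point →+ (shortCurve a b).toAffine.Point}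
    (hR : Interpolates R φ) (n : ℤ) : Interpolates (n • R) (n • φ) := by
  induction n with
  | zero => rw [zero_zsmul, zero_zsmul]; exact .zero
  | succ n ih => rw [add_zsmul, add_zsmul, one_zsmul, one_zsmul]; exact ih.add h2 hR
  | pred n ih =>
    rw [sub_zsmul, sub_zsmul, one_zsmul, one_zsmul]; exact ih.add h2 hR.neg

end Kernels

/-! ### The order of a kernel as the size of a generic fibre. -/

section KernelCount

open Polynomial WeierstrassCurve Filter

variable {k : Type*} [Field k] [DecidableEq k] [IsAlgClosed k] {a b : k}

omit [DecidableEq k] [IsAlgClosed k] in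
lemma finite_sq_eq (e : k) : {y : k | y ^ 2 = e}.Finite := by
  have : (X ^ 2 - C e : k[X]) ≠ 0 := X_pow_sub_C_ne_zero two_pos e
  refine (rootSet_finite (X ^ 2 - C e) k).subset fun y hy => ?_
  rw [mem_rootSet]
  refine ⟨this, ?_⟩
  simpa [sub_eq_zero] using hy

omit [DecidableEq k] [IsAlgClosed k] in
lemma finite_points_over {Z : Set k} (hZ : Z.Finite) :
    {P : (shortCurve a b).toAffine.Point | ∃ t ∈ Z, ∃ y h, P = .some t y h}.Finite := by
  have : {q : k × k | q.1 ∈ Z ∧ q.2 ^ 2 = q.1 ^ 3 + a * q.1 + b}.Finite := by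
    refine (hZ.biUnion fun t _ => (finite_sq_eq (t ^ 3 + a * t + b)).image (Prod.mk t)).subset ?_
    rintro ⟨t, y⟩ ⟨ht, hy⟩
    exact Set.mem_biUnion ht ⟨y, hy, rfl⟩
  refine Set.Finite.of_finite_image (f := fun P : (shortCurve a b).toAffine.Point =>
    match P with | .zero => ((0, 0) : k × k) | .some x y _ => (x, y)) (this.subset ?_) ?_
  · rintro _ ⟨P, ⟨t, ht, y, h, rfl⟩, rfl⟩
    exact ⟨ht, (shortCurve_equation_iff a b t y).mp h.1⟩
  · rintro _ ⟨t, ht, y, h, rfl⟩ _ ⟨t', ht', y', h', rfl⟩ e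
    simpa using e

/-- A rational function of degree `N` prime to the characteristic takes all but finitely many
values exactly `N` times. -/
lemma eventually_ncard_roots {A B : k[X]} (hcop : IsCoprime A B) {N : ℕ}
    (hdeg : HasMaxDegree ![A, B] N) (hN : (N : k) ≠ 0) :
    ∀ᶠ c in cofinite, {t | A.eval t = c * B.eval t}.ncard = N := by
  obtain ⟨hle, hne⟩ := hdeg
  simp only [Fin.forall_fin_two, Fin.exists_fin_two, Matrix.cons_val_zero,
    Matrix.cons_val_one] at hle hne
  obtain ⟨n, rfl⟩ : ∃ n, N = n + 1 := Nat.exists_eq_succ_of_ne_zero (by rintro rfl; simp at hN)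
  have hder : ∀ {f : k[X]}, f.coeff (n + 1) ≠ 0 → derivative f ≠ 0 := fun {f} hf h0 => by
    have := coeff_derivative f n
    rw [h0, coeff_zero] at this
    exact mul_ne_zero hf (by exact_mod_cast hN) this.symm
  -- Coprime polynomials with zero Wronskian have zero derivatives. The one of degree N does not,
  -- because N ≠ 0 in k.
  have hW : wronskian A B ≠ 0 := by
    intro h0
    obtain ⟨h1, h2⟩ := hcop.wronskian_eq_zero_iff.mp h0
    exact hne.elim (fun h => hder h h1) fun h => hder h h2
  -- This excludes the value of c for which the degree of A - cB drops below N.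
  have hlin : (C (A.coeff (n + 1)) - X * C (B.coeff (n + 1)) : k[X]) ≠ 0 := by
    intro h0
    have h1 := congrArg (eval 0) h0
    have h2 := congrArg (eval 1) h0
    simp at h1 h2
    simp_all
  have hcr : ∀ᶠ c in cofinite, ∀ t, (wronskian A B).eval t = 0 → c ≠ A.eval t / B.eval t := by
    have hfin : {t | (wronskian A B).eval t = 0}.Finite :=
      by simpa using eventually_cofinite.mp (eventually_eval_ne_zero hW)
    refine (eventually_cofinite.mpr ?_)
    refine (hfin.image fun t => A.eval t / B.eval t).subset fun c hc => ?_
    simp only [ne_eq, not_forall, not_not, Set.mem_ofPred_eq] at hc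
    obtain ⟨t, ht, rfl⟩ := hc
    exact ⟨t, ht, rfl⟩
  filter_upwards [eventually_eval_ne_zero hlin, hcr] with c hc hcr
  simp only [eval_sub, eval_mul, eval_X, eval_C] at hc
  set g := A - C c * B with hg
  have hcoeff : g.coeff (n + 1) ≠ 0 := by rwa [hg, coeff_sub, coeff_C_mul]
  have hgdeg : g.natDegree = n + 1 := by
    refine le_antisymm ((natDegree_sub_le_of_le hle.1
      ((natDegree_C_mul_le _ _).trans hle.2)).trans (max_self _).le)
      (le_natDegree_of_ne_zero hcoeff)
  have hg0 : g ≠ 0 := fun h => hcoeff (by rw [h, coeff_zero])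
  have hroot : ∀ t, g.eval t = 0 ↔ A.eval t = c * B.eval t := fun t => by
    rw [hg, eval_sub, eval_mul, eval_C, sub_eq_zero]
  have hsep : g.Separable := by
    rw [Polynomial.Separable, isCoprime_iff_aeval_ne_zero_of_isAlgClosed k k]
    intro t
    by_contra! h
    obtain ⟨h1, h2⟩ := h
    simp only [coe_aeval_eq_eval] at h1 h2
    rw [hroot] at h1
    have h2 : (derivative A).eval t = c * (derivative B).eval t := by
      rw [hg] at h2
      simpa [sub_eq_zero] using h2
    have hB : B.eval t ≠ 0 := fun h => by
      rcases isCoprime_pair_eval hcop t with h' | h'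
      · exact h' (by rw [h1, h, mul_zero])
      · exact h' h
    refine hcr t ?_ (by rw [h1, mul_div_cancel_right₀ _ hB])
    rw [wronskian, eval_sub, eval_mul, eval_mul, h1, h2]
    ring
  have hset : {t | A.eval t = c * B.eval t} = (g.roots.toFinset : Set k) := by
    ext t
    simp [hg0, hroot]
  rw [hset, Set.ncard_coe_finset, Multiset.toFinset_card_of_nodup (nodup_roots hsep),
    IsAlgClosed.card_roots_eq_natDegree, hgdeg]

/-- Over a generic point Q = (c, w), the x-coordinate identifies the fibre of φ with the N solutions
of A = cB. A nonempty fibre is a coset of the kernel. -/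
theorem Interpolates.card_ker (h2 : (2 : k) ≠ 0) (hΔ : 4 * a ^ 3 + 27 * b ^ 2 ≠ 0)
    {R : (genericTwist a b).toAffine.Point}
    {φ : (shortCurve a b).toAffine.Point →+ (shortCurve a b).toAffine.Point}
    (hR : Interpolates R φ) (hN : (height R : k) ≠ 0) : Nat.card φ.ker = height R := by
  obtain ⟨A, B, hcop, hdeg, e, he, hA, hB⟩ := hasHeight_height R
  set N := height R with hNR
  have hR0 : R ≠ 0 := by
    rintro rfl
    rw [hNR, hasHeight_zero.height_eq h2 hΔ] at hN
    simp at hN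
  rcases R with _ | ⟨X, Y, hXY⟩
  · exact absurd rfl hR0
  simp only [Affine.Point.xRep_some, Matrix.cons_val_zero, Matrix.cons_val_one] at hA hB
  have hB0 : B ≠ 0 := by
    rintro rfl
    simp at hB
  have hXB : X * algebraMap k[X] (RatFunc k) B = cubic a b * algebraMap k[X] (RatFunc k) A := by
    rw [hA]
    linear_combination -(cubic a b * algebraMap k[X] (RatFunc k) A) * hB
  have hgood : ∀ᶠ t in cofinite, B.eval t ≠ 0 ∧ ∀ y h, ∃ y' h',
      φ (.some t y h) = .some (A.eval t / B.eval t) y' h' := by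
    filter_upwards [hR, eventually_eval_ne_zero hB0, eventually_ev_mul X (algebraMap _ _ B),
      eventually_ev_mul (cubic a b) (algebraMap _ _ A),
      eventually_ev_ne_zero (cubic_ne_zero (a := a) (b := b))] with t ht hBt e1 e2 hf
    refine ⟨hBt, fun y h => ?_⟩
    obtain ⟨h', e'⟩ := ht y h
    have : ev t X / ev t (cubic a b) = A.eval t / B.eval t := by
      rw [hXB, e2, ev_algebraMap, ev_algebraMap] at e1
      rw [div_eq_div_iff hf hBt, ← e1, mul_comm]
    exact ⟨_, this ▸ h', by rw [e', Affine.Point.some.injEq]; exact ⟨this, rfl⟩⟩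
  set Z := {t : k | ¬(B.eval t ≠ 0 ∧ ∀ y h, ∃ y' h',
    φ (.some t y h) = .some (A.eval t / B.eval t) y' h')} with hZdef
  have hZ : Z.Finite := eventually_cofinite.mp hgood
  -- The exceptional set Z excludes only finitely many c. This bound keeps points above Z out of the
  -- fibre; the next one keeps Z away from the solutions of A = cB.
  have hfib : ∀ᶠ c in cofinite, ∀ t ∈ Z, ∀ y h y' h', φ (.some t y h) ≠ .some c y' h' := by
    refine eventually_cofinite.mpr (((finite_points_over (a := a) (b := b) hZ).image
      fun P => (φ P).xRep 0).subset fun c hc => ?_)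
    simp only [ne_eq, not_forall, not_not, Set.mem_ofPred_eq] at hc
    obtain ⟨t, ht, y, h, y', h', e⟩ := hc
    exact ⟨_, ⟨t, ht, y, h, rfl⟩, by simp [e]⟩
  have hval : ∀ᶠ c in cofinite, ∀ t ∈ Z, A.eval t / B.eval t ≠ c := by
    refine eventually_cofinite.mpr ((hZ.image fun t => A.eval t / B.eval t).subset fun c hc => ?_)
    simp only [ne_eq, not_forall, not_not, Set.mem_ofPred_eq] at hc
    obtain ⟨t, ht, e⟩ := hc
    exact ⟨t, ht, e⟩
  have hinf : Infinite k := IsAlgClosed.instInfinite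
  obtain ⟨c, hc₁, hc₂, hc₃, hc₄⟩ := (((eventually_ncard_roots hcop hdeg hN).and
    (hfib.and (hval.and (eventually_ev_ne_zero (cubic_ne_zero (a := a) (b := b)))))).exists)
  obtain ⟨w, hw⟩ := IsAlgClosed.exists_pow_nat_eq (c ^ 3 + a * c + b) two_pos
  have hcw := (shortCurve_nonsingular_iff h2 hΔ c w).mpr hw
  have hw0 : w ≠ 0 := by
    rintro rfl
    rw [ev_cubic, ← hw] at hc₄
    simp at hc₄
  set Q : (shortCurve a b).toAffine.Point := .some c w hcw with hQ
  -- This makes the x-coordinate injective on the fibre: P and -P cannot both map to Q.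
  have hQneg : Q ≠ -Q := by
    obtain ⟨h', e'⟩ := shortCurve_neg_some hcw
    rw [hQ, e', ne_eq, Affine.Point.some.injEq]
    rintro ⟨-, h⟩
    exact hw0 ((mul_eq_zero.mp (by linear_combination h : 2 * w = 0)).resolve_left h2)
  have hfiber : ∀ P, φ P = Q → ∃ t y h, P = .some t y h ∧ A.eval t = c * B.eval t := by
    intro P hP
    rcases P with _ | ⟨t, y, h⟩
    · have := hP.symm.trans (map_zero φ)
      exact absurd this (Affine.Point.some_ne_zero _)
    · have ht : t ∉ Z := fun ht => hc₂ t ht y h w hcw hP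
      rw [hZdef, Set.mem_ofPred_eq, not_not] at ht
      obtain ⟨hBt, ht⟩ := ht
      obtain ⟨y', h', e'⟩ := ht y h
      rw [hP, hQ, Affine.Point.some.injEq] at e'
      refine ⟨t, y, h, rfl, ?_⟩
      rw [e'.1, div_mul_cancel₀ _ hBt]
  have hcard : (φ ⁻¹' {Q}).ncard = N := by
    rw [← hc₁]
    refine Set.ncard_congr (fun P _ => P.xRep 0) ?_ ?_ ?_
    · intro P hP
      obtain ⟨t, y, h, rfl, e⟩ := hfiber P hP
      simpa using e
    · intro P P' hP hP' e
      obtain ⟨t, y, h, rfl, -⟩ := hfiber P hP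
      obtain ⟨t', y', h', rfl, -⟩ := hfiber P' hP'
      simp only [Affine.Point.xRep_some, Matrix.cons_val_zero] at e
      rcases Affine.Point.X_eq_iff.mp e with e' | e'
      · exact e'
      · have h1 : φ (.some t y h) = Q := hP
        rw [e', map_neg, show φ (.some t' y' h') = Q from hP'] at h1
        exact absurd h1.symm hQneg
    · intro t ht
      have hBt : B.eval t ≠ 0 := fun h => by
        rcases isCoprime_pair_eval hcop t with h' | h'
        · exact h' (by rw [ht, h, mul_zero])
        · exact h' h
      have hAB : A.eval t / B.eval t = c := by rw [ht, mul_div_cancel_right₀ _ hBt]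
      have htZ : t ∉ Z := fun h => hc₃ t h hAB
      rw [hZdef, Set.mem_ofPred_eq, not_not] at htZ
      obtain ⟨y, hy⟩ := IsAlgClosed.exists_pow_nat_eq (t ^ 3 + a * t + b) two_pos
      have hty := (shortCurve_nonsingular_iff h2 hΔ t y).mpr hy
      obtain ⟨y', h', e'⟩ := htZ.2 y hty
      rcases (Affine.Point.X_eq_iff (h₁ := h') (h₂ := hcw)).mp hAB with h | h
      · exact ⟨.some t y hty, e'.trans h, by simp⟩
      · refine ⟨-.some t y hty, ?_, by simp⟩
        rw [Set.mem_preimage, map_neg, e', h, neg_neg]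
        rfl
  have hpos : (φ ⁻¹' {Q}).ncard ≠ 0 := by
    rw [hcard]
    rintro h
    rw [h] at hN
    simp at hN
  obtain ⟨P, hP⟩ := Set.nonempty_of_ncard_ne_zero hpos
  have hP : φ P = Q := hP
  rw [← hcard, ← Nat.card_coe_set_eq, ← hP]
  exact (Nat.card_congr (φ.fiberEquivKer P)).symm

end KernelCount

/-! ### The orders of E[n] and of the kernels of m + ni. -/

section TorsionCount

open Polynomial WeierstrassCurve Filter

variable {k : Type*} [Field k] [DecidableEq k] [IsAlgClosed k] {a b : k}

omit [DecidableEq k] [IsAlgClosed k] in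
-- This point of the twist represents the map (x, y) ↦ (cx, dy). The three hypotheses say that this
-- map preserves the curve.
lemma nonsingular_generic (h2 : (2 : k) ≠ 0) (hΔ : 4 * a ^ 3 + 27 * b ^ 2 ≠ 0) {c d : k}
    (h₁ : d ^ 2 = c ^ 3) (h₂ : d ^ 2 * a = c * a) (h₃ : d ^ 2 * b = b) :
    (genericTwist a b).toAffine.Nonsingular (RatFunc.C c * (cubic a b * RatFunc.X))
      (RatFunc.C d * cubic a b ^ 2) := by
  have hC := fun {x y : k} (h : x = y) => congrArg (RatFunc.C (K := k)) h
  have e₁ := hC h₁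
  have e₂ := hC h₂
  have e₃ := hC h₃
  simp only [map_mul, map_pow] at e₁ e₂ e₃
  have hf : cubic a b = RatFunc.X ^ 3 + RatFunc.C a * RatFunc.X + RatFunc.C b := by
    simp [cubic]
  rw [shortCurve_nonsingular_iff]
  · have : (RatFunc.C d) ^ 2 * cubic a b = RatFunc.C c ^ 3 * RatFunc.X ^ 3 +
        RatFunc.C c * RatFunc.C a * RatFunc.X + RatFunc.C b := by
      rw [hf]
      linear_combination RatFunc.X ^ 3 * e₁ + RatFunc.X * e₂ + e₃
    linear_combination cubic a b ^ 3 * this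
  · rw [← map_ofNat (RatFunc.C (K := k)) 2]
    simpa using h2
  · have : 4 * (RatFunc.C a * cubic a b ^ 2) ^ 3 + 27 * (RatFunc.C b * cubic a b ^ 3) ^ 2 =
        RatFunc.C (4 * a ^ 3 + 27 * b ^ 2) * cubic a b ^ 6 := by
      simp only [map_add, map_mul, map_pow, map_ofNat]
      ring
    rw [this]
    exact mul_ne_zero ((_root_.map_ne_zero _).mpr hΔ) (pow_ne_zero 6 cubic_ne_zero)

omit [DecidableEq k] in
lemma height_generic (h2 : (2 : k) ≠ 0) (hΔ : 4 * a ^ 3 + 27 * b ^ 2 ≠ 0) {c : k} (hc : c ≠ 0)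
    {y : RatFunc k} (h : (genericTwist a b).toAffine.Nonsingular
      (RatFunc.C c * (cubic a b * RatFunc.X)) y) :
    height (Affine.Point.some _ _ h) = 1 := by
  classical
  have hcC : (RatFunc.C c : RatFunc k) ≠ 0 := by simpa using hc
  refine HasHeight.height_eq h2 hΔ ⟨X, C c⁻¹, ?_, ⟨?_, 0, by simp⟩, RatFunc.C c, hcC, ?_, ?_⟩
  · exact ⟨0, C c, by rw [zero_mul, zero_add, ← C_mul, mul_inv_cancel₀ hc, C_1]⟩
  · intro i
    fin_cases i <;> simp
  · simp
  · simp [hc]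

omit [IsAlgClosed k] in
lemma interpolates_generic {c d : k} (h : (genericTwist a b).toAffine.Nonsingular
      (RatFunc.C c * (cubic a b * RatFunc.X)) (RatFunc.C d * cubic a b ^ 2))
    {φ : (shortCurve a b).toAffine.Point →+ (shortCurve a b).toAffine.Point}
    (hφ : ∀ x y h, ∃ h', φ (.some x y h) = .some (c * x) (d * y) h') :
    Interpolates (Affine.Point.some _ _ h) φ := by
  filter_upwards [eventually_ev_mul (RatFunc.C c) (cubic a b * RatFunc.X),
    eventually_ev_mul (cubic a b) RatFunc.X, eventually_ev_mul (RatFunc.C d) (cubic a b ^ 2),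
    eventually_ev_mul (cubic a b) (cubic a b),
    eventually_ev_ne_zero (cubic_ne_zero (a := a) (b := b))] with t e1 e2 e3 e4 hf y h
  obtain ⟨h', e'⟩ := hφ t y h
  have hX : ev t (RatFunc.C c * (cubic a b * RatFunc.X)) / ev t (cubic a b) = c * t := by
    rw [e1, e2, ev_C, ev, ev, RatFunc.eval_X, ← ev]
    field_simp
  have hY : y * ev t (RatFunc.C d * cubic a b ^ 2) / ev t (cubic a b) ^ 2 = d * y := by
    rw [e3, pow_two, e4, ev_C]
    field_simp
  refine ⟨by rw [hX, hY]; exact h', ?_⟩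
  rw [e', Affine.Point.some.injEq]
  exact ⟨hX.symm, hY.symm⟩

/-- The identity has degree 1, so multiplication by n has degree n², which is nonzero in k. -/
theorem card_torsion (h2 : (2 : k) ≠ 0) (hΔ : 4 * a ^ 3 + 27 * b ^ 2 ≠ 0) {n : ℕ}
    (hn : (n : k) ≠ 0) : Nat.card (Torsion n (shortCurve a b)) = n ^ 2 := by
  have hG := nonsingular_generic h2 hΔ (c := 1) (d := 1) (by simp) (by simp) (by simp)
  have hint := (interpolates_generic hG (φ := AddMonoidHom.id _)
    (fun x y h => ⟨by simpa using h, by simp⟩)).zsmul h2 n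
  have hh := height_zsmul_add_zsmul h2 hΔ (Affine.Point.some _ _ hG) (.some _ _ hG) n 0
  rw [height_generic h2 hΔ one_ne_zero] at hh
  set G := Affine.Point.some _ _ hG
  rw [zero_zsmul, add_zero] at hh
  have hh : height ((n : ℤ) • G) = n ^ 2 := by
    zify
    rw [hh]
    ring
  have := hint.card_ker h2 hΔ (by rw [hh]; push_cast; exact pow_ne_zero 2 hn)
  rw [hh] at this
  rw [← this]
  refine Nat.card_congr (Equiv.subtypeEquivRight fun P => ?_)
  rw [AddSubgroup.torsionBy.nsmul_iff, AddMonoidHom.mem_ker, AddMonoidHom.smul_apply,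
    AddMonoidHom.id_apply, natCast_zsmul]

/-- The degree on ℤ[i] is the norm form: 1 and i have degree 1, and the cross term vanishes because
1 + i has degree 2. -/
theorem card_ker_zsmul_add_zsmul (h2 : (2 : k) ≠ 0) {ι : k} (hι : ι ^ 2 = -1)
    {I : (shortCurve (1 : k) 0).toAffine.Point →+ (shortCurve (1 : k) 0).toAffine.Point}
    (hI : ∀ x y h, ∃ h', I (.some x y h) = .some (-x) (ι * y) h') {m n : ℤ}
    (hmn : ((m ^ 2 + n ^ 2 : ℤ) : k) ≠ 0) :
    (Nat.card (m • AddMonoidHom.id _ + n • I).ker : ℤ) = m ^ 2 + n ^ 2 := by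
  have hΔ : 4 * (1 : k) ^ 3 + 27 * 0 ^ 2 ≠ 0 := by
    have : (4 : k) = 2 * 2 := by norm_num
    simp [this, h2]
  have hG := nonsingular_generic h2 hΔ (c := 1) (d := 1) (by simp) (by simp) (by simp)
  have hG' := nonsingular_generic h2 hΔ (c := -1) (d := ι) (by rw [hι]; ring)
    (by rw [hι]) (by simp)
  have hint := ((interpolates_generic hG (φ := AddMonoidHom.id _)
    (fun x y h => ⟨by simpa using h, by simp⟩)).zsmul h2 m).add h2
    ((interpolates_generic hG' (φ := I) (fun x y h => by simpa using hI x y h)).zsmul h2 n)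
  have hsum : height (Affine.Point.some _ _ hG + .some _ _ hG') = 2 := by
    refine HasHeight.height_eq h2 hΔ ?_
    have h2' : (2 : RatFunc k) ≠ 0 := by
      rw [← map_ofNat (RatFunc.C (K := k)) 2]
      exact (_root_.map_ne_zero _).mpr h2
    have hX := RatFunc.X_ne_zero (K := k)
    have hf := cubic_ne_zero (a := (1 : k)) (b := 0)
    have hfe : cubic (1 : k) 0 = RatFunc.X ^ 3 + RatFunc.X := by simp [cubic]
    have hιC : RatFunc.C ι ^ 2 = -1 := by rw [← map_pow, hι, map_neg, map_one]
    set f := cubic (1 : k) 0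
    obtain ⟨h₃, e₃⟩ := shortCurve_add_some (ℓ := (1 - RatFunc.C ι) * f / (2 * RatFunc.X)) hG hG'
      (Or.inl ⟨by
        intro h
        rw [map_neg, map_one] at h
        exact mul_ne_zero h2' (mul_ne_zero hf hX) (by linear_combination h), by
        rw [map_neg, map_one]
        field_simp
        ring⟩) rfl
    have hι0 : ι ≠ 0 := by
      rintro rfl
      simp at hι
    rw [e₃]
    -- The map 1 + I acts on x-coordinates by (X² + 1)/(2ιX). Coprimality is the identity (X² + 1) +
    -- (ι/2)X · 2ιX = 1.
    refine ⟨X ^ 2 + 1, C (2 * ι) * X, ⟨1, C (ι * 2⁻¹) * X, ?_⟩, ⟨?_, 0, ?_⟩, -RatFunc.C ι / (2 * RatFunc.X), ?_, ?_, ?_⟩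
    · have : ι * 2⁻¹ * (2 * ι) = -1 := by
        field_simp
        exact hι
      rw [mul_mul_mul_comm, ← C_mul, this, map_neg, map_one]
      ring
    · intro i
      fin_cases i
      · exact natDegree_add_le_of_degree_le (natDegree_X_pow_le 2) (by simp)
      · exact (natDegree_C_mul_le _ _).trans (natDegree_X_le.trans one_le_two)
    · simp [coeff_one]
    · exact div_ne_zero (neg_ne_zero.mpr ((_root_.map_ne_zero _).mpr hι0)) (mul_ne_zero h2' hX)
    · simp only [Affine.Point.xRep_some, Matrix.cons_val_zero, map_add, map_pow, map_one,
        RatFunc.algebraMap_X, map_neg]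
      field_simp
      linear_combination (f ^ 2) * hιC - 2 * RatFunc.C ι * f * hfe
    · simp only [Affine.Point.xRep_some, Matrix.cons_val, map_mul, RatFunc.algebraMap_X,
        RatFunc.algebraMap_C, map_ofNat]
      field_simp
      linear_combination hιC
  have hh := height_zsmul_add_zsmul h2 hΔ (Affine.Point.some _ _ hG) (.some _ _ hG') m n
  rw [height_generic h2 hΔ one_ne_zero, height_generic h2 hΔ (neg_ne_zero.mpr one_ne_zero),
    hsum] at hh
  set G := Affine.Point.some _ _ hG
  set G' := Affine.Point.some _ _ hG'
  have hh : (height (m • G + n • G') : ℤ) = m ^ 2 + n ^ 2 := by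
    rw [hh]
    ring
  have := hint.card_ker h2 hΔ (by
    rw [← hh] at hmn
    exact_mod_cast hmn)
  rw [this, hh]

end TorsionCount

/-! ### Coordinate changes and isomorphisms of short Weierstrass curves. -/

section Isomorphisms

open WeierstrassCurve

variable {k : Type*} [Field k]

lemma equation_variableChange_iff (C : VariableChange k) (W : WeierstrassCurve k) (x y : k) :
    (C • W).toAffine.Equation x y ↔ W.toAffine.Equation ((C.u : k) ^ 2 * x + C.r)
      ((C.u : k) ^ 3 * y + (C.u : k) ^ 2 * C.s * x + C.t) := by
  have hu : (C.u : k) ≠ 0 := C.u.ne_zero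
  rw [Affine.equation_iff', Affine.equation_iff', variableChange_a₁, variableChange_a₂,
    variableChange_a₃, variableChange_a₄, variableChange_a₆, Units.val_inv_eq_inv_val]
  have : ∀ {A B : k}, (C.u : k) ^ 6 * A = B → (A = 0 ↔ B = 0) := fun {A B} h => by
    rw [← h]
    simp [hu]
  refine this ?_
  field_simp
  ring

variable [DecidableEq k]

lemma add_some_of_slope {W : WeierstrassCurve k} {x₁ y₁ x₂ y₂ ℓ : k}
    (h₁ : W.toAffine.Nonsingular x₁ y₁) (h₂ : W.toAffine.Nonsingular x₂ y₂)
    (hℓ : x₁ ≠ x₂ ∧ ℓ * (x₁ - x₂) = y₁ - y₂ ∨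
      x₁ = x₂ ∧ y₁ = y₂ ∧ y₁ - W.toAffine.negY x₁ y₁ ≠ 0 ∧
        ℓ * (y₁ - W.toAffine.negY x₁ y₁) = 3 * x₁ ^ 2 + 2 * W.a₂ * x₁ + W.a₄ - W.a₁ * y₁) :
    ∃ h, Affine.Point.some x₁ y₁ h₁ + .some x₂ y₂ h₂ =
      .some (W.toAffine.addX x₁ x₂ ℓ) (W.toAffine.addY x₁ x₂ y₁ ℓ) h := by
  have hxy : ¬(x₁ = x₂ ∧ y₁ = W.toAffine.negY x₂ y₂) := by
    rintro ⟨e, e'⟩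
    rcases hℓ with ⟨h, -⟩ | ⟨-, h, h', -⟩
    · exact h e
    · subst e h
      exact h' (sub_eq_zero.mpr e')
  have hs : W.toAffine.slope x₁ x₂ y₁ y₂ = ℓ := by
    rcases hℓ with ⟨h, h'⟩ | ⟨rfl, rfl, h', h''⟩
    · rw [Affine.slope_of_X_ne h, div_eq_iff (sub_ne_zero.mpr h), h']
    · rw [Affine.slope_of_Y_ne rfl (fun h => hxy ⟨rfl, h⟩), div_eq_iff h', h'']
  rw [← hs]
  exact ⟨_, Affine.Point.add_some hxy⟩

lemma exists_slope {W : WeierstrassCurve k} {x₁ y₁ x₂ y₂ : k}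
    (h₁ : W.toAffine.Equation x₁ y₁) (h₂ : W.toAffine.Equation x₂ y₂)
    (hxy : ¬(x₁ = x₂ ∧ y₁ = W.toAffine.negY x₂ y₂)) :
    ∃ ℓ, x₁ ≠ x₂ ∧ ℓ * (x₁ - x₂) = y₁ - y₂ ∨
      x₁ = x₂ ∧ y₁ = y₂ ∧ y₁ - W.toAffine.negY x₁ y₁ ≠ 0 ∧
        ℓ * (y₁ - W.toAffine.negY x₁ y₁) = 3 * x₁ ^ 2 + 2 * W.a₂ * x₁ + W.a₄ - W.a₁ * y₁ := by
  by_cases hx : x₁ = x₂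
  · have hy : y₁ = y₂ := (Affine.Y_eq_of_X_eq h₁ h₂ hx).resolve_right fun h => hxy ⟨hx, h⟩
    subst hx hy
    have h0 := sub_ne_zero.mpr fun h => hxy ⟨rfl, h⟩
    exact ⟨_, Or.inr ⟨rfl, rfl, h0, div_mul_cancel₀ _ h0⟩⟩
  · exact ⟨_, Or.inl ⟨hx, div_mul_cancel₀ _ (sub_ne_zero.mpr hx)⟩⟩

/-- An admissible change of coordinates gives an isomorphism of elliptic curves. -/
lemma exists_isIsom (C : VariableChange k) (W : WeierstrassCurve k) [W.IsElliptic] :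
    ∃ f : (C • W).toAffine.Point ≃+ W.toAffine.Point, IsIsom (C • W) W f ∧
      ∀ x y h, ∃ h', f (.some x y h) = .some ((C.u : k) ^ 2 * x + C.r)
        ((C.u : k) ^ 3 * y + (C.u : k) ^ 2 * C.s * x + C.t) h' := by
  have hu : (C.u : k) ≠ 0 := C.u.ne_zero
  have hns : ∀ {x y : k}, (C • W).toAffine.Nonsingular x y → W.toAffine.Nonsingular
      ((C.u : k) ^ 2 * x + C.r) ((C.u : k) ^ 3 * y + (C.u : k) ^ 2 * C.s * x + C.t) :=
    fun {x y} h => Affine.equation_iff_nonsingular.mp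
      ((equation_variableChange_iff C W x y).mp h.1)
  let F : (C • W).toAffine.Point → W.toAffine.Point := fun P => match P with
    | .zero => .zero
    | .some x y h => .some _ _ (hns h)
  have hF : ∀ x y h, F (.some x y h) = .some _ _ (hns h) := fun x y h => rfl
  have hF0 : F 0 = 0 := rfl
  have hnegY : ∀ x y, W.toAffine.negY ((C.u : k) ^ 2 * x + C.r)
      ((C.u : k) ^ 3 * y + (C.u : k) ^ 2 * C.s * x + C.t) =
      (C.u : k) ^ 3 * (C • W).toAffine.negY x y + (C.u : k) ^ 2 * C.s * x + C.t := fun x y => by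
    simp only [Affine.negY, variableChange_a₁, variableChange_a₃, Units.val_inv_eq_inv_val]
    field_simp
    ring
  have hadd : ∀ P Q, F (P + Q) = F P + F Q := by
    intro P Q
    rcases P with _ | ⟨x₁, y₁, h₁⟩
    · rw [← Affine.Point.zero_def, zero_add, hF0, zero_add]
    rcases Q with _ | ⟨x₂, y₂, h₂⟩
    · rw [← Affine.Point.zero_def, add_zero, hF0, add_zero]
    by_cases hxy : x₁ = x₂ ∧ y₁ = (C • W).toAffine.negY x₂ y₂
    · rw [Affine.Point.add_of_Y_eq hxy.1 hxy.2, hF _ _ h₁, hF _ _ h₂, hF0,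
        Affine.Point.add_of_Y_eq]
      · rw [hxy.1]
      · rw [hnegY, ← hxy.2, hxy.1]
    · obtain ⟨ℓ, hℓ⟩ := exists_slope h₁.1 h₂.1 hxy
      obtain ⟨h₃, e₃⟩ := add_some_of_slope h₁ h₂ hℓ
      -- The change of coordinates carries a line of slope ℓ to one of slope uℓ + s.
      obtain ⟨h₄, e₄⟩ := add_some_of_slope (hns h₁) (hns h₂) (ℓ := C.u * ℓ + C.s) (by
        rcases hℓ with ⟨hx, h⟩ | ⟨hx, hy, h0, h⟩
        · refine Or.inl ⟨fun e => hx ?_, ?_⟩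
          · exact mul_left_cancel₀ (pow_ne_zero 2 hu) (add_right_cancel e)
          · linear_combination (C.u : k) ^ 3 * h
        · subst hx hy
          have e : (C.u : k) ^ 3 * y₁ + (C.u : k) ^ 2 * C.s * x₁ + C.t -
              W.toAffine.negY ((C.u : k) ^ 2 * x₁ + C.r)
                ((C.u : k) ^ 3 * y₁ + (C.u : k) ^ 2 * C.s * x₁ + C.t) =
              (C.u : k) ^ 3 * (y₁ - (C • W).toAffine.negY x₁ y₁) := by
            rw [hnegY]
            ring
          refine Or.inr ⟨rfl, rfl, ?_, ?_⟩
          · rw [e]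
            exact mul_ne_zero (pow_ne_zero 3 hu) h0
          · rw [e]
            have h' := congrArg ((C.u : k) ^ 4 * ·) h
            simp only [Affine.negY, variableChange_a₁, variableChange_a₂, variableChange_a₃,
              variableChange_a₄, Units.val_inv_eq_inv_val] at h' ⊢
            field_simp at h' ⊢
            linear_combination h')
      rw [e₃, hF _ _ h₁, hF _ _ h₂, hF _ _ h₃, e₄, Affine.Point.some.injEq]
      have hX : (C.u : k) ^ 2 * (C • W).toAffine.addX x₁ x₂ ℓ + C.r =
          W.toAffine.addX ((C.u : k) ^ 2 * x₁ + C.r) ((C.u : k) ^ 2 * x₂ + C.r)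
            (C.u * ℓ + C.s) := by
        simp only [Affine.addX, variableChange_a₁, variableChange_a₂, Units.val_inv_eq_inv_val]
        field_simp
        ring
      refine ⟨hX, ?_⟩
      rw [Affine.addY, Affine.addY, ← hnegY, hX]
      congr 1
      rw [Affine.negAddY, Affine.negAddY, ← hX]
      ring
  have hbij : Function.Bijective F := by
    constructor
    · intro P Q h
      rcases P with _ | ⟨x₁, y₁, h₁⟩ <;> rcases Q with _ | ⟨x₂, y₂, h₂⟩
      · rfl
      · exact absurd h.symm (Affine.Point.some_ne_zero _)
      · exact absurd h (Affine.Point.some_ne_zero _)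
      · rw [hF _ _ h₁, hF _ _ h₂, Affine.Point.some.injEq] at h
        obtain ⟨hx, hy⟩ := h
        have hx : x₁ = x₂ := mul_left_cancel₀ (pow_ne_zero 2 hu) (add_right_cancel hx)
        subst hx
        have hy : y₁ = y₂ :=
          mul_left_cancel₀ (pow_ne_zero 3 hu) (add_right_cancel (add_right_cancel hy))
        subst hy
        rfl
    · intro P
      rcases P with _ | ⟨x, y, h⟩
      · exact ⟨0, rfl⟩
      · have hx : (C.u : k) ^ 2 * ((x - C.r) / (C.u : k) ^ 2) + C.r = x := by
          field_simp
          ring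
        have hy : (C.u : k) ^ 3 * ((y - C.s * (x - C.r) - C.t) / (C.u : k) ^ 3) +
            (C.u : k) ^ 2 * C.s * ((x - C.r) / (C.u : k) ^ 2) + C.t = y := by
          field_simp
          ring
        have heq := (equation_variableChange_iff C W ((x - C.r) / (C.u : k) ^ 2)
          ((y - C.s * (x - C.r) - C.t) / (C.u : k) ^ 3)).mpr (by rw [hx, hy]; exact h.1)
        have hn := Affine.equation_iff_nonsingular.mp heq
        refine ⟨.some _ _ hn, ?_⟩
        rw [hF _ _ hn, Affine.Point.some.injEq]
        exact ⟨hx, hy⟩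
  have hf : ∀ x y h, ∃ h', F (.some x y h) = .some ((C.u : k) ^ 2 * x + C.r)
        ((C.u : k) ^ 3 * y + (C.u : k) ^ 2 * C.s * x + C.t) h' := fun x y h => ⟨hns h, rfl⟩
  exact ⟨AddEquiv.ofBijective (AddMonoidHom.mk' F hadd) hbij, ⟨C, rfl, hf⟩, hf⟩

omit [DecidableEq k] in
lemma isElliptic_shortCurve (h2 : (2 : k) ≠ 0) {a b : k} (hΔ : 4 * a ^ 3 + 27 * b ^ 2 ≠ 0) :
    (shortCurve a b).IsElliptic := by
  rw [isElliptic_iff, isUnit_iff_ne_zero]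
  have : (shortCurve a b).Δ = -2 ^ 4 * (4 * a ^ 3 + 27 * b ^ 2) := by
    simp only [Δ, b₂, b₄, b₆, b₈]
    ring
  rw [this]
  exact mul_ne_zero (neg_ne_zero.mpr (pow_ne_zero 4 h2)) hΔ

/-- The group isomorphism is given by `(x, y) ↦ (u² x, u³ y)`. -/
def ScalesBy {W W' : WeierstrassCurve k} (f : W.toAffine.Point ≃+ W'.toAffine.Point) (u : k) :
    Prop :=
  ∀ x y h, ∃ h', f (.some x y h) = .some (u ^ 2 * x) (u ^ 3 * y) h'

lemma ScalesBy.trans {W W' W'' : WeierstrassCurve k} {f : W.toAffine.Point ≃+ W'.toAffine.Point}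
    {g : W'.toAffine.Point ≃+ W''.toAffine.Point} {u v : k} (hf : ScalesBy f u)
    (hg : ScalesBy g v) : ScalesBy (f.trans g) (u * v) := by
  intro x y h
  obtain ⟨h₁, e₁⟩ := hf x y h
  obtain ⟨h₂, e₂⟩ := hg _ _ h₁
  have hx : (u * v) ^ 2 * x = v ^ 2 * (u ^ 2 * x) := by ring
  have hy : (u * v) ^ 3 * y = v ^ 3 * (u ^ 3 * y) := by ring
  rw [hx, hy, AddEquiv.trans_apply, e₁, e₂]
  exact ⟨h₂, rfl⟩

lemma ScalesBy.apply_eq {W W' : WeierstrassCurve k} {f g : W.toAffine.Point ≃+ W'.toAffine.Point}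
    {u : k} (hf : ScalesBy f u) (hg : ScalesBy g u) (P : W.toAffine.Point) : f P = g P := by
  rcases P with _ | ⟨x, y, h⟩
  · exact (map_zero f).trans (map_zero g).symm
  · obtain ⟨h₁, e₁⟩ := hf x y h
    obtain ⟨h₂, e₂⟩ := hg x y h
    rw [e₁, e₂]

lemma scalesBy_refl (W : WeierstrassCurve k) : ScalesBy (AddEquiv.refl W.toAffine.Point) 1 := by
  intro x y h
  rw [one_pow, one_pow, one_mul, one_mul]
  exact ⟨h, rfl⟩

lemma scalesBy_neg (a b : k) :
    ScalesBy (AddEquiv.neg (shortCurve a b).toAffine.Point) (-1) := by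
  intro x y h
  obtain ⟨h', e⟩ := shortCurve_neg_some h
  have hx : (-1 : k) ^ 2 * x = x := by ring
  have hy : (-1 : k) ^ 3 * y = -y := by ring
  rw [hx, hy]
  exact ⟨h', e⟩

/-- The vanishing of a₁, a₂ and a₃ on both curves forces s, r and t to vanish in turn, since 2 and 3
are invertible. -/
lemma IsIsom.exists_scalesBy (h2 : (2 : k) ≠ 0) (h3 : (3 : k) ≠ 0) {a b a' b' : k}
    {f : (shortCurve a b).toAffine.Point ≃+ (shortCurve a' b').toAffine.Point}
    (hf : IsIsom (shortCurve a b) (shortCurve a' b') f) :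
    ∃ u : k, u ^ 4 * a = a' ∧ u ^ 6 * b = b' ∧ ScalesBy f u := by
  obtain ⟨C, hC, h⟩ := hf
  have hu : (C.u : k) ≠ 0 := C.u.ne_zero
  have e₁ := congrArg WeierstrassCurve.a₁ hC
  have e₂ := congrArg WeierstrassCurve.a₂ hC
  have e₃ := congrArg WeierstrassCurve.a₃ hC
  have e₄ := congrArg WeierstrassCurve.a₄ hC
  have e₆ := congrArg WeierstrassCurve.a₆ hC
  simp only [variableChange_a₁, variableChange_a₂, variableChange_a₃, variableChange_a₄,
    variableChange_a₆, Units.val_inv_eq_inv_val] at e₁ e₂ e₃ e₄ e₆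
  have hs : C.s = 0 := by simpa [hu, h2] using e₁
  rw [hs] at e₂ e₄
  have hr : C.r = 0 := by simpa [hu, h3] using e₂
  rw [hr] at e₃ e₄ e₆
  have ht : C.t = 0 := by simpa [hu, h2] using e₃
  rw [ht] at e₄ e₆
  refine ⟨C.u, ?_, ?_, fun x y hxy => ?_⟩
  · rw [← e₄]
    field_simp
    ring
  · rw [← e₆]
    field_simp
    ring
  · obtain ⟨h', e⟩ := h x y hxy
    have hx : (C.u : k) ^ 2 * x + C.r = (C.u : k) ^ 2 * x := by rw [hr, add_zero]
    have hy : (C.u : k) ^ 3 * y + (C.u : k) ^ 2 * C.s * x + C.t = (C.u : k) ^ 3 * y := by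
      rw [hs, ht]; ring
    rw [e]
    exact ⟨hx ▸ hy ▸ h', by rw [Affine.Point.some.injEq]; exact ⟨hx, hy⟩⟩

lemma exists_isIsom_scalesBy (h2 : (2 : k) ≠ 0) {a b u : k} (hu : u ≠ 0)
    (hΔ : 4 * (u ^ 4 * a) ^ 3 + 27 * (u ^ 6 * b) ^ 2 ≠ 0) :
    ∃ f : (shortCurve a b).toAffine.Point ≃+ (shortCurve (u ^ 4 * a) (u ^ 6 * b)).toAffine.Point,
      IsIsom (shortCurve a b) (shortCurve (u ^ 4 * a) (u ^ 6 * b)) f ∧ ScalesBy f u := by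
  have := isElliptic_shortCurve h2 hΔ
  obtain ⟨f, hf, hf'⟩ := exists_isIsom ⟨Units.mk0 u hu, 0, 0, 0⟩ (shortCurve (u ^ 4 * a) (u ^ 6 * b))
  have hC : (⟨Units.mk0 u hu, 0, 0, 0⟩ : VariableChange k) • shortCurve (u ^ 4 * a) (u ^ 6 * b) =
      shortCurve a b := by
    ext
    · simp [variableChange_a₁]
    · simp [variableChange_a₂]
    · simp [variableChange_a₃]
    · simp [variableChange_a₄, hu]
    · simp [variableChange_a₆, hu]
  have hs : ScalesBy f u := fun x y h => by simpa using hf' x y h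
  clear hf'
  revert f
  rw [hC]
  exact fun f hf hs => ⟨f, hf, hs⟩

/-- The map is `P ↦ P` or `P ↦ -P`. -/
def IsSign {A : Type*} [AddGroup A] (f : A → A) : Prop := (∀ P, f P = P) ∨ ∀ P, f P = -P

end Isomorphisms

/-! ### Trivial classes in PGL are those of scalars. -/

section ProjectiveLinear

variable {p : ℕ} [Fact p.Prime] {V : Type*} [AddCommGroup V] [Module (ZMod p) V]

lemma toPGL_eq_one {e : V ≃ₗ[ZMod p] V} {c : ZMod p} (h : ∀ x, e x = c • x) : toPGL e = 1 := by
  rw [toPGL, QuotientGroup.eq_one_iff, Subgroup.mem_center_iff]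
  intro g
  ext x
  change g.val (e x) = e (g.val x)
  rw [h, h, map_smul]

/-- An endomorphism that commutes with all transvections is a scalar. -/
lemma exists_smul_of_toPGL_eq_one (b : Module.Basis (Fin 2) (ZMod p) V) {e : V ≃ₗ[ZMod p] V}
    (h : toPGL e = 1) : ∃ c : ZMod p, ∀ x, e x = c • x := by
  rw [toPGL, QuotientGroup.eq_one_iff, Subgroup.mem_center_iff] at h
  obtain ⟨a, ha⟩ := LinearMap.commute_transvections_iff_of_basis b (f := e.toLinearMap)
    fun i j r hij => by
      have hf : b.coord i (r • b j) = 0 := by simp [hij.symm]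
      exact (congrArg Units.val (h (LinearMap.GeneralLinearGroup.ofLinearEquiv
        (LinearEquiv.transvection hf)))).symm
  exact ⟨a, fun x => LinearMap.congr_fun ha x⟩

end ProjectiveLinear

/-! ### The curves y² = x³ + x and y² = x³ + 1 with their extra automorphisms. -/

section StandardCurves

open WeierstrassCurve

variable {k : Type*} [Field k] [DecidableEq k]

lemma coe_torsionEquiv_iterate (p : ℕ) {E : WeierstrassCurve k}
    (f : E.toAffine.Point ≃+ E.toAffine.Point) (i : ℕ) (x : Torsion p E) :
    ((torsionEquiv p f)^[i] x : E.toAffine.Point) = f^[i] x := by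
  induction i generalizing x with
  | zero => rfl
  | succ i ih => rw [Function.iterate_succ_apply, Function.iterate_succ_apply, ih, coe_torsionEquiv]

lemma toPGL_eq_one_of_isSign {p : ℕ} [Fact p.Prime] {E : WeierstrassCurve k}
    {f : E.toAffine.Point ≃+ E.toAffine.Point} (h : IsSign f) : toPGL (torsionEquiv p f) = 1 := by
  rcases h with h | h
  · exact toPGL_eq_one (c := 1) fun x => Subtype.ext (by rw [coe_torsionEquiv, h, one_smul])
  · exact toPGL_eq_one (c := -1) fun x => Subtype.ext (by
      rw [coe_torsionEquiv, h, neg_smul, one_smul]; rfl)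

/-- Up to sign, the first map is a power of the second one. -/
def SignPow {A : Type*} [AddGroup A] (f g : A → A) : Prop :=
  ∃ i : ℕ, (∀ P, f P = g^[i] P) ∨ ∀ P, f P = -g^[i] P

lemma SignPow.torsion {p : ℕ} {E : WeierstrassCurve k} {f g : E.toAffine.Point ≃+ E.toAffine.Point}
    (h : SignPow f g) : SignPow (torsionEquiv p f) (torsionEquiv p g) := by
  obtain ⟨i, h | h⟩ := h
  · exact ⟨i, Or.inl fun x => Subtype.ext (by
      rw [coe_torsionEquiv, coe_torsionEquiv_iterate, h])⟩
  · exact ⟨i, Or.inr fun x => Subtype.ext (by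
      rw [coe_torsionEquiv, h, ← coe_torsionEquiv_iterate]; rfl)⟩

lemma ScalesBy.isSign {a b u : k}
    {f : (shortCurve a b).toAffine.Point ≃+ (shortCurve a b).toAffine.Point}
    (h : ScalesBy f u) (hu : u ^ 2 = 1) : IsSign f := by
  have : (u - 1) * (u + 1) = 0 := by linear_combination hu
  rcases mul_eq_zero.mp this with h' | h'
  · rw [sub_eq_zero.mp h'] at h
    exact Or.inl fun P => h.apply_eq (scalesBy_refl _) P
  · rw [eq_neg_of_add_eq_zero_left h'] at h
    exact Or.inr fun P => h.apply_eq (scalesBy_neg a b) P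

lemma ScalesBy.apply_eq_neg {a b u : k}
    {f g : (shortCurve a b).toAffine.Point ≃+ (shortCurve a b).toAffine.Point}
    (hf : ScalesBy f (-u)) (hg : ScalesBy g u) (P : (shortCurve a b).toAffine.Point) :
    f P = -g P := by
  rw [← mul_neg_one] at hf
  exact hf.apply_eq (hg.trans (scalesBy_neg a b)) P

/-- A curve `E₀` with an automorphism `g` such that every elliptic curve with an automorphism
of order `r` modulo `±1` is isomorphic to `E₀`, and every automorphism of `E₀` is a power of `g`,
up to sign. -/
structure IsStandard (r : ℕ) (E₀ : WeierstrassCurve k)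
    (g : E₀.toAffine.Point ≃+ E₀.toAffine.Point) : Prop where
  isElliptic : E₀.IsElliptic
  isIsom : IsIsom E₀ E₀ g
  exists_isIsom : ∀ (p : ℕ) [Fact p.Prime] (E : WeierstrassCurve k) (_ : E.IsElliptic)
    (f : E.toAffine.Point ≃+ E.toAffine.Point), IsIsom E E f →
    orderOf (toPGL (torsionEquiv p f)) = r → ∃ e : E.toAffine.Point ≃+ E₀.toAffine.Point,
      IsIsom E E₀ e
  -- The first half shows that automorphisms fix every necklace fixed by g. The second shows that a
  -- necklace fixed by some f ≠ ±1 is fixed by g.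
  signPow : ∀ f, IsIsom E₀ E₀ f → SignPow f g ∧ (IsSign f ∨ SignPow g f)

lemma isSign_conj {A B : Type*} [AddGroup A] [AddGroup B] (e : A ≃+ B) {f : A → A} {f' : B → B}
    (h : ∀ P, f' (e P) = e (f P)) (hf : IsSign f') : IsSign f := by
  rcases hf with hf | hf
  · exact Or.inl fun P => e.injective (by rw [← h, hf])
  · exact Or.inr fun P => e.injective (by rw [← h, hf, map_neg])

/-- Every elliptic curve has a short Weierstrass equation. -/
lemma exists_isIsom_shortCurve (h2 : (2 : k) ≠ 0) (h3 : (3 : k) ≠ 0) (E : WeierstrassCurve k)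
    [E.IsElliptic] : ∃ a b : k, 4 * a ^ 3 + 27 * b ^ 2 ≠ 0 ∧
      ∃ e : (shortCurve a b).toAffine.Point ≃+ E.toAffine.Point, IsIsom (shortCurve a b) E e := by
  have : Invertible (2 : k) := invertibleOfNonzero h2
  have : Invertible (3 : k) := invertibleOfNonzero h3
  obtain ⟨C, hC⟩ := E.exists_variableChange_isShortNF
  obtain ⟨f, hf, -⟩ := exists_isIsom C E
  have hE : C • E = shortCurve (C • E).a₄ (C • E).a₆ := by
    ext
    · exact (C • E).a₁_of_isShortNF
    · exact (C • E).a₂_of_isShortNF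
    · exact (C • E).a₃_of_isShortNF
    · rfl
    · rfl
  refine ⟨(C • E).a₄, (C • E).a₆, ?_, ?_⟩
  · intro h
    have hΔ := (C • E).isUnit_Δ
    rw [(C • E).Δ_of_isShortNF, h, mul_zero] at hΔ
    exact not_isUnit_zero hΔ
  · rw [← hE]
    exact ⟨f, hf⟩

/-- The automorphisms of order `2` modulo scalars live on `y² = x³ + ax`, those of order `3` on
`y² = x³ + b`. -/
lemma exists_isIsom_of_orderOf (h2 : (2 : k) ≠ 0) (h3 : (3 : k) ≠ 0) {p : ℕ} [Fact p.Prime]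
    (E : WeierstrassCurve k) [E.IsElliptic] (f : E.toAffine.Point ≃+ E.toAffine.Point)
    (hf : IsIsom E E f) {r : ℕ} (hr : orderOf (toPGL (torsionEquiv p f)) = r) :
    ∃ a b : k, 4 * a ^ 3 + 27 * b ^ 2 ≠ 0 ∧ (r = 2 → b = 0) ∧ (r = 3 → a = 0) ∧
      ∃ e : E.toAffine.Point ≃+ (shortCurve a b).toAffine.Point, IsIsom E (shortCurve a b) e := by
  obtain ⟨a, b, hΔ, e, he⟩ := exists_isIsom_shortCurve h2 h3 E
  refine ⟨a, b, hΔ, ?_, ?_, e.symm, he.symm⟩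
  all_goals obtain ⟨u, hua, hub, hu⟩ := ((he.trans hf).trans he.symm).exists_scalesBy h2 h3
  · rintro rfl
    by_contra hb
    -- If b ≠ 0, then f³ = ±1, so the order in PGL divides 3. If a ≠ 0, then u⁴ = 1 and f² = ±1,
    -- which in the same way excludes order 3.
    have h6 : u ^ 6 = 1 := mul_right_cancel₀ hb (by rw [hub, one_mul])
    have h := ((hu.trans hu).trans hu).isSign (by rw [← h6]; ring)
    have h' : IsSign ((f.trans f).trans f) := isSign_conj e.symm (fun P => by simp) h
    have h1 := toPGL_eq_one_of_isSign (p := p) h'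
    have h1 : toPGL (torsionEquiv p f) ^ 3 = 1 := by
      rw [← h1, pow_succ, pow_two]; rfl
    have := orderOf_dvd_of_pow_eq_one h1
    rw [hr] at this
    omega
  · rintro rfl
    by_contra hb
    have h4 : u ^ 4 = 1 := mul_right_cancel₀ hb (by rw [hua, one_mul])
    have h := (hu.trans hu).isSign (by rw [← h4]; ring)
    have h' : IsSign (f.trans f) := isSign_conj e.symm (fun P => by simp) h
    have h1 := toPGL_eq_one_of_isSign (p := p) h'
    have h1 : toPGL (torsionEquiv p f) ^ 2 = 1 := by
      rw [← h1, pow_two]; rfl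
    have := orderOf_dvd_of_pow_eq_one h1
    rw [hr] at this
    omega

variable [IsAlgClosed k]

lemma exists_isStandard_two (h2 : (2 : k) ≠ 0) (h3 : (3 : k) ≠ 0) {ι : k} (hι : ι ^ 2 = -1) :
    ∃ g : (shortCurve (1 : k) 0).toAffine.Point ≃+ (shortCurve (1 : k) 0).toAffine.Point,
      ScalesBy g ι ∧ IsStandard 2 (shortCurve (1 : k) 0) g ∧ ∀ P, g (g P) = -P := by
  have h4 : (4 : k) ≠ 0 := by
    have : (4 : k) = 2 * 2 := by norm_num
    rw [this]
    exact mul_ne_zero h2 h2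
  have hΔ : 4 * (1 : k) ^ 3 + 27 * 0 ^ 2 ≠ 0 := by simpa using h4
  have hι0 : ι ≠ 0 := by
    rintro rfl
    simp at hι
  obtain ⟨g, hg, hgs⟩ : ∃ g : (shortCurve (1 : k) 0).toAffine.Point ≃+
      (shortCurve (1 : k) 0).toAffine.Point, IsIsom (shortCurve (1 : k) 0) (shortCurve (1 : k) 0) g ∧
      ScalesBy g ι := by
    have e1 : ι ^ 4 * 1 = 1 := by linear_combination (ι ^ 2 - 1) * hι
    have := exists_isIsom_scalesBy h2 (a := 1) (b := 0) hι0 (by rw [e1, mul_zero]; exact hΔ)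
    rwa [e1, mul_zero] at this
  refine ⟨g, hgs, ⟨isElliptic_shortCurve h2 hΔ, hg, ?_, ?_⟩, fun P => ?_⟩
  · intro p _ E hE f hf hr
    obtain ⟨a, b, hab, hb, -, e, he⟩ := exists_isIsom_of_orderOf h2 h3 E f hf hr
    obtain rfl := hb rfl
    have ha : a ≠ 0 := by
      rintro rfl
      simp at hab
    obtain ⟨w, hw⟩ := IsAlgClosed.exists_pow_nat_eq a⁻¹ (n := 4) (by norm_num)
    have hwa : w ^ 4 * a = 1 := by rw [hw, inv_mul_cancel₀ ha]
    have hw0 : w ≠ 0 := by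
      rintro rfl
      simp at hwa
    have := exists_isIsom_scalesBy h2 (a := a) (b := 0) hw0 (by rw [hwa, mul_zero]; exact hΔ)
    rw [hwa, mul_zero] at this
    obtain ⟨e', he', -⟩ := this
    exact ⟨_, he.trans he'⟩
  · intro f hf
    obtain ⟨u, hu, -, hfu⟩ := hf.exists_scalesBy h2 h3
    -- This is u⁴ = 1, whose roots ±1 and ±ι give the automorphisms ±1 and ±g.
    have : (u ^ 2 - 1) * ((u - ι) * (u + ι)) = 0 := by
      linear_combination hu + (1 - u ^ 2) * hι
    rcases mul_eq_zero.mp this with h | h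
    · have hs := hfu.isSign (sub_eq_zero.mp h)
      exact ⟨⟨0, hs⟩, Or.inl hs⟩
    · rcases mul_eq_zero.mp h with h | h
      · rw [sub_eq_zero.mp h] at hfu
        exact ⟨⟨1, Or.inl fun P => hfu.apply_eq hgs P⟩,
          Or.inr ⟨1, Or.inl fun P => hgs.apply_eq hfu P⟩⟩
      · rw [eq_neg_of_add_eq_zero_left h] at hfu
        exact ⟨⟨1, Or.inr fun P => hfu.apply_eq_neg hgs P⟩, Or.inr ⟨1, Or.inr fun P => by
          rw [Function.iterate_one, hfu.apply_eq_neg hgs P, neg_neg]⟩⟩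
  · have := hgs.trans hgs
    rw [← pow_two, hι] at this
    exact this.apply_eq (scalesBy_neg _ _) P

lemma exists_isStandard_three (h2 : (2 : k) ≠ 0) (h3 : (3 : k) ≠ 0) :
    ∃ g : (shortCurve (0 : k) 1).toAffine.Point ≃+ (shortCurve (0 : k) 1).toAffine.Point,
      IsStandard 3 (shortCurve (0 : k) 1) g ∧ ∀ P, P + g P + g (g P) = 0 := by
  have hΔ : 4 * (0 : k) ^ 3 + 27 * 1 ^ 2 ≠ 0 := by
    have : 4 * (0 : k) ^ 3 + 27 * 1 ^ 2 = 3 ^ 3 := by norm_num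
    rw [this]
    exact pow_ne_zero 3 h3
  obtain ⟨ω, hω⟩ : ∃ ω : k, ω ^ 2 + ω + 1 = 0 := by
    obtain ⟨s, hs⟩ := IsAlgClosed.exists_pow_nat_eq (-3 : k) (n := 2) (by norm_num)
    refine ⟨(-1 + s) / 2, ?_⟩
    field_simp
    linear_combination hs
  have hω3 : ω ^ 3 = 1 := by linear_combination (ω - 1) * hω
  have hω0 : ω ≠ 0 := by
    rintro rfl
    simp at hω
  have hω1 : ω ^ 2 ≠ 1 := by
    intro h
    have h1 : ω = -2 := by linear_combination hω - h
    rw [h1] at hω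
    exact h3 (by linear_combination hω)
  obtain ⟨g, hg, hgs⟩ : ∃ g : (shortCurve (0 : k) 1).toAffine.Point ≃+
      (shortCurve (0 : k) 1).toAffine.Point, IsIsom (shortCurve (0 : k) 1) (shortCurve (0 : k) 1) g ∧
      ScalesBy g ω := by
    have e1 : ω ^ 6 * 1 = 1 := by linear_combination (ω ^ 3 + 1) * hω3
    have := exists_isIsom_scalesBy h2 (a := 0) (b := 1) hω0 (by rw [e1, mul_zero]; exact hΔ)
    rwa [e1, mul_zero] at this
  refine ⟨g, ⟨isElliptic_shortCurve h2 hΔ, hg, ?_, ?_⟩, fun P => ?_⟩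
  · intro p _ E hE f hf hr
    obtain ⟨a, b, hab, -, ha, e, he⟩ := exists_isIsom_of_orderOf h2 h3 E f hf hr
    obtain rfl := ha rfl
    have hb : b ≠ 0 := by
      rintro rfl
      simp at hab
    obtain ⟨w, hw⟩ := IsAlgClosed.exists_pow_nat_eq b⁻¹ (n := 6) (by norm_num)
    have hwb : w ^ 6 * b = 1 := by rw [hw, inv_mul_cancel₀ hb]
    have hw0 : w ≠ 0 := by
      rintro rfl
      simp at hwb
    have := exists_isIsom_scalesBy h2 (a := 0) (b := b) hw0 (by rw [hwb, mul_zero]; exact hΔ)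
    rw [hwb, mul_zero] at this
    obtain ⟨e', he', -⟩ := this
    exact ⟨_, he.trans he'⟩
  · intro f hf
    obtain ⟨u, -, hu, hfu⟩ := hf.exists_scalesBy h2 h3
    have hg2 : ScalesBy (g.trans g) (ω ^ 2) := by
      rw [pow_two]
      exact hgs.trans hgs
    -- If f scales by ±ω², then f² scales by ω⁴ = ω and equals g.
    have hf2 : ∀ {v : k}, v ^ 2 = ω ^ 4 → ScalesBy f v → SignPow g f := fun {v} hv hfv =>
      ⟨2, Or.inl fun P => by
        have := hfv.trans hfv
        rw [← pow_two, hv, show ω ^ 4 = ω by linear_combination ω * hω3] at this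
        exact hgs.apply_eq this P⟩
    have : (u ^ 2 - 1) * (((u - ω) * (u + ω)) * ((u - ω ^ 2) * (u + ω ^ 2))) = 0 := by
      linear_combination hu + (-u ^ 4 + u ^ 2) * (ω ^ 2 + (1 - ω)) * hω +
        (u ^ 2 - 1) * (ω ^ 3 + 1) * hω3
    rcases mul_eq_zero.mp this with h | h
    · have hs := hfu.isSign (sub_eq_zero.mp h)
      exact ⟨⟨0, hs⟩, Or.inl hs⟩
    rcases mul_eq_zero.mp h with h | h
    · rcases mul_eq_zero.mp h with h | h
      · rw [sub_eq_zero.mp h] at hfu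
        exact ⟨⟨1, Or.inl fun P => hfu.apply_eq hgs P⟩,
          Or.inr ⟨1, Or.inl fun P => hgs.apply_eq hfu P⟩⟩
      · rw [eq_neg_of_add_eq_zero_left h] at hfu
        exact ⟨⟨1, Or.inr fun P => hfu.apply_eq_neg hgs P⟩, Or.inr ⟨1, Or.inr fun P => by
          rw [Function.iterate_one, hfu.apply_eq_neg hgs P, neg_neg]⟩⟩
    · rcases mul_eq_zero.mp h with h | h
      · have hf2 := hf2 (by rw [sub_eq_zero.mp h]; ring) hfu
        rw [sub_eq_zero.mp h] at hfu
        exact ⟨⟨2, Or.inl fun P => hfu.apply_eq hg2 P⟩, Or.inr hf2⟩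
      · have hf2 := hf2 (by rw [eq_neg_of_add_eq_zero_left h]; ring) hfu
        rw [eq_neg_of_add_eq_zero_left h] at hfu
        exact ⟨⟨2, Or.inr fun P => hfu.apply_eq_neg hg2 P⟩, Or.inr hf2⟩
  · rcases P with _ | ⟨x, y, h⟩
    · rw [← Affine.Point.zero_def, map_zero, map_zero, add_zero, add_zero]
    · obtain ⟨h₁, e₁⟩ := hgs x y h
      obtain ⟨h₂, e₂⟩ := hgs _ _ h₁
      rw [e₁, e₂]
      -- The points P, g(P) and g²(P) share their y-coordinate, so they lie on a horizontal line.
      -- When x = 0 they coincide and that line is the tangent at a flex.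
      obtain ⟨h₃, e₃⟩ := shortCurve_add_some (ℓ := 0) (x₃ := ω ^ 2 * (ω ^ 2 * x)) h h₁ (by
        by_cases hx : x = 0
        · subst hx
          have hy := (shortCurve_equation_iff _ _ _ _).mp h.1
          refine Or.inr ⟨by simp, by rw [hω3, one_mul], mul_ne_zero h2 ?_, by simp⟩
          rintro rfl
          simp at hy
        · refine Or.inl ⟨fun e => hω1 ?_, by rw [hω3]; ring⟩
          exact mul_right_cancel₀ hx (by rw [← e, one_mul])) (by
        linear_combination (ω ^ 2 - ω + 1) * x * hω)
      rw [e₃, Affine.Point.add_of_Y_eq rfl]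
      simp only [Affine.negY, hω3]
      ring

end StandardCurves

/-! ### Plane endomorphisms annihilated by the minimal polynomial of γ. -/

section QuadraticMaps

open Polynomial

variable {p : ℕ} [Fact p.Prime]

lemma finrank_galoisField : Module.finrank (ZMod p) (GaloisField p 2) = 2 :=
  GaloisField.finrank p two_ne_zero

variable {γ : (GaloisField p 2)ˣ}

lemma orderOf_generator (hγ : ∀ x, x ∈ Subgroup.zpowers γ) : orderOf γ = p ^ 2 - 1 := by
  rw [orderOf_eq_card_of_forall_mem_zpowers hγ, Nat.card_units, GaloisField.card p 2 two_ne_zero]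

/-- From c^(p-1) = 1 the order (p + 1)(p - 1) of γ divides i(p - 1). -/
lemma dvd_of_pow_eq_algebraMap (hγ : ∀ x, x ∈ Subgroup.zpowers γ) {i : ℕ} {c : ZMod p}
    (h : (γ : GaloisField p 2) ^ i = algebraMap (ZMod p) _ c) : p + 1 ∣ i := by
  have hp := (Fact.out : p.Prime).two_le
  have hc : c ≠ 0 := by
    rintro rfl
    rw [map_zero] at h
    exact pow_ne_zero i γ.ne_zero h
  have h1 : γ ^ (i * (p - 1)) = 1 := by
    ext
    rw [pow_mul, Units.val_pow_eq_pow_val, Units.val_pow_eq_pow_val, h, ← map_pow,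
      ZMod.pow_card_sub_one_eq_one hc, map_one, Units.val_one]
  have h2 := orderOf_dvd_of_pow_eq_one h1
  rw [orderOf_generator hγ] at h2
  have h3 : p ^ 2 - 1 = (p + 1) * (p - 1) := by
    obtain ⟨q, rfl⟩ := Nat.exists_eq_add_of_le' (by omega : 1 ≤ p)
    simp only [Nat.add_sub_cancel]
    rw [Nat.sub_eq_iff_eq_add (Nat.one_le_pow _ _ (by omega))]
    ring
  rw [h3] at h2
  exact Nat.dvd_of_mul_dvd_mul_right (by omega) h2

/-- The minimal polynomial of a generator of `𝔽_{p²}ˣ`. -/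
lemma exists_minpoly_eq (hp : 3 < p) (hγ : ∀ x, x ∈ Subgroup.zpowers γ) :
    ∃ t n : ZMod p, minpoly (ZMod p) (γ : GaloisField p 2) = X ^ 2 - C t * X + C n ∧ t ≠ 0 ∧
      ∀ c, c * c ≠ t * c - n := by
  have hint : IsIntegral (ZMod p) (γ : GaloisField p 2) := Algebra.IsIntegral.isIntegral _
  have hnot : ∀ c : ZMod p, algebraMap (ZMod p) (GaloisField p 2) c ≠ γ := fun c hc => by
    have := dvd_of_pow_eq_algebraMap hγ (i := 1) (c := c) (by rw [pow_one, hc])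
    have := Nat.le_of_dvd one_pos this
    omega
  set q := minpoly (ZMod p) (γ : GaloisField p 2) with hq
  have hmonic : q.Monic := minpoly.monic hint
  have hdeg : q.natDegree = 2 := by
    refine le_antisymm ?_ ?_
    · rw [← finrank_galoisField (p := p)]
      exact minpoly.natDegree_le _
    · by_contra! h
      have h1 : q.natDegree = 1 := by
        have : 0 < q.natDegree := minpoly.natDegree_pos hint
        omega
      obtain ⟨c, hc⟩ := minpoly.natDegree_eq_one_iff.mp h1
      exact hnot c hc
  have hqe : q = X ^ 2 - C (-q.coeff 1) * X + C (q.coeff 0) := by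
    have h2 : q.coeff 2 = 1 := by rw [← hdeg]; exact hmonic
    conv_lhs => rw [q.as_sum_range_C_mul_X_pow, hdeg]
    simp only [Finset.sum_range_succ, Finset.sum_range_zero, h2, C_1, C_neg]
    ring
  have haeval : (γ : GaloisField p 2) ^ 2 + algebraMap _ _ (q.coeff 1) * γ +
      algebraMap _ _ (q.coeff 0) = 0 := by
    have := minpoly.aeval (ZMod p) (γ : GaloisField p 2)
    rw [← hq, hqe] at this
    simpa using this
  refine ⟨-q.coeff 1, q.coeff 0, hqe, fun h => ?_, fun c hc => ?_⟩
  · rw [neg_eq_zero] at h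
    rw [h, map_zero, zero_mul, add_zero] at haeval
    -- Trace zero would put γ² in 𝔽_p, against p + 1 > 2. The case i = 1 above showed that γ itself
    -- is not in 𝔽_p.
    have := dvd_of_pow_eq_algebraMap hγ (i := 2) (c := -q.coeff 0)
      (by rw [map_neg]; exact eq_neg_of_add_eq_zero_left haeval)
    have := Nat.le_of_dvd two_pos this
    omega
  · have hirr : Irreducible q := minpoly.irreducible hint
    have hroot : q.IsRoot c := by
      rw [IsRoot, hqe]
      simp only [eval_add, eval_sub, eval_mul, eval_pow, eval_X, eval_C]
      linear_combination hc
    have := degree_eq_one_of_irreducible_of_root hirr hroot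
    rw [degree_eq_natDegree hirr.ne_zero, hdeg] at this
    norm_num at this

variable {V W : Type*} [AddCommGroup V] [Module (ZMod p) V] [AddCommGroup W] [Module (ZMod p) W]
  {t n : ZMod p}

lemma linearIndependent_of_quadratic (hroot : ∀ c : ZMod p, c * c ≠ t * c - n)
    {φ : V →ₗ[ZMod p] V} (hφ : ∀ v, φ (φ v) = t • φ v - n • v) {v : V} (hv : v ≠ 0) :
    LinearIndependent (ZMod p) ![v, φ v] := by
  rw [LinearIndependent.pair_iff' hv]
  intro c hc
  have h := hφ v
  rw [← hc, map_smul, ← hc, smul_smul, smul_smul, ← sub_smul] at h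
  exact hroot c (smul_left_injective _ hv h)

lemma exists_basis_of_quadratic (hV : Module.finrank (ZMod p) V = 2)
    (hroot : ∀ c : ZMod p, c * c ≠ t * c - n)
    {φ : V →ₗ[ZMod p] V} (hφ : ∀ v, φ (φ v) = t • φ v - n • v) {v : V} (hv : v ≠ 0) :
    ∃ b : Module.Basis (Fin 2) (ZMod p) V, b 0 = v ∧ b 1 = φ v := by
  have hli := linearIndependent_of_quadratic hroot hφ hv
  refine ⟨basisOfLinearIndependentOfCardEqFinrank hli (by simp [hV]), ?_, ?_⟩ <;> simp

/-- Two endomorphisms of planes annihilated by the same irreducible quadratic polynomial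
are conjugate. -/
lemma exists_conj_of_quadratic (hV : Module.finrank (ZMod p) V = 2)
    (hW : Module.finrank (ZMod p) W = 2) (hroot : ∀ c : ZMod p, c * c ≠ t * c - n)
    {φ : V →ₗ[ZMod p] V} (hφ : ∀ v, φ (φ v) = t • φ v - n • v)
    {ψ : W →ₗ[ZMod p] W} (hψ : ∀ v, ψ (ψ v) = t • ψ v - n • v) :
    ∃ e : V ≃ₗ[ZMod p] W, ∀ v, e (φ v) = ψ (e v) := by
  have : Nontrivial V := Module.nontrivial_of_finrank_pos (R := ZMod p) (by omega)
  have : Nontrivial W := Module.nontrivial_of_finrank_pos (R := ZMod p) (by omega)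
  obtain ⟨v, hv⟩ := exists_ne (0 : V)
  obtain ⟨w, hw⟩ := exists_ne (0 : W)
  obtain ⟨b, hb0, hb1⟩ := exists_basis_of_quadratic hV hroot hφ hv
  obtain ⟨c, hc0, hc1⟩ := exists_basis_of_quadratic hW hroot hψ hw
  let e := b.equiv c (Equiv.refl _)
  have he0 : e v = w := by rw [← hb0, ← hc0]; simp [e]
  have he1 : e (φ v) = ψ w := by rw [← hb1, ← hc1]; simp [e]
  refine ⟨e, fun x => LinearMap.congr_fun
    (f := e.toLinearMap ∘ₗ φ) (g := ψ ∘ₗ e.toLinearMap) (b.ext fun i => ?_) x⟩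
  fin_cases i
  · simp [hb0, he0, he1]
  · simp [hb1, he0, he1, hφ, hψ]

/-- The minimal polynomial of γ is irreducible of degree dim V, so it annihilates g exactly when it
is the characteristic polynomial of g. This trades matrices for a relation on vectors. -/
lemma mem_rotations_iff (hV : Module.finrank (ZMod p) V = 2)
    (hm : minpoly (ZMod p) (γ : GaloisField p 2) = X ^ 2 - C t * X + C n)
    (g : LinearMap.GeneralLinearGroup (ZMod p) V) :
    g ∈ rotations γ V ↔ ∀ v, g.val (g.val v) = t • g.val v - n • v := by
  have : Module.Finite (ZMod p) V := Module.finite_of_finrank_pos (by omega)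
  have : Nontrivial V := Module.nontrivial_of_finrank_pos (R := ZMod p) (by omega)
  have haeval : aeval g.val (minpoly (ZMod p) (γ : GaloisField p 2)) = 0 ↔
      ∀ v, g.val (g.val v) = t • g.val v - n • v := by
    rw [hm, LinearMap.ext_iff]
    refine forall_congr' fun v => ?_
    simp only [map_add, map_sub, map_mul, aeval_X, aeval_C, LinearMap.add_apply,
      LinearMap.sub_apply, Module.End.mul_apply, Module.algebraMap_end_apply, pow_two,
      LinearMap.zero_apply]
    constructor
    · intro h
      rw [← sub_eq_zero, ← h]
      abel
    · intro h
      rw [h]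
      abel
  rw [← haeval]
  constructor
  · rintro ⟨b, hb⟩
    rw [← hb, LinearMap.charpoly_toMatrix]
    exact LinearMap.aeval_self_charpoly _
  · intro h
    have hint : IsIntegral (ZMod p) (γ : GaloisField p 2) := Algebra.IsIntegral.isIntegral _
    refine ⟨Module.finBasisOfFinrankEq (ZMod p) V hV, ?_⟩
    rw [LinearMap.charpoly_toMatrix]
    have h1 := minpoly.eq_of_irreducible_of_monic (minpoly.irreducible hint) h (minpoly.monic hint)
    refine (eq_of_monic_of_dvd_of_natDegree_le (minpoly.monic hint)
      (LinearMap.charpoly_monic _) (h1 ▸ LinearMap.minpoly_dvd_charpoly _) ?_)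
    rw [LinearMap.charpoly_natDegree, hV, hm]
    have h2 : (X ^ 2 - C t * X + C n).natDegree = 2 := by compute_degree!
    exact h2.ge

end QuadraticMaps

/-! ### Oriented necklaces as square roots of δ = t²/4 - n. -/

section SquareRoots

open Polynomial

variable {p : ℕ} [Fact p.Prime]

/-- `γ` generates `𝔽_{p²}ˣ` and has trace `t ≠ 0` and norm `n`. -/
structure HasTraceNorm (γ : (GaloisField p 2)ˣ) (t n : ZMod p) : Prop where
  generates : ∀ x, x ∈ Subgroup.zpowers γ
  minpoly_eq : minpoly (ZMod p) (γ : GaloisField p 2) = X ^ 2 - C t * X + C n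
  trace_ne_zero : t ≠ 0
  no_root : ∀ c, c * c ≠ t * c - n
  two_ne_zero : (2 : ZMod p) ≠ 0

variable {γ : (GaloisField p 2)ˣ} {t n : ZMod p} {V W : Type*} [AddCommGroup V] [Module (ZMod p) V]
  [AddCommGroup W] [Module (ZMod p) W]

lemma HasTraceNorm.norm_ne_zero (hγ : HasTraceNorm γ t n) : n ≠ 0 := by
  rintro rfl
  exact hγ.no_root 0 (by ring)

lemma HasTraceNorm.mul_self_generator (hγ : HasTraceNorm γ t n) :
    (γ : GaloisField p 2) * γ = t • (γ : GaloisField p 2) - n • 1 := by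
  have := minpoly.aeval (ZMod p) (γ : GaloisField p 2)
  rw [hγ.minpoly_eq] at this
  simp only [map_add, map_sub, map_mul, aeval_X, aeval_C, map_pow] at this
  rw [Algebra.smul_def, Algebra.smul_def]
  linear_combination this

/-- The quarter of the discriminant of `X² - t X + n`. -/
def quarterDisc (t n : ZMod p) : ZMod p := (t / 2) ^ 2 - n

lemma HasTraceNorm.not_isSquare (hγ : HasTraceNorm γ t n) : ¬ IsSquare (quarterDisc t n) := by
  rintro ⟨s, hs⟩
  have h2 := hγ.two_ne_zero
  refine hγ.no_root (t / 2 + s) ?_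
  rw [quarterDisc] at hs
  have : t = 2 * (t / 2) := by field_simp
  linear_combination (-1 : ZMod p) * hs - (t / 2 + s) * this

lemma HasTraceNorm.quarterDisc_ne_zero (hγ : HasTraceNorm γ t n) : quarterDisc t n ≠ 0 := fun h =>
  hγ.not_isSquare (h ▸ IsSquare.zero)

/-- Completing the square with N = g - t/2. -/
lemma HasTraceNorm.quadratic_iff (hγ : HasTraceNorm γ t n) (N : Module.End (ZMod p) V) (v : V) :
    ((t / 2) • 1 + N) (((t / 2) • 1 + N) v) = t • ((t / 2) • 1 + N) v - n • v ↔
      N (N v) = quarterDisc t n • v := by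
  have h2 := hγ.two_ne_zero
  have ht : t = t / 2 + t / 2 := by field_simp; ring
  simp only [LinearMap.add_apply, LinearMap.smul_apply, Module.End.one_apply, map_add, map_smul]
  rw [← sub_eq_zero, ← sub_eq_zero (a := N (N v)), quarterDisc]
  generalize t / 2 = s at ht
  subst ht
  refine Eq.congr ?_ rfl
  module

/-- The endomorphisms `N` of `V` with `N² = δ`. -/
abbrev Sqrt (δ : ZMod p) (V : Type*) [AddCommGroup V] [Module (ZMod p) V] : Type _ :=
  {N : Module.End (ZMod p) V // ∀ v, N (N v) = δ • v}

instance (δ : ZMod p) : Neg (Sqrt δ V) where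
  neg N := ⟨-N.1, fun v => by simp [N.2]⟩

/-- From (t/2 + N)(t/2 - N) = t²/4 - δ = n, the inverse is n⁻¹(t/2 - N). -/
lemma HasTraceNorm.exists_rotation (hγ : HasTraceNorm γ t n) (hV : Module.finrank (ZMod p) V = 2)
    (N : Sqrt (quarterDisc t n) V) : ∃ g ∈ rotations γ V, g.val = (t / 2) • 1 + N.1 := by
  have hn := hγ.norm_ne_zero
  have hinv : ∀ M : Sqrt (quarterDisc t n) V,
      ((t / 2) • 1 + M.1) * (n⁻¹ • ((t / 2) • 1 - M.1)) = 1 := fun M => by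
    ext v
    simp only [Module.End.mul_apply, LinearMap.add_apply, LinearMap.smul_apply, Module.End.one_apply,
      LinearMap.sub_apply, map_smul, map_sub, M.2]
    have : n⁻¹ * ((t / 2) ^ 2 - quarterDisc t n) = 1 := by
      rw [quarterDisc, sub_sub_cancel, inv_mul_cancel₀ hn]
    conv_rhs => rw [← one_smul (ZMod p) v, ← this]
    module
  refine ⟨⟨(t / 2) • 1 + N.1, n⁻¹ • ((t / 2) • 1 - N.1), hinv N, ?_⟩,
    (mem_rotations_iff hV hγ.minpoly_eq _).mpr fun v => (hγ.quadratic_iff N.1 v).mpr (N.2 v), rfl⟩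
  have h := hinv (-N)
  change ((t / 2) • 1 + -N.1) * (n⁻¹ • ((t / 2) • 1 - -N.1)) = 1 at h
  rw [mul_smul_comm, ← sub_eq_add_neg, sub_neg_eq_add] at h
  rw [smul_mul_assoc]
  exact h

lemma smul_eq_self_of_smul {g : LinearMap.GeneralLinearGroup (ZMod p) V} {c : ZMod p}
    (h : ∀ v, g.val v = c • v) (x : ℙ (ZMod p) V) : g • x = x := by
  induction x using Projectivization.ind with
  | h v hv =>
    rw [Projectivization.smul_mk, Projectivization.mk_eq_mk_iff']
    exact ⟨c, (h v).symm⟩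

/-- A rotation is conjugate to multiplication by γ on 𝔽_{p²}. If its i-th power fixes a line, then
γ^i lies in 𝔽_p. -/
lemma HasTraceNorm.dvd_of_pow_smul_eq (hγ : HasTraceNorm γ t n)
    (hV : Module.finrank (ZMod p) V = 2) {g : LinearMap.GeneralLinearGroup (ZMod p) V}
    (hg : g ∈ rotations γ V) {i : ℕ} {x : ℙ (ZMod p) V} (h : g ^ i • x = x) : p + 1 ∣ i := by
  obtain ⟨e, he⟩ := exists_conj_of_quadratic hV finrank_galoisField hγ.no_root (φ := g.val)
    ((mem_rotations_iff hV hγ.minpoly_eq g).mp hg)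
    (ψ := LinearMap.mulLeft (ZMod p) (γ : GaloisField p 2)) fun v => by
      simp only [LinearMap.mulLeft_apply]
      rw [← mul_assoc, hγ.mul_self_generator, sub_mul, smul_mul_assoc, smul_mul_assoc, one_mul]
  have hpow : ∀ v, e ((g ^ i).val v) = (γ : GaloisField p 2) ^ i * e v := fun v => by
    clear h
    induction i with
    | zero => simp
    | succ i ih =>
      rw [pow_succ', Units.val_mul, Module.End.mul_apply, he, ih, LinearMap.mulLeft_apply, pow_succ',
        mul_assoc]
  induction x using Projectivization.ind with
  | h v hv =>
    rw [Projectivization.smul_mk, Projectivization.mk_eq_mk_iff'] at h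
    obtain ⟨c, hc⟩ := h
    refine dvd_of_pow_eq_algebraMap hγ.generates (c := c)
      (mul_right_cancel₀ (e.map_ne_zero_iff.mpr hv) ?_)
    rw [← hpow, ← Algebra.smul_def, ← map_smul, hc]
    rfl

lemma HasTraceNorm.natCast_eq_of_pow_smul_eq (hγ : HasTraceNorm γ t n)
    (hV : Module.finrank (ZMod p) V = 2) {g : LinearMap.GeneralLinearGroup (ZMod p) V}
    (hg : g ∈ rotations γ V) {i j : ℕ} {x : ℙ (ZMod p) V} (h : g ^ i • x = g ^ j • x) :
    (i : ZMod (p + 1)) = j := by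
  wlog hij : i ≤ j generalizing i j
  · exact (this h.symm (le_of_not_ge hij)).symm
  obtain ⟨l, rfl⟩ := Nat.exists_eq_add_of_le hij
  rw [pow_add, mul_smul, smul_left_cancel_iff] at h
  rw [Nat.cast_add, (ZMod.natCast_eq_zero_iff l (p + 1)).mpr
    (hγ.dvd_of_pow_smul_eq hV hg h.symm), add_zero]

/-- The p + 1 points g^i x are distinct, and ℙ(V) has p + 1 points. -/
lemma HasTraceNorm.exists_necklaceList (hγ : HasTraceNorm γ t n)
    (hV : Module.finrank (ZMod p) V = 2) {g : LinearMap.GeneralLinearGroup (ZMod p) V}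
    (hg : g ∈ rotations γ V) : ∃ c : NecklaceList γ V, ∀ i, g • c.pearl i = c.pearl (i + 1) := by
  have : Module.Finite (ZMod p) V := Module.finite_of_finrank_pos (by omega)
  have : Finite V := Module.finite_of_finite (ZMod p)
  have : Nontrivial V := Module.nontrivial_of_finrank_pos (R := ZMod p) (by omega)
  obtain ⟨x⟩ : Nonempty (ℙ (ZMod p) V) := inferInstance
  have hinj : Function.Injective fun i : ZMod (p + 1) => g ^ i.val • x := fun i j h => by
    have := hγ.natCast_eq_of_pow_smul_eq hV hg h
    rwa [ZMod.natCast_zmod_val, ZMod.natCast_zmod_val] at this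
  have hbij : Function.Bijective fun i : ZMod (p + 1) => g ^ i.val • x :=
    (Nat.bijective_iff_injective_and_card _).mpr ⟨hinj, by
      rw [Projectivization.card_of_finrank_two _ _ hV, Nat.card_zmod, Nat.card_zmod]⟩
  -- At the wrap-around `(i + 1).val` differs from `i.val + 1`, so the index of the next point is
  -- identified only modulo p + 1.
  have hstep : ∀ i : ZMod (p + 1), g • g ^ i.val • x = g ^ (i + 1).val • x := fun i => by
    obtain ⟨j, hj⟩ := hbij.2 (g • g ^ i.val • x)
    simp only at hj
    rw [← mul_smul, ← pow_succ'] at hj ⊢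
    have := hγ.natCast_eq_of_pow_smul_eq hV hg hj
    rw [Nat.cast_succ, ZMod.natCast_zmod_val, ZMod.natCast_zmod_val] at this
    rw [← hj, this]
  exact ⟨⟨Equiv.ofBijective _ hbij, g, hg, hstep⟩, hstep⟩

/-- Two rotations with the same action differ by a scalar c. Comparing their quadratic relations
gives c²t = ct, hence c = 1 because t ≠ 0 and c ≠ 0. -/
lemma HasTraceNorm.rotation_ext (hγ : HasTraceNorm γ t n)
    (hV : Module.finrank (ZMod p) V = 2) {g h : LinearMap.GeneralLinearGroup (ZMod p) V}
    (hg : g ∈ rotations γ V) (hh : h ∈ rotations γ V) (H : ∀ x : ℙ (ZMod p) V, g • x = h • x) :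
    g = h := by
  have : Nontrivial V := Module.nontrivial_of_finrank_pos (R := ZMod p) (by omega)
  obtain ⟨c, hc⟩ := LinearMap.exists_eq_smul_id_of_forall_notLinearIndependent
    (f := (h⁻¹ * g).val) fun v hv => by
      have hv0 : v ≠ 0 := hv.ne_zero 0
      rw [LinearIndependent.pair_iff' hv0] at hv
      have hx := H (.mk _ v hv0)
      rw [← inv_smul_eq_iff, ← mul_smul, Projectivization.smul_mk,
        Projectivization.mk_eq_mk_iff'] at hx
      obtain ⟨c, hc⟩ := hx
      exact hv c hc
  have hgh : ∀ v, g.val v = c • h.val v := fun v => by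
    have h1 : g = h * (h⁻¹ * g) := by group
    rw [h1, Units.val_mul, Module.End.mul_apply, hc]
    simp
  rw [mem_rotations_iff hV hγ.minpoly_eq] at hg hh
  obtain ⟨v, hv⟩ := exists_ne (0 : V)
  have hc0 : c ≠ 0 := by
    rintro rfl
    have := hgh v
    rw [zero_smul] at this
    have h2 := hg v
    rw [this, map_zero, smul_zero, zero_sub, zero_eq_neg] at h2
    exact (smul_ne_zero hγ.norm_ne_zero hv) h2
  have h1 := hg v
  rw [hgh, hgh, map_smul, hh] at h1
  have hli := LinearIndependent.pair_iff.mp (linearIndependent_of_quadratic hγ.no_root hh hv)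
    (n - c * c * n) (c * c * t - t * c) (by rw [← sub_eq_zero] at h1; rw [← h1]; module)
  have hc1 : c = 1 := by
    have h3 : (t * c) * (c - 1) = 0 := by linear_combination hli.2
    rcases mul_eq_zero.mp h3 with h4 | h4
    · exact absurd h4 (mul_ne_zero hγ.trace_ne_zero hc0)
    · exact sub_eq_zero.mp h4
  ext v
  rw [hgh, hc1, one_smul]

/-- The oriented necklace `v` is represented by an orbit of the rotation `t / 2 + N`. -/
def HasSqrt (t n : ZMod p) (v : OrientedNecklace γ V) (N : Sqrt (quarterDisc t n) V) : Prop :=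
  ∃ c : NecklaceList γ V, Quotient.mk _ c = v ∧ ∃ g ∈ rotations γ V, g.val = (t / 2) • 1 + N.1 ∧
    ∀ i, g • c.pearl i = c.pearl (i + 1)

lemma HasTraceNorm.exists_hasSqrt (hγ : HasTraceNorm γ t n) (hV : Module.finrank (ZMod p) V = 2)
    (v : OrientedNecklace γ V) : ∃ N, HasSqrt t n v N := by
  induction v using Quotient.inductionOn with
  | h c =>
    obtain ⟨g, hg, h⟩ := c.exists_rotation
    refine ⟨⟨g.val - (t / 2) • 1, fun v => (hγ.quadratic_iff _ v).mp ?_⟩, c, rfl, g, hg,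
      (add_sub_cancel _ _).symm, h⟩
    rw [add_sub_cancel]
    exact (mem_rotations_iff hV hγ.minpoly_eq g).mp hg v

lemma HasTraceNorm.exists_orientedNecklace (hγ : HasTraceNorm γ t n)
    (hV : Module.finrank (ZMod p) V = 2) (N : Sqrt (quarterDisc t n) V) :
    ∃ v : OrientedNecklace γ V, HasSqrt t n v N := by
  obtain ⟨g, hg, hgN⟩ := hγ.exists_rotation hV N
  obtain ⟨c, hc⟩ := hγ.exists_necklaceList hV hg
  exact ⟨Quotient.mk _ c, c, rfl, g, hg, hgN, hc⟩

lemma HasTraceNorm.sqrt_unique (hγ : HasTraceNorm γ t n) (hV : Module.finrank (ZMod p) V = 2)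
    {v : OrientedNecklace γ V} {N N' : Sqrt (quarterDisc t n) V}
    (h : HasSqrt t n v N) (h' : HasSqrt t n v N') : N = N' := by
  obtain ⟨c, rfl, g, hg, hgN, hc⟩ := h
  obtain ⟨c', hcc', g', hg', hgN', hc'⟩ := h'
  obtain ⟨a, ha⟩ := Quotient.exact hcc'
  have : g = g' := hγ.rotation_ext hV hg hg' fun x => by
    obtain ⟨i, rfl⟩ := c.pearl.surjective x
    rw [hc, ha, ha, hc', add_right_comm]
  rw [this, hgN', add_right_inj] at hgN
  exact Subtype.ext hgN.symm

/-- Both lists are orbits of the same rotation, so they differ by the shift that matches their base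
points. -/
lemma HasSqrt.unique {v v' : OrientedNecklace γ V} {N : Sqrt (quarterDisc t n) V}
    (h : HasSqrt t n v N) (h' : HasSqrt t n v' N) : v = v' := by
  obtain ⟨c, rfl, g, hg, hgN, hc⟩ := h
  obtain ⟨c', rfl, g', hg', hgN', hc'⟩ := h'
  have hgg : g = g' := Units.ext (hgN.trans hgN'.symm)
  subst hgg
  obtain ⟨a, ha⟩ := c.pearl.surjective (c'.pearl 0)
  refine Quotient.sound ⟨a, fun i => ?_⟩
  rw [← ZMod.natCast_zmod_val i]
  induction i.val with
  | zero => rw [Nat.cast_zero, zero_add, ha]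
  | succ j ih => rw [Nat.cast_succ, ← hc', ih, hc, add_right_comm]

/-- As (t/2 - N)(t/2 + N) is the scalar n, the rotation of -N acts on lines as the inverse of the
rotation of N. It therefore runs through the list backwards. -/
lemma HasTraceNorm.hasSqrt_w (hγ : HasTraceNorm γ t n) (hV : Module.finrank (ZMod p) V = 2)
    {v : OrientedNecklace γ V} {N : Sqrt (quarterDisc t n) V} (h : HasSqrt t n v N) :
    HasSqrt t n v.w (-N) := by
  obtain ⟨c, rfl, g, hg, hgN, hc⟩ := h
  obtain ⟨g', hg', hgN'⟩ := hγ.exists_rotation hV (-N)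
  refine ⟨c.reverse, rfl, g', hg', hgN', fun i => ?_⟩
  have hgg : ∀ x : ℙ (ZMod p) V, (g' * g) • x = x := smul_eq_self_of_smul (c := n) fun v => by
    rw [Units.val_mul, Module.End.mul_apply, hgN', hgN]
    change (t / 2) • ((t / 2) • v + N.1 v) + -(N.1 ((t / 2) • v + N.1 v)) = _
    have hN : N.1 (N.1 v) = ((t / 2) ^ 2 - n) • v := N.2 v
    rw [map_add, map_smul, hN]
    module
  rw [c.reverse_apply, c.reverse_apply]
  have := hgg (c.pearl (-1 - (i + 1)))
  rw [mul_smul, hc] at this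
  rw [← this]
  congr 3
  ring

/-- Conjugation of a square root of `δ` by a linear isomorphism. -/
def Sqrt.map {δ : ZMod p} (e : V ≃ₗ[ZMod p] W) (N : Sqrt δ V) : Sqrt δ W :=
  ⟨e.conj N.1, fun v => by simp [LinearEquiv.conj_apply, N.2]⟩

lemma Sqrt.map_apply {δ : ZMod p} (e : V ≃ₗ[ZMod p] W) (N : Sqrt δ V) (v : V) :
    (N.map e).1 (e v) = e (N.1 v) := by
  simp [Sqrt.map, LinearEquiv.conj_apply]

lemma HasTraceNorm.hasSqrt_map (hγ : HasTraceNorm γ t n) (hW : Module.finrank (ZMod p) W = 2)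
    {v : OrientedNecklace γ V} {N : Sqrt (quarterDisc t n) V} (h : HasSqrt t n v N)
    (e : V ≃ₗ[ZMod p] W) : HasSqrt t n (v.map e) (N.map e) := by
  obtain ⟨c, rfl, g, hg, hgN, hc⟩ := h
  obtain ⟨g', hg', hgN'⟩ := hγ.exists_rotation hW (N.map e)
  refine ⟨c.map e, rfl, g', hg', hgN', fun i => ?_⟩
  simp only [NecklaceList.map, Equiv.trans_apply]
  rw [← hc i]
  induction c.pearl i using Projectivization.ind with
  | h v hv =>
    have h1 : g'.val (e v) = e (g.val v) := by
      rw [hgN, hgN']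
      simp [Sqrt.map_apply]
    simp only [projEquiv, Equiv.coe_fn_mk, Projectivization.smul_mk, Projectivization.map_mk]
    congr 1

/-- The necklace given by a square root of the discriminant. -/
def HasTraceNorm.necklace (hγ : HasTraceNorm γ t n) (hV : Module.finrank (ZMod p) V = 2)
    (N : Sqrt (quarterDisc t n) V) : Necklace γ V :=
  (hγ.exists_orientedNecklace hV N).choose.toNecklace

lemma HasTraceNorm.necklace_eq (hγ : HasTraceNorm γ t n) (hV : Module.finrank (ZMod p) V = 2)
    {v : OrientedNecklace γ V} {N : Sqrt (quarterDisc t n) V} (h : HasSqrt t n v N) :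
    hγ.necklace hV N = v.toNecklace :=
  congrArg _ ((hγ.exists_orientedNecklace hV N).choose_spec.unique h)

lemma HasTraceNorm.necklace_surjective (hγ : HasTraceNorm γ t n)
    (hV : Module.finrank (ZMod p) V = 2) : Function.Surjective (hγ.necklace hV) := fun v => by
  induction v using Quotient.inductionOn with
  | h v =>
    obtain ⟨N, hN⟩ := hγ.exists_hasSqrt hV v
    exact ⟨N, hγ.necklace_eq hV hN⟩

lemma HasTraceNorm.necklace_eq_iff (hγ : HasTraceNorm γ t n) (hV : Module.finrank (ZMod p) V = 2)
    {N N' : Sqrt (quarterDisc t n) V} :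
    hγ.necklace hV N = hγ.necklace hV N' ↔ N' = N ∨ N' = -N := by
  obtain ⟨v, hv⟩ := hγ.exists_orientedNecklace hV N
  obtain ⟨v', hv'⟩ := hγ.exists_orientedNecklace hV N'
  rw [hγ.necklace_eq hV hv, hγ.necklace_eq hV hv']
  constructor
  · intro h
    rcases Quotient.exact h with rfl | rfl
    · exact Or.inl (hγ.sqrt_unique hV hv' hv)
    · exact Or.inr (hγ.sqrt_unique hV hv' (hγ.hasSqrt_w hV hv))
  · rintro (rfl | rfl)
    · exact congrArg _ (hv.unique hv')
    · exact Quotient.sound (Or.inr (hv'.unique (hγ.hasSqrt_w hV hv)))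

lemma HasTraceNorm.necklace_map (hγ : HasTraceNorm γ t n) (hV : Module.finrank (ZMod p) V = 2)
    (hW : Module.finrank (ZMod p) W = 2) (N : Sqrt (quarterDisc t n) V) (e : V ≃ₗ[ZMod p] W) :
    (hγ.necklace hV N).map e = hγ.necklace hW (N.map e) := by
  obtain ⟨v, hv⟩ := hγ.exists_orientedNecklace hV N
  rw [hγ.necklace_eq hV hv, hγ.necklace_eq hW (hγ.hasSqrt_map hW hv e)]
  rfl

end SquareRoots

/-! ### Quadratic equations over 𝔽_p. -/

section Counting

variable {p : ℕ} [Fact p.Prime]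

lemma ringChar_zmod_ne_two (h2 : (2 : ZMod p) ≠ 0) : ringChar (ZMod p) ≠ 2 := by
  rw [ZMod.ringChar_zmod_n]
  rintro rfl
  exact h2 rfl

lemma card_sqrts (h2 : (2 : ZMod p) ≠ 0) (a : ZMod p) :
    (Nat.card {y : ZMod p // y ^ 2 = a} : ℤ) = quadraticChar (ZMod p) a + 1 := by
  rw [← quadraticChar_card_sqrts (ringChar_zmod_ne_two h2) a, Set.toFinset_card,
    Nat.card_eq_fintype_card]
  rfl

/-- There are 1 + χ(d/a) solutions, and χ(d) = -1. -/
lemma card_mul_sq_eq (h2 : (2 : ZMod p) ≠ 0) {a d : ZMod p} (ha : a ≠ 0) (hd : ¬ IsSquare d) :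
    (Nat.card {y : ZMod p // a * y ^ 2 = d} : ℤ) = 1 - quadraticChar (ZMod p) a := by
  have h1 : ∀ y : ZMod p, a * y ^ 2 = d ↔ y ^ 2 = d * a * a⁻¹ ^ 2 := fun y => by
    rw [← mul_right_inj' ha, ← mul_right_inj' ha]
    field_simp
  rw [Nat.card_congr (Equiv.subtypeEquivRight h1), card_sqrts h2, map_mul, map_mul,
    quadraticChar_neg_one_iff_not_isSquare.mpr hd, quadraticChar_sq_one' (inv_ne_zero ha)]
  ring

/-- The sum of (1 + χ(u))(1 + χ(d - u)) over u reduces, by scaling with d, to the Jacobi sum of χ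
with its inverse, which is -χ(-1). -/
lemma card_sum_two_squares (h2 : (2 : ZMod p) ≠ 0) {d : ZMod p} (hd : d ≠ 0) :
    (Nat.card {x : ZMod p × ZMod p // x.1 ^ 2 + x.2 ^ 2 = d} : ℤ) =
      p - quadraticChar (ZMod p) (-1) := by
  set χ := quadraticChar (ZMod p) with hχ
  have hne : χ ≠ 1 := quadraticChar_ne_one (ringChar_zmod_ne_two h2)
  have hJ : ∑ w : ZMod p, χ w * χ (1 - w) = -χ (-1) := by
    have := jacobiSum_nontrivial_inv hne
    rwa [(quadraticChar_isQuadratic (ZMod p)).inv] at this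
  have hJ' : ∑ u : ZMod p, χ u * χ (d - u) = -χ (-1) := by
    rw [← hJ, ← Equiv.sum_comp (Equiv.mulLeft₀ d hd)]
    refine Finset.sum_congr rfl fun w _ => ?_
    have h1 : d - d * w = d * (1 - w) := by ring
    rw [Equiv.mulLeft₀_apply, h1, map_mul, map_mul]
    linear_combination χ w * χ (1 - w) * quadraticChar_sq_one hd
  have h0 : ∑ u : ZMod p, χ u = 0 := quadraticChar_sum_zero (ringChar_zmod_ne_two h2)
  have h0' : ∑ u : ZMod p, χ (d - u) = 0 := by
    rw [← h0]
    exact (Equiv.subLeft d).sum_comp fun u => χ u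
  let e : {x : ZMod p × ZMod p // x.1 ^ 2 + x.2 ^ 2 = d} ≃
      Σ u : ZMod p, {x : ZMod p // x ^ 2 = u} × {y : ZMod p // y ^ 2 = d - u} :=
    { toFun := fun x => ⟨x.1.1 ^ 2, ⟨x.1.1, rfl⟩, ⟨x.1.2, eq_sub_of_add_eq' x.2⟩⟩
      invFun := fun s => ⟨(s.2.1.1, s.2.2.1), by rw [s.2.1.2, s.2.2.2]; ring⟩
      left_inv := fun _ => rfl
      right_inv := by rintro ⟨_, ⟨x, rfl⟩, y⟩; rfl }
  rw [Nat.card_congr e, Nat.card_sigma, Nat.cast_sum]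
  simp only [Nat.card_prod, Nat.cast_mul, card_sqrts h2, ← hχ]
  calc ∑ u : ZMod p, (χ u + 1) * (χ (d - u) + 1)
      = ∑ u : ZMod p, (χ u * χ (d - u) + χ u + χ (d - u) + 1) :=
        Finset.sum_congr rfl fun u _ => by ring
    _ = p - χ (-1) := by
      rw [Finset.sum_add_distrib, Finset.sum_add_distrib, Finset.sum_add_distrib, hJ', h0, h0']
      simp [ZMod.card]
      ring

end Counting

/-! ### Counting the necklaces fixed by a linear map. -/

section FixedNecklaces

variable {p : ℕ} [Fact p.Prime] {γ : (GaloisField p 2)ˣ} {t n : ZMod p}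
  {V : Type*} [AddCommGroup V] [Module (ZMod p) V]

lemma Sqrt.finite (hV : Module.finrank (ZMod p) V = 2) (δ : ZMod p) : Finite (Sqrt δ V) := by
  have : Module.Finite (ZMod p) V := Module.finite_of_finrank_pos (by omega)
  have : Finite (Module.End (ZMod p) V) := Module.finite_of_finite (ZMod p)
  infer_instance

lemma Sqrt.ne_neg (hV : Module.finrank (ZMod p) V = 2) (h2 : (2 : ZMod p) ≠ 0) {δ : ZMod p}
    (hδ : δ ≠ 0) (N : Sqrt δ V) : N ≠ -N := fun h => by
  have : Nontrivial V := Module.nontrivial_of_finrank_pos (R := ZMod p) (by omega)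
  obtain ⟨v, hv⟩ := exists_ne (0 : V)
  have h1 : N.1 = -N.1 := congrArg Subtype.val h
  have h3 : ∀ w, N.1 w = 0 := fun w => by
    have := LinearMap.congr_fun h1 w
    rw [LinearMap.neg_apply, eq_neg_iff_add_eq_zero, ← two_smul (ZMod p)] at this
    exact (smul_eq_zero.mp this).resolve_left h2
  have := N.2 v
  rw [h3] at this
  exact smul_ne_zero hδ hv this.symm

lemma HasTraceNorm.finite_necklace (hγ : HasTraceNorm γ t n)
    (hV : Module.finrank (ZMod p) V = 2) : Finite (Necklace γ V) :=
  have := Sqrt.finite hV (quarterDisc t n)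
  Finite.of_surjective _ (hγ.necklace_surjective hV)

/-- The necklaces fixed by `g` correspond two-to-one to the square roots of `δ` that commute or
anticommute with `g`. -/
lemma HasTraceNorm.two_mul_ncard_fixed (hγ : HasTraceNorm γ t n)
    (hV : Module.finrank (ZMod p) V = 2) (g : V ≃ₗ[ZMod p] V) :
    2 * {v : Necklace γ V | v.map g = v}.ncard =
      Nat.card {N : Sqrt (quarterDisc t n) V // ∀ v, N.1 (g v) = g (N.1 v)} +
        Nat.card {N : Sqrt (quarterDisc t n) V // ∀ v, N.1 (g v) = -g (N.1 v)} := by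
  classical
  have := Sqrt.finite hV (quarterDisc t n)
  have := Fintype.ofFinite (Sqrt (quarterDisc t n) V)
  have hc : ∀ N : Sqrt (quarterDisc t n) V, N.map g = N ↔ ∀ v, N.1 (g v) = g (N.1 v) := fun N => by
    constructor
    · intro h v
      rw [← N.map_apply g, h]
    · intro h
      refine Subtype.ext (LinearMap.ext fun w => ?_)
      obtain ⟨v, rfl⟩ := g.surjective w
      rw [N.map_apply, h]
  have ha : ∀ N : Sqrt (quarterDisc t n) V, N.map g = -N ↔ ∀ v, N.1 (g v) = -g (N.1 v) := fun N => by
    constructor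
    · intro h v
      rw [← N.map_apply g, h]
      exact (neg_neg _).symm
    · intro h
      refine Subtype.ext (LinearMap.ext fun w => ?_)
      obtain ⟨v, rfl⟩ := g.surjective w
      rw [N.map_apply]
      exact (neg_eq_iff_eq_neg.mpr (h v)).symm
  have hfix : ∀ N, (hγ.necklace hV N).map g = hγ.necklace hV N ↔ N.map g = N ∨ N.map g = -N :=
    fun N => by
      rw [hγ.necklace_map hV hV, eq_comm, hγ.necklace_eq_iff]
  have hfib : ∀ N : Sqrt (quarterDisc t n) V,
      Finset.univ.filter (fun N' => hγ.necklace hV N' = hγ.necklace hV N) = {N, -N} := fun N => by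
    ext N'
    rw [Finset.mem_filter, eq_comm, hγ.necklace_eq_iff, Finset.mem_insert, Finset.mem_singleton]
    simp
  set S := Finset.univ.filter fun N : Sqrt (quarterDisc t n) V => N.map g = N ∨ N.map g = -N with hS
  have himage : {v : Necklace γ V | v.map g = v} = (S.image (hγ.necklace hV) : Finset _) := by
    ext v
    obtain ⟨N, rfl⟩ := hγ.necklace_surjective hV v
    rw [Set.mem_ofPred_eq, hfix, Finset.mem_coe, Finset.mem_image]
    constructor
    · intro h
      exact ⟨N, by simpa [hS] using h, rfl⟩
    · rintro ⟨N', hN', h⟩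
      rw [← hfix, ← h, hfix]
      simpa [hS] using hN'
  have hcard : S.card = (S.image (hγ.necklace hV)).card * 2 := by
    rw [Finset.card_eq_sum_card_image (hγ.necklace hV) S]
    refine Finset.sum_const_nat fun v hv => ?_
    obtain ⟨N, hN, rfl⟩ := Finset.mem_image.mp hv
    have : S.filter (fun N' => hγ.necklace hV N' = hγ.necklace hV N) = {N, -N} := by
      rw [← hfib N]
      ext N'
      rw [Finset.mem_filter, Finset.mem_filter, Finset.mem_filter]
      refine and_congr_left fun h => ?_
      rw [← hfix, h, hfix]
      simpa [hS] using hN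
    rw [this, Finset.card_pair (N.ne_neg hV hγ.two_ne_zero hγ.quarterDisc_ne_zero)]
  have hunion : S = Finset.univ.filter (fun N => ∀ v, N.1 (g v) = g (N.1 v)) ∪
      Finset.univ.filter (fun N => ∀ v, N.1 (g v) = -g (N.1 v)) := by
    ext N
    simp [hS, hc, ha]
  have hdisj : Disjoint (Finset.univ.filter (fun N : Sqrt (quarterDisc t n) V =>
      ∀ v, N.1 (g v) = g (N.1 v))) (Finset.univ.filter (fun N => ∀ v, N.1 (g v) = -g (N.1 v))) := by
    rw [Finset.disjoint_filter]
    intro N _ h1 h2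
    exact N.ne_neg hV hγ.two_ne_zero hγ.quarterDisc_ne_zero
      (((hc N).mpr h1).symm.trans ((ha N).mpr h2))
  rw [himage, Set.ncard_coe_finset, mul_comm, ← hcard, hunion, Finset.card_union_of_disjoint hdisj,
    Nat.card_eq_fintype_card, Nat.card_eq_fintype_card, Fintype.card_subtype, Fintype.card_subtype]

/-- A nonscalar endomorphism of a plane has a cyclic vector. Everything that commutes or
anticommutes with g is determined by its value there. -/
lemma exists_basis_of_not_scalar (hV : Module.finrank (ZMod p) V = 2) {g : V ≃ₗ[ZMod p] V}
    (hg : ¬ ∃ c : ZMod p, ∀ v, g v = c • v) :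
    ∃ b : Module.Basis (Fin 2) (ZMod p) V, b 1 = g (b 0) ∧
      (∀ x y : ZMod p, x • b 0 + y • g (b 0) = 0 → x = 0 ∧ y = 0) ∧
      ∀ v, ∃ x y : ZMod p, v = x • b 0 + y • g (b 0) := by
  by_contra! h
  refine hg ?_
  obtain ⟨c, hc⟩ := LinearMap.exists_eq_smul_id_of_forall_notLinearIndependent
    (f := g.toLinearMap) fun v hv => by
      let b := basisOfLinearIndependentOfCardEqFinrank hv (by simp [hV])
      have h0 : b 0 = v := by simp [b]
      have h1 : b 1 = g v := by simp [b]
      obtain ⟨w, hw⟩ := h b (by rw [h0, h1]) fun x y hxy => by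
        rw [h0] at hxy
        exact LinearIndependent.pair_iff.mp hv x y hxy
      refine hw (b.repr w 0) (b.repr w 1) ?_
      conv_lhs => rw [← b.sum_repr w, Fin.sum_univ_two, h1, h0]
      rw [h0]
  exact ⟨c, fun v => LinearMap.congr_fun hc v⟩

/-- An N commuting with g has the form x + yg. Its square is the nonsquare δ only if N = y(g - s),
and (g - s)² = s² - 1. -/
lemma card_commuting (hV : Module.finrank (ZMod p) V = 2) (h2 : (2 : ZMod p) ≠ 0) {δ : ZMod p}
    (hδ : ¬ IsSquare δ) {g : V ≃ₗ[ZMod p] V} (hg : ¬ ∃ c : ZMod p, ∀ v, g v = c • v) {s : ZMod p}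
    (hs : s ^ 2 ≠ 1) (hgs : ∀ v, g (g v) = (2 * s) • g v - v) :
    (Nat.card {N : Sqrt δ V // ∀ v, N.1 (g v) = g (N.1 v)} : ℤ) =
      1 - quadraticChar (ZMod p) (s ^ 2 - 1) := by
  obtain ⟨b, hb, hli, hspan⟩ := exists_basis_of_not_scalar hV hg
  rw [← card_mul_sq_eq h2 (sub_ne_zero.mpr hs) hδ]
  let F : {y : ZMod p // (s ^ 2 - 1) * y ^ 2 = δ} →
      {N : Sqrt δ V // ∀ v, N.1 (g v) = g (N.1 v)} := fun y =>
    ⟨⟨y.1 • (g.toLinearMap - s • LinearMap.id), fun v => by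
      have hy := y.2
      simp only [LinearMap.smul_apply, LinearMap.sub_apply, LinearEquiv.coe_coe, LinearMap.id_apply,
        map_smul, map_sub, hgs, ← hy]
      module⟩, fun v => by simp⟩
  have hF : ∀ y v, (F y).1.1 v = y.1 • (g v - s • v) := fun y v => rfl
  refine congrArg _ (Nat.card_congr (Equiv.ofBijective F ⟨fun y y' h => ?_, fun N => ?_⟩)).symm
  · have h1 := hF y (b 0)
    rw [h, hF] at h1
    refine Subtype.ext (sub_eq_zero.mp (hli (s * (y' - y)) (y - y') ?_).2)
    rw [← sub_eq_zero] at h1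
    rw [← neg_eq_zero, ← h1]
    module
  · obtain ⟨x, y, hxy⟩ := hspan (N.1.1 (b 0))
    have hNN := N.1.2 (b 0)
    rw [hxy, map_add, map_smul, map_smul, N.2, hxy, map_add, map_smul, map_smul, hgs] at hNN
    obtain ⟨h3, h4⟩ := hli (x ^ 2 - y ^ 2 - δ) (y * (2 * (x + s * y))) (by
      rw [← sub_eq_zero] at hNN
      rw [← hNN]
      module)
    -- If y = 0, then δ = x² would be a square.
    have hy : y ≠ 0 := by
      rintro rfl
      exact hδ ⟨x, by linear_combination -h3⟩
    have hx : x = -(s * y) := eq_neg_of_add_eq_zero_left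
      ((mul_eq_zero.mp ((mul_eq_zero.mp h4).resolve_left hy)).resolve_left h2)
    subst hx
    have hy' : (s ^ 2 - 1) * y ^ 2 = δ := by linear_combination h3
    refine ⟨⟨y, hy'⟩, Subtype.ext (Subtype.ext (b.ext fun i => ?_))⟩
    have h0 : (F ⟨y, hy'⟩).1.1 (b 0) = N.1.1 (b 0) := by
      rw [hF, hxy]
      module
    fin_cases i
    · exact h0
    · change (F _).1.1 (b 1) = N.1.1 (b 1)
      rw [hb, N.2, ← h0, (F _).2]

/-- With N e = xe + y g(e), anticommutation forces N g(e) = ye - x g(e), and then N² = x² + y². -/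
lemma card_anticommuting (hV : Module.finrank (ZMod p) V = 2) (h2 : (2 : ZMod p) ≠ 0) {δ : ZMod p}
    (hδ : δ ≠ 0) {g : V ≃ₗ[ZMod p] V} (hg : ¬ ∃ c : ZMod p, ∀ v, g v = c • v)
    (hgs : ∀ v, g (g v) = -v) :
    (Nat.card {N : Sqrt δ V // ∀ v, N.1 (g v) = -g (N.1 v)} : ℤ) =
      p - quadraticChar (ZMod p) (-1) := by
  obtain ⟨b, hb, hli, hspan⟩ := exists_basis_of_not_scalar hV hg
  rw [← card_sum_two_squares h2 hδ]
  have hext : ∀ φ ψ : Module.End (ZMod p) V, φ (b 0) = ψ (b 0) → φ (g (b 0)) = ψ (g (b 0)) → φ = ψ := by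
    intro φ ψ h h'
    refine b.ext fun i => ?_
    fin_cases i
    · exact h
    · change φ (b 1) = ψ (b 1)
      rw [hb, h']
  let φ : ZMod p × ZMod p → Module.End (ZMod p) V := fun x =>
    b.constr (ZMod p) ![x.1 • b 0 + x.2 • g (b 0), x.2 • b 0 - x.1 • g (b 0)]
  have hφ0 : ∀ x, φ x (b 0) = x.1 • b 0 + x.2 • g (b 0) := fun x => by simp [φ]
  have hφ1 : ∀ x, φ x (g (b 0)) = x.2 • b 0 - x.1 • g (b 0) := fun x =>
    (congrArg (φ x) hb).symm.trans (by simp [φ])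
  let F : {x : ZMod p × ZMod p // x.1 ^ 2 + x.2 ^ 2 = δ} →
      {N : Sqrt δ V // ∀ v, N.1 (g v) = -g (N.1 v)} := fun ⟨x, hx⟩ =>
    ⟨⟨φ x, fun v => by
      refine LinearMap.congr_fun (f := φ x * φ x) (g := δ • 1) (hext _ _ ?_ ?_) v
      · rw [Module.End.mul_apply, hφ0, map_add, map_smul, map_smul, hφ0, hφ1, ← hx]
        simp only [LinearMap.smul_apply, Module.End.one_apply]
        module
      · rw [Module.End.mul_apply, hφ1, map_sub, map_smul, map_smul, hφ0, hφ1, ← hx]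
        simp only [LinearMap.smul_apply, Module.End.one_apply]
        module⟩, fun v => by
      refine LinearMap.congr_fun (f := φ x * g.toLinearMap) (g := -(g.toLinearMap * φ x))
        (hext _ _ ?_ ?_) v
      · simp only [Module.End.mul_apply, LinearEquiv.coe_coe, LinearMap.neg_apply, hφ0, hφ1, map_add,
          map_smul, hgs]
        module
      · simp only [Module.End.mul_apply, LinearEquiv.coe_coe, LinearMap.neg_apply, hφ0, hφ1, map_sub,
          map_smul, hgs, map_neg]
        module⟩
  refine congrArg _ (Nat.card_congr (Equiv.ofBijective F ⟨fun x x' h => ?_, fun N => ?_⟩)).symm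
  · have h1 : φ x (b 0) = φ x' (b 0) := LinearMap.congr_fun (congrArg (fun N => N.1.1) h) _
    rw [hφ0, hφ0, ← sub_eq_zero] at h1
    obtain ⟨h3, h4⟩ := hli (x.1.1 - x'.1.1) (x.1.2 - x'.1.2) (by rw [← h1]; module)
    exact Subtype.ext (Prod.ext (sub_eq_zero.mp h3) (sub_eq_zero.mp h4))
  · obtain ⟨x, y, hxy⟩ := hspan (N.1.1 (b 0))
    have hxy' : N.1.1 (g (b 0)) = y • b 0 - x • g (b 0) := by
      rw [N.2, hxy, map_add, map_smul, map_smul, hgs]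
      module
    have hNN := N.1.2 (b 0)
    rw [hxy, map_add, map_smul, map_smul, hxy', hxy] at hNN
    obtain ⟨h3, -⟩ := hli (x ^ 2 + y ^ 2 - δ) 0 (by
      rw [← sub_eq_zero] at hNN
      rw [← hNN]
      module)
    refine ⟨⟨(x, y), sub_eq_zero.mp h3⟩, Subtype.ext (Subtype.ext (hext _ _ ?_ ?_))⟩
    · exact (hφ0 _).trans hxy.symm
    · exact (hφ1 _).trans hxy'.symm

/-- Here g³ = 1, so moving N across g three times gives N = -N. -/
lemma card_anticommuting_eq_zero (hV : Module.finrank (ZMod p) V = 2) (h2 : (2 : ZMod p) ≠ 0)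
    {δ : ZMod p} (hδ : δ ≠ 0) {g : V ≃ₗ[ZMod p] V} (hgs : ∀ v, v + g v + g (g v) = 0) :
    Nat.card {N : Sqrt δ V // ∀ v, N.1 (g v) = -g (N.1 v)} = 0 := by
  have : Nontrivial V := Module.nontrivial_of_finrank_pos (R := ZMod p) (by omega)
  obtain ⟨v, hv⟩ := exists_ne (0 : V)
  rw [Nat.card_eq_zero]
  refine Or.inl ⟨fun N => ?_⟩
  have h0 : ∀ v, N.1.1 v = 0 := fun v => by
    have hg3 : g (g (g v)) = v := by
      have h1 := hgs v
      have h2 := hgs (g v)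
      rw [← sub_eq_zero, ← sub_self (0 : V)]
      nth_rw 1 [← h2]
      nth_rw 1 [← h1]
      abel
    have h1 := N.2 (g (g v))
    simp only [hg3, N.2, map_neg, neg_neg, eq_neg_iff_add_eq_zero] at h1
    have h3 := hgs (g (N.1.1 v))
    have h4 := hgs (N.1.1 v)
    have hg3' : g (g (g (N.1.1 v))) = N.1.1 v := by
      rw [← sub_eq_zero, ← sub_self (0 : V)]
      nth_rw 1 [← h3]
      nth_rw 1 [← h4]
      abel
    rw [hg3', ← two_smul (ZMod p)] at h1
    exact (smul_eq_zero.mp h1).resolve_left h2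
  have := N.1.2 v
  rw [h0] at this
  exact smul_ne_zero hδ hv this.symm

lemma HasTraceNorm.ncard_fixed_of_sq (hγ : HasTraceNorm γ t n)
    (hV : Module.finrank (ZMod p) V = 2) {g : V ≃ₗ[ZMod p] V}
    (hg : ¬ ∃ c : ZMod p, ∀ v, g v = c • v) (hgs : ∀ v, g (g v) = -v) :
    2 * ({v : Necklace γ V | v.map g = v}.ncard : ℤ) = p + 1 - 2 * quadraticChar (ZMod p) (-1) := by
  have h := hγ.two_mul_ncard_fixed hV g
  have h1 := card_commuting hV hγ.two_ne_zero hγ.not_isSquare hg (s := 0) (by simp)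
    fun v => by rw [hgs]; simp
  have h3 := card_anticommuting hV hγ.two_ne_zero hγ.quarterDisc_ne_zero hg hgs
  rw [zero_pow _root_.two_ne_zero, zero_sub] at h1
  zify at h
  rw [h, h1, h3]
  ring

lemma HasTraceNorm.ncard_fixed_of_cube (hγ : HasTraceNorm γ t n) (hp3 : (3 : ZMod p) ≠ 0)
    (hV : Module.finrank (ZMod p) V = 2) {g : V ≃ₗ[ZMod p] V}
    (hg : ¬ ∃ c : ZMod p, ∀ v, g v = c • v) (hgs : ∀ v, v + g v + g (g v) = 0) :
    2 * ({v : Necklace γ V | v.map g = v}.ncard : ℤ) = 1 - quadraticChar (ZMod p) (-3) := by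
  have h2 := hγ.two_ne_zero
  have h := hγ.two_mul_ncard_fixed hV g
  -- The relation g² = -g - 1 means 2s = -1, and s² - 1 is -3 up to a square.
  have hq : (-1 / 2 : ZMod p) ^ 2 - 1 = -3 * (1 / 2) ^ 2 := by
    field_simp
    ring
  have h1 := card_commuting hV h2 hγ.not_isSquare hg (s := -1 / 2)
    (sub_ne_zero.mp (hq ▸ mul_ne_zero (neg_ne_zero.mpr hp3) (pow_ne_zero 2 (one_div_ne_zero h2))))
    fun v => by
      rw [mul_div_cancel₀ _ h2, ← sub_eq_zero, ← hgs v]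
      module
  rw [hq, map_mul, quadraticChar_sq_one' (one_div_ne_zero h2), mul_one] at h1
  rw [card_anticommuting_eq_zero hV h2 hγ.quarterDisc_ne_zero hgs, add_zero] at h
  zify at h
  rw [h, h1]

end FixedNecklaces

/-! ### Scalars and powers acting on necklaces. -/

section NecklaceMaps

variable {p : ℕ} [Fact p.Prime] {γ : (GaloisField p 2)ˣ} {V W : Type*} [AddCommGroup V]
  [Module (ZMod p) V] [AddCommGroup W] [Module (ZMod p) W]

lemma Necklace.map_congr_smul {e e' : V ≃ₗ[ZMod p] W} {c : ZMod p} (h : ∀ x, e x = c • e' x)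
    (v : Necklace γ V) : v.map e = v.map e' := by
  induction v using Quotient.inductionOn with
  | h v =>
    induction v using Quotient.inductionOn with
    | h l =>
      refine congrArg OrientedNecklace.toNecklace (congrArg (Quotient.mk _) ?_)
      ext i
      simp only [NecklaceList.map, Equiv.trans_apply]
      induction l.pearl i using Projectivization.ind with
      | h v hv =>
        simp only [projEquiv, Equiv.coe_fn_mk, Projectivization.map_mk]
        rw [Projectivization.mk_eq_mk_iff']
        exact ⟨c, (h v).symm⟩

lemma Necklace.map_eq_self_of_signPow {g f : V ≃ₗ[ZMod p] V} (h : SignPow f g) {v : Necklace γ V}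
    (hv : v.map g = v) : v.map f = v := by
  have key : ∀ (i : ℕ) (e : V ≃ₗ[ZMod p] V), (∀ x, e x = g^[i] x) → v.map e = v := by
    intro i
    induction i with
    | zero =>
      intro e he
      have h1 : e = LinearEquiv.refl _ _ := LinearEquiv.ext he
      rw [h1, v.map_refl]
    | succ i ih =>
      intro e he
      have h1 : e = g.trans (g.symm.trans e) := by ext; simp
      rw [h1, Necklace.map_trans, hv]
      exact ih _ fun x => by
        rw [LinearEquiv.trans_apply, he, Function.iterate_succ_apply, LinearEquiv.apply_symm_apply]
  obtain ⟨i, h | h⟩ := h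
  · exact key i f h
  · rw [← v.map_congr_smul (e := f.trans (LinearEquiv.neg (ZMod p))) (c := -1) fun x => by simp]
    exact key i _ fun x => by simp [h]

lemma OrientedNecklace.toNecklace_map_eq_iff (v : OrientedNecklace γ V) (g : V ≃ₗ[ZMod p] V) :
    v.toNecklace.map g = v.toNecklace ↔ v.map g = v ∨ v.map g = v.w := by
  constructor
  · intro h
    exact Quotient.exact h.symm
  · intro h
    exact (Quotient.sound h : v.toNecklace = _).symm

lemma toPGL_pow_eq_one {g : V ≃ₗ[ZMod p] V} {i : ℕ} {c : ZMod p} (h : ∀ x, g^[i] x = c • x) :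
    toPGL g ^ i = 1 := by
  have h1 : toPGL g ^ i = toPGL (g ^ i) := by
    clear h
    induction i with
    | zero => exact (toPGL_eq_one (c := 1) fun x => (one_smul _ x).symm).symm
    | succ i ih => rw [pow_succ, ih, pow_succ]; rfl
  rw [h1]
  refine toPGL_eq_one (c := c) fun x => ?_
  rw [← h]
  clear h h1
  induction i generalizing x with
  | zero => rfl
  | succ i ih => rw [pow_succ, LinearEquiv.mul_apply, ih, Function.iterate_succ_apply]

end NecklaceMaps

/-! ### Counting elliptic points as fixed necklaces of the standard curves. -/

section EllipticPoints

variable {p : ℕ} [Fact p.Prime] {k : Type*} [Field k] [DecidableEq k] {γ : (GaloisField p 2)ˣ}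
  {t n : ZMod p} {r : ℕ} {E₀ : WeierstrassCurve k} {g : E₀.toAffine.Point ≃+ E₀.toAffine.Point}

/-- The isomorphism class of a pair `(E, v)`. -/
def NecklaceModuli.mk (E : WeierstrassCurve k) (hE : E.IsElliptic) (v : Necklace γ (Torsion p E)) :
    NecklaceModuli p k γ :=
  Quotient.mk _ ⟨E, hE, v⟩

lemma NecklaceModuli.mk_eq_mk_iff {E E' : WeierstrassCurve k} {hE : E.IsElliptic}
    {hE' : E'.IsElliptic} {v : Necklace γ (Torsion p E)} {v' : Necklace γ (Torsion p E')} :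
    mk E hE v = mk E' hE' v' ↔ ∃ f : E.toAffine.Point ≃+ E'.toAffine.Point, IsIsom E E' f ∧
      v.map (torsionEquiv p f) = v' :=
  Quotient.eq

/-- The elliptic points all lie over the standard curve, and correspond to the fixed necklaces. -/
lemma IsStandard.ellipticPoints_eq (h : IsStandard r E₀ g) (hr : r ≠ 1)
    (hg : orderOf (toPGL (torsionEquiv p g)) = r) :
    ellipticPoints p k γ r = NecklaceModuli.mk E₀ h.isElliptic ''
      {v : Necklace γ (Torsion p E₀) | v.map (torsionEquiv p g) = v} := by
  ext x
  constructor
  · rintro ⟨E, hE, v, f, rfl, hf, hfr, hv⟩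
    obtain ⟨e, he⟩ := h.exists_isIsom p E hE f hf hfr
    refine ⟨v.toNecklace.map (torsionEquiv p e), ?_, (NecklaceModuli.mk_eq_mk_iff.mpr ⟨e, he, rfl⟩).symm⟩
    -- The transported automorphism is not a sign, since its order in PGL is r ≠ 1. So g is a power
    -- of it up to sign, and g fixes the transported necklace.
    rcases (h.signPow _ ((he.symm.trans hf).trans he)).2 with hs | hs
    · have : IsSign f := isSign_conj e (fun P => by simp) hs
      exact absurd (by rw [← hfr, toPGL_eq_one_of_isSign this, orderOf_one]) hr
    · have h1 : (v.toNecklace.map (torsionEquiv p e)).map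
          (torsionEquiv p ((e.symm.trans f).trans e)) = v.toNecklace.map (torsionEquiv p e) := by
        have h2 : (torsionEquiv p e).trans (torsionEquiv p ((e.symm.trans f).trans e)) =
            (torsionEquiv p f).trans (torsionEquiv p e) :=
          LinearEquiv.ext fun x => Subtype.ext (by simp [coe_torsionEquiv])
        rw [← Necklace.map_trans, h2, Necklace.map_trans, (v.toNecklace_map_eq_iff _).mpr hv]
      exact Necklace.map_eq_self_of_signPow hs.torsion h1
  · rintro ⟨v, hv, rfl⟩
    induction v using Quotient.inductionOn with
    | h v => exact ⟨E₀, h.isElliptic, v, g, rfl, h.isIsom, hg, (v.toNecklace_map_eq_iff _).mp hv⟩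

/-- An isomorphism between two such pairs is an automorphism of the curve, hence up to sign a power
of g, and it fixes the first necklace. -/
lemma IsStandard.injOn (h : IsStandard r E₀ g) :
    Set.InjOn (NecklaceModuli.mk E₀ h.isElliptic)
      {v : Necklace γ (Torsion p E₀) | v.map (torsionEquiv p g) = v} := by
  intro v hv v' _ hvv
  obtain ⟨f, hf, hfv⟩ := NecklaceModuli.mk_eq_mk_iff.mp hvv
  rw [← hfv]
  exact (Necklace.map_eq_self_of_signPow (h.signPow f hf).1.torsion hv).symm

lemma finrank_of_card {V : Type*} [AddCommGroup V] [Module (ZMod p) V]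
    (h : Nat.card V = p ^ 2) : Module.finrank (ZMod p) V = 2 := by
  have hp := (Fact.out : p.Prime)
  have : Finite V := Nat.finite_of_card_ne_zero (h ▸ pow_ne_zero 2 hp.ne_zero)
  rw [Module.natCard_eq_pow_finrank (K := ZMod p), Nat.card_zmod] at h
  exact Nat.pow_right_injective hp.two_le h

lemma HasTraceNorm.ncard_ellipticPoints (hγ : HasTraceNorm γ t n) (h : IsStandard r E₀ g)
    (hr : r ≠ 1) (hV : Module.finrank (ZMod p) (Torsion p E₀) = 2)
    (hg : orderOf (toPGL (torsionEquiv p g)) = r) :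
    (ellipticPoints p k γ r).Finite ∧ (ellipticPoints p k γ r).ncard =
      {v : Necklace γ (Torsion p E₀) | v.map (torsionEquiv p g) = v}.ncard := by
  have := hγ.finite_necklace hV
  rw [h.ellipticPoints_eq hr hg, h.injOn.ncard_image]
  exact ⟨(Set.toFinite _).image _, rfl⟩

variable [IsAlgClosed k]

/-- If g acted as c, then c² = -1 and p = m² + m'² with m + m'c = 0 in 𝔽_p. So m + m'g would kill
the p² points of E[p], but its kernel has only p elements. -/
lemma not_scalar_two (h2 : (2 : k) ≠ 0) (hpk : (p : k) ≠ 0) {ι : k} (hι : ι ^ 2 = -1)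
    {g : (shortCurve (1 : k) 0).toAffine.Point ≃+ (shortCurve (1 : k) 0).toAffine.Point}
    (hg : ScalesBy g ι) (hgg : ∀ P, g (g P) = -P) :
    ¬ ∃ c : ZMod p, ∀ v : Torsion p (shortCurve (1 : k) 0), torsionEquiv p g v = c • v := by
  rintro ⟨c, hc⟩
  have hp := (Fact.out : p.Prime)
  have hcard : Nat.card (Torsion p (shortCurve (1 : k) 0)) = p ^ 2 :=
    card_torsion h2 (by
      have : (4 : k) = 2 * 2 := by norm_num
      simp [this, h2]) hpk
  have hV := finrank_of_card hcard
  have : Nontrivial (Torsion p (shortCurve (1 : k) 0)) :=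
    Module.nontrivial_of_finrank_pos (R := ZMod p) (by omega)
  obtain ⟨v, hv⟩ := exists_ne (0 : Torsion p (shortCurve (1 : k) 0))
  have hc2 : c * c = -1 := by
    have h1 : torsionEquiv p g (torsionEquiv p g v) = -v := Subtype.ext (hgg v)
    rw [hc, hc, smul_smul, ← neg_one_smul (ZMod p)] at h1
    exact smul_left_injective _ hv h1
  have hp3 : p % 4 ≠ 3 := ZMod.exists_sq_eq_neg_one_iff.mp ⟨c, hc2.symm⟩
  obtain ⟨a, b, hab⟩ := Nat.Prime.sq_add_sq hp3
  obtain ⟨m, m', hmm, hker⟩ : ∃ m m' : ℤ, m ^ 2 + m' ^ 2 = p ∧ (m : ZMod p) + m' * c = 0 := by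
    -- The product is a² + b² = p = 0. Whichever factor vanishes fixes the sign of m'.
    have h1 : ((a : ZMod p) + b * c) * (a - b * c) = 0 := by
      have : (a : ZMod p) ^ 2 + b ^ 2 = 0 := by
        rw [← Nat.cast_pow, ← Nat.cast_pow, ← Nat.cast_add, hab, ZMod.natCast_self]
      linear_combination this - (b : ZMod p) ^ 2 * hc2
    rcases mul_eq_zero.mp h1 with h1 | h1
    · exact ⟨a, b, by exact_mod_cast hab, by exact_mod_cast h1⟩
    · refine ⟨a, -b, by rw [neg_sq]; exact_mod_cast hab, ?_⟩
      push_cast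
      linear_combination h1
  have h3 : Nat.card (m • AddMonoidHom.id _ + m' • g.toAddMonoidHom).ker = p := by
    -- Scaling by ι is (x, y) ↦ (ι²x, ι³y) = (-x, ι³y), so the root of -1 acting on y is ι³.
    have := card_ker_zsmul_add_zsmul h2 (ι := ι ^ 3) (by linear_combination (ι ^ 4 - ι ^ 2 + 1) * hι)
      (I := g.toAddMonoidHom) (fun x y h => by
        obtain ⟨h', e⟩ := hg x y h
        have hx : -x = ι ^ 2 * x := by rw [hι]; ring
        rw [hx]
        exact ⟨h', e⟩) (m := m) (n := m') (by rw [hmm]; exact_mod_cast hpk)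
    rw [hmm] at this
    exact_mod_cast this
  have hle : AddSubgroup.torsionBy (shortCurve (1 : k) 0).toAffine.Point (p : ℤ) ≤
      (m • AddMonoidHom.id _ + m' • g.toAddMonoidHom).ker := fun x hx => by
    let w : Torsion p (shortCurve (1 : k) 0) := ⟨x, hx⟩
    have h4 : m • w + m' • torsionEquiv p g w = 0 := by
      rw [hc, ← Int.cast_smul_eq_zsmul (ZMod p), ← Int.cast_smul_eq_zsmul (ZMod p), smul_smul,
        ← add_smul, hker, zero_smul]
    exact congrArg Subtype.val h4
  have hfin : Finite (m • AddMonoidHom.id _ + m' • g.toAddMonoidHom).ker :=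
    Nat.finite_of_card_ne_zero (h3 ▸ hp.ne_zero)
  have h5 := Nat.card_le_card_of_injective _ (AddSubgroup.inclusion_injective hle)
  rw [h3] at h5
  change Nat.card (Torsion p (shortCurve (1 : k) 0)) ≤ p at h5
  rw [hcard] at h5
  nlinarith [hp.two_le]

theorem HasTraceNorm.ellipticPoints_two (hγ : HasTraceNorm γ t n) (h2 : (2 : k) ≠ 0)
    (h3 : (3 : k) ≠ 0) (hpk : (p : k) ≠ 0) :
    (ellipticPoints p k γ 2).Finite ∧
      2 * ((ellipticPoints p k γ 2).ncard : ℤ) = p + 1 - 2 * legendreSym p (-1) := by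
  obtain ⟨ι, hι⟩ := IsAlgClosed.exists_pow_nat_eq (-1 : k) two_pos
  obtain ⟨g, hg, hstd, hgg⟩ := exists_isStandard_two h2 h3 hι
  have hns := not_scalar_two h2 hpk hι hg hgg
  have hV : Module.finrank (ZMod p) (Torsion p (shortCurve (1 : k) 0)) = 2 :=
    finrank_of_card (card_torsion h2 (by
      have : (4 : k) = 2 * 2 := by norm_num
      simp [this, h2]) hpk)
  have hgg' : ∀ v : Torsion p (shortCurve (1 : k) 0), torsionEquiv p g (torsionEquiv p g v) = -v :=
    fun v => Subtype.ext (hgg v)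
  have : Module.Finite (ZMod p) (Torsion p (shortCurve (1 : k) 0)) :=
    Module.finite_of_finrank_pos (by omega)
  have hord : orderOf (toPGL (torsionEquiv p g)) = 2 :=
    orderOf_eq_prime (toPGL_pow_eq_one (c := -1) fun x => by simp [hgg']) fun h =>
      hns (exists_smul_of_toPGL_eq_one (Module.finBasisOfFinrankEq _ _ hV) h)
  obtain ⟨h4, h5⟩ := hγ.ncard_ellipticPoints hstd (by norm_num) hV hord
  refine ⟨h4, ?_⟩
  rw [h5, hγ.ncard_fixed_of_sq hV hns hgg', legendreSym]
  push_cast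
  rfl

theorem HasTraceNorm.ellipticPoints_three (hγ : HasTraceNorm γ t n) (hp : 3 < p)
    (h2 : (2 : k) ≠ 0) (h3 : (3 : k) ≠ 0) (hpk : (p : k) ≠ 0) :
    (ellipticPoints p k γ 3).Finite ∧
      2 * ((ellipticPoints p k γ 3).ncard : ℤ) = 1 - legendreSym p (-3) := by
  have hp3 : (3 : ZMod p) ≠ 0 := fun h => by
    have := Nat.le_of_dvd three_pos ((ZMod.natCast_eq_zero_iff 3 p).mp (by exact_mod_cast h))
    omega
  obtain ⟨g, hstd, hgg⟩ := exists_isStandard_three h2 h3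
  have hV : Module.finrank (ZMod p) (Torsion p (shortCurve (0 : k) 1)) = 2 :=
    finrank_of_card (card_torsion h2 (by
      have : 4 * (0 : k) ^ 3 + 27 * 1 ^ 2 = 3 ^ 3 := by norm_num
      rw [this]
      exact pow_ne_zero 3 h3) hpk)
  have hgg' : ∀ v : Torsion p (shortCurve (0 : k) 1),
      v + torsionEquiv p g v + torsionEquiv p g (torsionEquiv p g v) = 0 :=
    fun v => Subtype.ext (hgg v)
  have hchi : legendreSym p (-3) = quadraticChar (ZMod p) (-3) := by
    rw [legendreSym]
    push_cast
    rfl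
  -- If g is scalar, every automorphism of the curve has trivial class and there is no elliptic
  -- point. The scalar satisfies 1 + c + c² = 0, so -3 = (2c + 1)² and the formula gives 0 too.
  by_cases hs : ∃ c : ZMod p, ∀ v : Torsion p (shortCurve (0 : k) 1), torsionEquiv p g v = c • v
  · obtain ⟨c, hc⟩ := hs
    have hempty : ellipticPoints p k γ 3 = ∅ := by
      rw [Set.eq_empty_iff_forall_notMem]
      rintro x ⟨E, hE, v, f, rfl, hf, hfr, -⟩
      obtain ⟨e, he⟩ := hstd.exists_isIsom p E hE f hf hfr
      obtain ⟨d, hd⟩ : ∃ d : ZMod p, ∀ w, torsionEquiv p ((e.symm.trans f).trans e) w = d • w := by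
        have hit : ∀ (i : ℕ) (w : Torsion p (shortCurve (0 : k) 1)),
            (torsionEquiv p g)^[i] w = c ^ i • w := fun i w => by
          induction i with
          | zero => simp
          | succ i ih => rw [Function.iterate_succ_apply', ih, hc, smul_smul, pow_succ']
        obtain ⟨i, hi | hi⟩ := (hstd.signPow _ ((he.symm.trans hf).trans he)).1.torsion (p := p)
        · exact ⟨c ^ i, fun w => by rw [hi, hit]⟩
        · exact ⟨-c ^ i, fun w => by rw [hi, hit, neg_smul]⟩
      have : toPGL (torsionEquiv p f) = 1 := toPGL_eq_one (c := d) fun w => by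
        refine (torsionEquiv p e).injective ?_
        rw [map_smul, ← hd]
        exact Subtype.ext (by simp [coe_torsionEquiv])
      rw [this, orderOf_one] at hfr
      norm_num at hfr
    have : Nontrivial (Torsion p (shortCurve (0 : k) 1)) :=
      Module.nontrivial_of_finrank_pos (R := ZMod p) (by omega)
    obtain ⟨v, hv⟩ := exists_ne (0 : Torsion p (shortCurve (0 : k) 1))
    have hc3 : 1 + c + c * c = 0 := by
      have h1 := hgg' v
      rw [hc, hc, smul_smul] at h1
      have h4 : (1 + c + c * c) • v = 0 := by
        rw [← h1]
        module
      exact (smul_eq_zero.mp h4).resolve_right hv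
    have hsq : quadraticChar (ZMod p) (-3) = 1 :=
      (quadraticChar_one_iff_isSquare (neg_ne_zero.mpr hp3)).mpr
        ⟨2 * c + 1, by linear_combination -4 * hc3⟩
    rw [hempty, hchi, hsq]
    simp
  · have : Module.Finite (ZMod p) (Torsion p (shortCurve (0 : k) 1)) :=
      Module.finite_of_finrank_pos (by omega)
    have hord : orderOf (toPGL (torsionEquiv p g)) = 3 := by
      refine orderOf_eq_prime (toPGL_pow_eq_one (c := 1) fun x => ?_) fun h =>
        hs (exists_smul_of_toPGL_eq_one (Module.finBasisOfFinrankEq _ _ hV) h)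
      have h4 := hgg' x
      have h5 := hgg' (torsionEquiv p g x)
      rw [one_smul, ← sub_eq_zero, ← sub_self (0 : Torsion p (shortCurve (0 : k) 1))]
      nth_rw 1 [← h5]
      nth_rw 1 [← h4]
      simp only [Function.iterate_succ_apply, Function.iterate_zero_apply]
      abel
    obtain ⟨h4, h5⟩ := hγ.ncard_ellipticPoints hstd (by norm_num) hV hord
    refine ⟨h4, ?_⟩
    rw [h5, hγ.ncard_fixed_of_cube hp3 hV hs hgg', hchi]

end EllipticPoints

/-! ### Bases modulo the normaliser of the Cartan subgroup. -/

section Cartan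

variable {p : ℕ} [Fact p.Prime] {γ : (GaloisField p 2)ˣ} {t n : ZMod p}

/-- The square root `γ - t / 2` of the quarter of the discriminant in `𝔽_{p²}`. -/
def sqrtDisc (γ : (GaloisField p 2)ˣ) (t : ZMod p) : GaloisField p 2 :=
  γ - algebraMap (ZMod p) _ (t / 2)

lemma HasTraceNorm.sqrtDisc_mul_self (hγ : HasTraceNorm γ t n) :
    sqrtDisc γ t * sqrtDisc γ t = algebraMap (ZMod p) _ (quarterDisc t n) := by
  have h1 := hγ.mul_self_generator
  have h2 := hγ.two_ne_zero
  have ht : t = t / 2 + t / 2 := by field_simp; ring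
  rw [Algebra.smul_def, Algebra.smul_def] at h1
  rw [sqrtDisc, quarterDisc]
  generalize t / 2 = s at ht
  subst ht
  simp only [map_sub, map_add, map_pow] at *
  linear_combination h1

lemma HasTraceNorm.sqrtDisc_ne_zero (hγ : HasTraceNorm γ t n) : sqrtDisc γ t ≠ 0 := fun h => by
  have := hγ.sqrtDisc_mul_self
  rw [h, zero_mul, eq_comm, map_eq_zero] at this
  exact hγ.quarterDisc_ne_zero this

lemma HasTraceNorm.quarterDisc_no_root (hγ : HasTraceNorm γ t n) (c : ZMod p) :
    c * c ≠ 0 * c - -quarterDisc t n := fun h =>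
  hγ.not_isSquare ⟨c, by rw [h]; ring⟩

lemma HasTraceNorm.exists_eq_add_mul_sqrtDisc (hγ : HasTraceNorm γ t n) (x : GaloisField p 2) :
    ∃ r s : ZMod p, x = r • 1 + s • sqrtDisc γ t := by
  obtain ⟨b, h0, h1⟩ := exists_basis_of_quadratic finrank_galoisField hγ.quarterDisc_no_root
    (φ := LinearMap.mulLeft (ZMod p) (sqrtDisc γ t)) (fun v => by
      rw [LinearMap.mulLeft_apply, LinearMap.mulLeft_apply, ← mul_assoc, hγ.sqrtDisc_mul_self,
        ← Algebra.smul_def]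
      module) (one_ne_zero (α := GaloisField p 2))
  refine ⟨b.repr x 0, b.repr x 1, ?_⟩
  conv_lhs => rw [← b.sum_repr x, Fin.sum_univ_two, h0, h1, LinearMap.mulLeft_apply, mul_one]

variable (b : Module.Basis (Fin 2) (ZMod p) (GaloisField p 2))

/-- The matrix of the multiplication by `γ - t / 2`. -/
def sqrtMatrix (γ : (GaloisField p 2)ˣ) (t : ZMod p) : Matrix (Fin 2) (Fin 2) (ZMod p) :=
  Algebra.leftMulMatrix b (sqrtDisc γ t)

lemma HasTraceNorm.sqrtMatrix_mul_self (hγ : HasTraceNorm γ t n) :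
    sqrtMatrix b γ t * sqrtMatrix b γ t = quarterDisc t n • 1 := by
  rw [sqrtMatrix, ← map_mul, hγ.sqrtDisc_mul_self, AlgHom.commutes, Algebra.algebraMap_eq_smul_one]

lemma mem_nonsplitCartan_iff {M : GL (Fin 2) (ZMod p)} :
    M ∈ nonsplitCartan p b ↔ ∃ x, Algebra.leftMulMatrix b x = M.val := by
  constructor
  · rintro ⟨u, rfl⟩
    exact ⟨u, rfl⟩
  · rintro ⟨x, hx⟩
    have hx0 : x ≠ 0 := by
      rintro rfl
      rw [map_zero] at hx
      exact M.ne_zero hx.symm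
    exact ⟨Units.mk0 x hx0, Units.ext hx⟩

/-- The normaliser of a non-split Cartan subgroup consists of the matrices that commute or
anticommute with `A`. -/
lemma HasTraceNorm.mem_normalizer_iff (hγ : HasTraceNorm γ t n) (M : GL (Fin 2) (ZMod p)) :
    M ∈ Subgroup.normalizer (nonsplitCartan p b : Set (GL (Fin 2) (ZMod p))) ↔
      M.val * sqrtMatrix b γ t = sqrtMatrix b γ t * M.val ∨
        M.val * sqrtMatrix b γ t = -(sqrtMatrix b γ t * M.val) := by
  rw [Subgroup.mem_normalizer_iff]
  have hinv : M⁻¹.val * M.val = 1 := by rw [← Units.val_mul, inv_mul_cancel, Units.val_one]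
  have hinv' : M.val * M⁻¹.val = 1 := by rw [← Units.val_mul, mul_inv_cancel, Units.val_one]
  constructor
  · intro h
    let A : GL (Fin 2) (ZMod p) := Units.map (Algebra.leftMulMatrix b).toRingHom.toMonoidHom
      (Units.mk0 _ hγ.sqrtDisc_ne_zero)
    obtain ⟨x, hx⟩ := (mem_nonsplitCartan_iff b).mp ((h A).mp ⟨_, rfl⟩)
    have hA : A.val = sqrtMatrix b γ t := rfl
    rw [Units.val_mul, Units.val_mul, hA] at hx
    have hxM : Algebra.leftMulMatrix b x * M.val = M.val * sqrtMatrix b γ t := by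
      rw [hx, mul_assoc, hinv, mul_one]
    -- The conjugate of the matrix of γ - t/2 comes from a field element x whose square is again δ,
    -- so x = ±(γ - t/2).
    have hsq : x * x = sqrtDisc γ t * sqrtDisc γ t := by
      refine Algebra.leftMulMatrix_injective b ?_
      rw [hγ.sqrtDisc_mul_self, map_mul]
      calc Algebra.leftMulMatrix b x * Algebra.leftMulMatrix b x
          = Algebra.leftMulMatrix b x * (M.val * sqrtMatrix b γ t * M⁻¹.val) := by rw [← hx]
        _ = M.val * (sqrtMatrix b γ t * sqrtMatrix b γ t) * M⁻¹.val := by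
          rw [← mul_assoc, ← mul_assoc, hxM]
          simp only [mul_assoc]
        _ = _ := by
          rw [hγ.sqrtMatrix_mul_self, mul_smul_comm, mul_one, smul_mul_assoc, hinv',
            AlgHom.commutes, Algebra.algebraMap_eq_smul_one]
    rcases mul_self_eq_mul_self_iff.mp hsq with rfl | rfl
    · exact Or.inl hxM.symm
    · rw [map_neg, neg_mul] at hxM
      exact Or.inr hxM.symm
  · intro h
    -- With α = γ - t/2, conjugation sends r + sα to r ± sα, so it maps the field into itself.
    -- Applying this to M and to M⁻¹ gives both inclusions.
    have key : ∀ P Q : Matrix (Fin 2) (Fin 2) (ZMod p), P * Q = 1 →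
        (P * sqrtMatrix b γ t = sqrtMatrix b γ t * P ∨
          P * sqrtMatrix b γ t = -(sqrtMatrix b γ t * P)) →
        ∀ x, ∃ y, Algebra.leftMulMatrix b y = P * Algebra.leftMulMatrix b x * Q := by
      intro P Q hPQ hP x
      obtain ⟨r, s, rfl⟩ := hγ.exists_eq_add_mul_sqrtDisc x
      rcases hP with hP | hP
      · refine ⟨r • 1 + s • sqrtDisc γ t, ?_⟩
        simp only [map_add, map_smul, map_one, mul_add, add_mul, mul_smul_comm, smul_mul_assoc,
          mul_one, hPQ]
        rw [← sqrtMatrix, hP, mul_assoc, hPQ, mul_one]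
      · refine ⟨r • 1 - s • sqrtDisc γ t, ?_⟩
        simp only [map_add, map_sub, map_smul, map_one, mul_add, add_mul, mul_smul_comm,
          smul_mul_assoc, mul_one, hPQ]
        rw [← sqrtMatrix, hP, neg_mul, mul_assoc, hPQ, mul_one, smul_neg, sub_eq_add_neg]
    have h' : M⁻¹.val * sqrtMatrix b γ t = sqrtMatrix b γ t * M⁻¹.val ∨
        M⁻¹.val * sqrtMatrix b γ t = -(sqrtMatrix b γ t * M⁻¹.val) := by
      have hconj : M⁻¹.val * (M.val * sqrtMatrix b γ t) * M⁻¹.val =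
          sqrtMatrix b γ t * M⁻¹.val := by rw [← mul_assoc, hinv, one_mul]
      have hconj' : M⁻¹.val * (sqrtMatrix b γ t * M.val) * M⁻¹.val =
          M⁻¹.val * sqrtMatrix b γ t := by rw [mul_assoc, mul_assoc, hinv', mul_one]
      rcases h with h | h
      · exact Or.inl (by rw [← hconj, ← hconj', h])
      · exact Or.inr (by rw [← hconj, ← hconj', h, mul_neg, neg_mul, neg_neg])
    intro U
    rw [mem_nonsplitCartan_iff, mem_nonsplitCartan_iff]
    constructor
    · rintro ⟨x, hx⟩
      rw [Units.val_mul, Units.val_mul, ← hx]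
      exact key _ _ hinv' h x
    · rintro ⟨x, hx⟩
      obtain ⟨y, hy⟩ := key _ _ hinv h' x
      refine ⟨y, hy.trans ?_⟩
      rw [hx, ← Units.val_mul, ← Units.val_mul]
      congr 1
      group

variable {V W : Type*} [AddCommGroup V] [Module (ZMod p) V] [AddCommGroup W] [Module (ZMod p) W]

/-- The endomorphism of `V` with the matrix of the multiplication by `γ - t / 2`. -/
def HasTraceNorm.sqrtOfBasis (hγ : HasTraceNorm γ t n) (β : Module.Basis (Fin 2) (ZMod p) V) :
    Sqrt (quarterDisc t n) V :=
  ⟨Matrix.toLin β β (sqrtMatrix b γ t), fun v => by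
    rw [← Matrix.toLin_mul_apply, hγ.sqrtMatrix_mul_self, map_smul, Matrix.toLin_one]
    rfl⟩

lemma finrank_of_basis (β : Module.Basis (Fin 2) (ZMod p) V) : Module.finrank (ZMod p) V = 2 := by
  simp [Module.finrank_eq_card_basis β]

/-- The necklace attached to a basis. -/
def HasTraceNorm.necklaceOfBasis (hγ : HasTraceNorm γ t n)
    (β : Module.Basis (Fin 2) (ZMod p) V) : Necklace γ V :=
  hγ.necklace (finrank_of_basis β) (hγ.sqrtOfBasis b β)

lemma HasTraceNorm.sqrtOfBasis_map (hγ : HasTraceNorm γ t n)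
    (β : Module.Basis (Fin 2) (ZMod p) V) (e : V ≃ₗ[ZMod p] W) :
    (hγ.sqrtOfBasis b β).map e = hγ.sqrtOfBasis b (β.map e) := by
  refine Subtype.ext ((β.map e).ext fun j => ?_)
  have h1 : (hγ.sqrtOfBasis b (β.map e)).1 ((β.map e) j) = _ :=
    Matrix.toLin_self (β.map e) (β.map e) (sqrtMatrix b γ t) j
  rw [h1, Module.Basis.map_apply, Sqrt.map_apply]
  simp only [sqrtOfBasis, Matrix.toLin_self, map_sum, map_smul, Module.Basis.map_apply]

lemma HasTraceNorm.necklaceOfBasis_map (hγ : HasTraceNorm γ t n)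
    (β : Module.Basis (Fin 2) (ZMod p) V) (e : V ≃ₗ[ZMod p] W) :
    (hγ.necklaceOfBasis b β).map e = hγ.necklaceOfBasis b (β.map e) := by
  rw [necklaceOfBasis, hγ.necklace_map _ (finrank_of_basis (β.map e)), hγ.sqrtOfBasis_map]
  rfl

/-- Multiplication by γ - t/2 on 𝔽_{p²} and N have the same irreducible quadratic polynomial, so
they are conjugate. The conjugating map carries b to the required basis. -/
lemma HasTraceNorm.necklaceOfBasis_surjective (hγ : HasTraceNorm γ t n)
    (hV : Module.finrank (ZMod p) V = 2) (v : Necklace γ V) :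
    ∃ β : Module.Basis (Fin 2) (ZMod p) V, hγ.necklaceOfBasis b β = v := by
  obtain ⟨N, rfl⟩ := hγ.necklace_surjective hV v
  obtain ⟨e, he⟩ := exists_conj_of_quadratic finrank_galoisField hV hγ.quarterDisc_no_root
    (φ := LinearMap.mulLeft (ZMod p) (sqrtDisc γ t)) (fun v => by
      rw [LinearMap.mulLeft_apply, LinearMap.mulLeft_apply, ← mul_assoc, hγ.sqrtDisc_mul_self,
        ← Algebra.smul_def]
      module) (ψ := N.1) (fun v => by rw [N.2]; module)
  refine ⟨b.map e, congrArg _ (Subtype.ext ((b.map e).ext fun j => ?_))⟩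
  have h1 : sqrtMatrix b γ t = LinearMap.toMatrix b b (LinearMap.mulLeft (ZMod p) (sqrtDisc γ t)) :=
    rfl
  rw [← hγ.sqrtOfBasis_map, Module.Basis.map_apply, Sqrt.map_apply, ← he]
  simp only [sqrtOfBasis, h1, Matrix.toLin_toMatrix]

/-- Two bases give the same necklace if and only if they differ by an element of the normaliser. -/
lemma HasTraceNorm.necklaceOfBasis_eq_iff (hγ : HasTraceNorm γ t n)
    (β β' : Module.Basis (Fin 2) (ZMod p) V) :
    hγ.necklaceOfBasis b β = hγ.necklaceOfBasis b β' ↔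
      ∃ M ∈ Subgroup.normalizer (nonsplitCartan p b : Set (GL (Fin 2) (ZMod p))),
        ∀ j, β' j = ∑ i, M.val i j • β i := by
  have key : ∀ M : GL (Fin 2) (ZMod p), (∀ j, β' j = ∑ i, M.val i j • β i) →
      (hγ.necklaceOfBasis b β = hγ.necklaceOfBasis b β' ↔
        M ∈ Subgroup.normalizer (nonsplitCartan p b : Set (GL (Fin 2) (ZMod p)))) := by
    intro M hM
    have hM' : M.val = β.toMatrix β' := by
      ext i j
      rw [Module.Basis.toMatrix_apply, hM]
      fin_cases i <;> simp
    -- Written from β' to β, the two endomorphisms have matrices AM and MA, where A is `sqrtMatrix b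
    -- γ t`. They agree up to sign exactly when M commutes or anticommutes with A.
    have h1 : LinearMap.toMatrix β' β (hγ.sqrtOfBasis b β).1 = sqrtMatrix b γ t * M.val := by
      rw [hM', ← linearMap_toMatrix_mul_basis_toMatrix β' β β, sqrtOfBasis, LinearMap.toMatrix_toLin]
    have h2 : LinearMap.toMatrix β' β (hγ.sqrtOfBasis b β').1 = M.val * sqrtMatrix b γ t := by
      rw [hM', ← basis_toMatrix_mul_linearMap_toMatrix β' β β', sqrtOfBasis, LinearMap.toMatrix_toLin]
    rw [hγ.mem_normalizer_iff b, ← h1, ← h2, ← map_neg, (LinearMap.toMatrix β' β).injective.eq_iff,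
      (LinearMap.toMatrix β' β).injective.eq_iff, necklaceOfBasis, necklaceOfBasis,
      hγ.necklace_eq_iff, Subtype.ext_iff, Subtype.ext_iff]
    rfl
  constructor
  · intro h
    let M : GL (Fin 2) (ZMod p) := ⟨β.toMatrix β', β'.toMatrix β,
      β.toMatrix_mul_toMatrix_flip β', β'.toMatrix_mul_toMatrix_flip β⟩
    have hM : ∀ j, β' j = ∑ i, M.val i j • β i := fun j => (β.sum_repr (β' j)).symm
    exact ⟨M, (key M hM).mp h, hM⟩
  · rintro ⟨M, hM, h⟩
    exact (key M h).mpr hM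

end Cartan

/-! ### Comparison of the two descriptions of the points. -/

section LevelModuli

variable {p : ℕ} [Fact p.Prime] {k : Type*} [Field k] [DecidableEq k] {γ : (GaloisField p 2)ˣ}
  {t n : ZMod p} (b : Module.Basis (Fin 2) (ZMod p) (GaloisField p 2))

/-- A rotation carries a basis in its definition, so the comparison below needs no torsion count. -/
lemma finrank_of_necklace {V : Type*} [AddCommGroup V] [Module (ZMod p) V] (v : Necklace γ V) :
    Module.finrank (ZMod p) V = 2 := by
  induction v using Quotient.inductionOn with
  | h v =>
    induction v using Quotient.inductionOn with
    | h c =>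
      obtain ⟨_, ⟨β, _⟩, _⟩ := c.exists_rotation
      exact finrank_of_basis β

lemma HasTraceNorm.necklaceOfBasis_map_eq_iff (hγ : HasTraceNorm γ t n) {V W : Type*}
    [AddCommGroup V] [Module (ZMod p) V] [AddCommGroup W] [Module (ZMod p) W]
    (β : Module.Basis (Fin 2) (ZMod p) V) (β' : Module.Basis (Fin 2) (ZMod p) W)
    (e : V ≃ₗ[ZMod p] W) :
    (hγ.necklaceOfBasis b β).map e = hγ.necklaceOfBasis b β' ↔
      ∃ M ∈ Subgroup.normalizer (nonsplitCartan p b : Set (GL (Fin 2) (ZMod p))),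
        ∀ j, β' j = e (∑ i, M.val i j • β i) := by
  rw [hγ.necklaceOfBasis_map, hγ.necklaceOfBasis_eq_iff]
  simp

/-- The comparison between the two descriptions of the non-cuspidal points of `X_nsp⁺`. -/
def HasTraceNorm.levelToNecklace (hγ : HasTraceNorm γ t n) :
    LevelModuli p k (Subgroup.normalizer (nonsplitCartan p b : Set (GL (Fin 2) (ZMod p)))) →
      NecklaceModuli p k γ :=
  Quotient.lift (fun x => NecklaceModuli.mk x.E x.isElliptic (hγ.necklaceOfBasis b x.basis))
    fun _ _ ⟨f, hf, h⟩ => NecklaceModuli.mk_eq_mk_iff.mpr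
      ⟨f, hf, (hγ.necklaceOfBasis_map_eq_iff b _ _ _).mpr h⟩

lemma HasTraceNorm.levelToNecklace_mk (hγ : HasTraceNorm γ t n) (E : WeierstrassCurve k)
    (hE : E.IsElliptic) (β : Module.Basis (Fin 2) (ZMod p) (Torsion p E)) :
    hγ.levelToNecklace b (Quotient.mk _ ⟨E, hE, β⟩) =
      NecklaceModuli.mk E hE (hγ.necklaceOfBasis b β) := rfl

lemma HasTraceNorm.levelToNecklace_bijective (hγ : HasTraceNorm γ t n) :
    Function.Bijective (hγ.levelToNecklace b (k := k)) := by
  constructor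
  · intro x y h
    induction x, y using Quotient.inductionOn₂ with
    | h x y =>
      obtain ⟨f, hf, h⟩ := NecklaceModuli.mk_eq_mk_iff.mp h
      exact Quotient.sound ⟨f, hf, (hγ.necklaceOfBasis_map_eq_iff b _ _ _).mp h⟩
  · intro x
    induction x using Quotient.inductionOn with
    | h x =>
      obtain ⟨E, hE, v⟩ := x
      obtain ⟨β, rfl⟩ := hγ.necklaceOfBasis_surjective b (finrank_of_necklace v) v
      exact ⟨Quotient.mk _ ⟨E, hE, β⟩, rfl⟩

/-- Preserving the orbit of a basis under the normaliser is the same as fixing its necklace. -/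
lemma HasTraceNorm.ellipticLevelPoints_eq (hγ : HasTraceNorm γ t n) (r : ℕ) :
    ellipticLevelPoints p k
        (Subgroup.normalizer (nonsplitCartan p b : Set (GL (Fin 2) (ZMod p)))) r =
      hγ.levelToNecklace b ⁻¹' ellipticPoints p k γ r := by
  have hfix : ∀ (E : WeierstrassCurve k) (β : Module.Basis (Fin 2) (ZMod p) (Torsion p E))
      (e : Torsion p E ≃ₗ[ZMod p] Torsion p E),
      (hγ.necklaceOfBasis b β).map e = hγ.necklaceOfBasis b β ↔
        ∃ M ∈ Subgroup.normalizer (nonsplitCartan p b : Set (GL (Fin 2) (ZMod p))),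
          ∀ j, e (β j) = ∑ i, M.val i j • β i := fun E β e => by
    rw [hγ.necklaceOfBasis_map, eq_comm, hγ.necklaceOfBasis_eq_iff]
    simp only [Module.Basis.map_apply]
  ext x
  constructor
  · rintro ⟨E, hE, β, f, rfl, hf, hr, h⟩
    have h1 := (hfix E β _).mpr h
    obtain ⟨v, hv⟩ := Quotient.exists_rep (hγ.necklaceOfBasis b β)
    rw [← hv] at h1
    refine ⟨E, hE, v, f, ?_, hf, hr, (v.toNecklace_map_eq_iff _).mp h1⟩
    rw [hγ.levelToNecklace_mk, ← hv]
    rfl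
  · rintro ⟨E, hE, v, f, hx, hf, hr, h⟩
    obtain ⟨β, hβ⟩ := hγ.necklaceOfBasis_surjective b (finrank_of_necklace v.toNecklace) v.toNecklace
    refine ⟨E, hE, β, f, (hγ.levelToNecklace_bijective b).1 (hx.trans ?_), hf, hr,
      (hfix E β _).mp ?_⟩
    · rw [hγ.levelToNecklace_mk, hβ]
      rfl
    · rw [hβ]
      exact (v.toNecklace_map_eq_iff _).mpr h

lemma HasTraceNorm.ncard_ellipticLevelPoints (hγ : HasTraceNorm γ t n) {r : ℕ}
    (hfin : (ellipticPoints p k γ r).Finite) :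
    (ellipticLevelPoints p k
        (Subgroup.normalizer (nonsplitCartan p b : Set (GL (Fin 2) (ZMod p)))) r).Finite ∧
      (ellipticLevelPoints p k
        (Subgroup.normalizer (nonsplitCartan p b : Set (GL (Fin 2) (ZMod p)))) r).ncard =
      (ellipticPoints p k γ r).ncard := by
  have hbij := hγ.levelToNecklace_bijective b (k := k)
  rw [hγ.ellipticLevelPoints_eq b]
  exact ⟨hfin.preimage hbij.1.injOn, Set.ncard_preimage_of_injective_subset_range hbij.1
    (by rw [hbij.2.range_eq]; exact Set.subset_univ _)⟩

end LevelModuli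

/-! ### The Legendre symbols of -1 and -3. -/

section LegendreSymbols

variable {p : ℕ} [Fact p.Prime]

lemma HasTraceNorm.exists (hp : 3 < p) {γ : (GaloisField p 2)ˣ}
    (hγ : ∀ x, x ∈ Subgroup.zpowers γ) : ∃ t n, HasTraceNorm γ t n := by
  obtain ⟨t, n, h, ht, hroot⟩ := exists_minpoly_eq hp hγ
  refine ⟨t, n, hγ, h, ht, hroot, fun h2 => ?_⟩
  have := Nat.le_of_dvd two_pos ((ZMod.natCast_eq_zero_iff 2 p).mp (by exact_mod_cast h2))
  omega

lemma legendreSym_neg_one_of_mod_four_eq_one (h : p % 4 = 1) : legendreSym p (-1) = 1 := by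
  rw [legendreSym.at_neg_one (by rintro rfl; omega), ZMod.χ₄_nat_one_mod_four h]

lemma legendreSym_neg_one_of_mod_four_eq_three (h : p % 4 = 3) : legendreSym p (-1) = -1 := by
  rw [legendreSym.at_neg_one (by rintro rfl; omega), ZMod.χ₄_nat_three_mod_four h]

/-- A square root of -3 is 2w + 1 with w a primitive cube root of unity, which exists in 𝔽_p exactly
when 3 divides p - 1. -/
lemma isSquare_neg_three_iff (hp : 3 < p) : IsSquare (-3 : ZMod p) ↔ p % 3 = 1 := by
  have hp' := (Fact.out : p.Prime)
  have hne : ∀ q : ℕ, 0 < q → q ≤ 3 → (q : ZMod p) ≠ 0 := fun q h0 hq h => by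
    have := Nat.le_of_dvd h0 ((ZMod.natCast_eq_zero_iff q p).mp h)
    omega
  have h2 : (2 : ZMod p) ≠ 0 := by exact_mod_cast hne 2 two_pos (by norm_num)
  have h3 : (3 : ZMod p) ≠ 0 := by exact_mod_cast hne 3 three_pos le_rfl
  have hcard : Fintype.card (ZMod p)ˣ = p - 1 := ZMod.card_units p
  constructor
  · rintro ⟨s, hs⟩
    have hw : ((s - 1) / 2) ^ 2 + (s - 1) / 2 + 1 = 0 := by
      field_simp
      linear_combination -hs
    set w := (s - 1) / 2
    have hw3 : w ^ 3 = 1 := by linear_combination (w - 1) * hw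
    have hw1 : w ≠ 1 := fun h => h3 (by rw [h] at hw; linear_combination hw)
    have hord : orderOf w = 3 := orderOf_eq_prime hw3 hw1
    have hw0 : w ≠ 0 := fun h => by rw [h] at hw; simp at hw
    have := orderOf_dvd_card (x := Units.mk0 w hw0)
    rw [← orderOf_units, Units.val_mk0, hord, hcard] at this
    omega
  · intro h
    have : Fact (Nat.Prime 3) := ⟨Nat.prime_three⟩
    obtain ⟨w, hw⟩ := exists_prime_orderOf_dvd_card 3 (G := (ZMod p)ˣ) (by rw [hcard]; omega)
    rw [← orderOf_units] at hw
    have hw3 : (w : ZMod p) ^ 3 = 1 := hw ▸ pow_orderOf_eq_one _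
    have hw1 : (w : ZMod p) ≠ 1 := fun h => by
      rw [h, orderOf_one] at hw
      norm_num at hw
    have hw2 : (w : ZMod p) ^ 2 + w + 1 = 0 :=
      (mul_eq_zero.mp (show ((w : ZMod p) - 1) * ((w : ZMod p) ^ 2 + w + 1) = 0 by
        linear_combination hw3)).resolve_left (sub_ne_zero.mpr hw1)
    exact ⟨2 * w + 1, by linear_combination -4 * hw2⟩

lemma legendreSym_neg_three_of_mod_three_eq_one (hp : 3 < p) (h : p % 3 = 1) :
    legendreSym p (-3) = 1 := by
  have h3 : ((-3 : ℤ) : ZMod p) ≠ 0 := by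
    rw [Int.cast_neg, neg_ne_zero]
    intro h'
    have := Nat.le_of_dvd three_pos ((ZMod.natCast_eq_zero_iff 3 p).mp (by exact_mod_cast h'))
    omega
  rw [legendreSym.eq_one_iff p h3]
  push_cast
  exact (isSquare_neg_three_iff hp).mpr h

lemma legendreSym_neg_three_of_mod_three_eq_two (hp : 3 < p) (h : p % 3 = 2) :
    legendreSym p (-3) = -1 := by
  rw [legendreSym.eq_neg_one_iff]
  push_cast
  rw [isSquare_neg_three_iff hp]
  omega

end LegendreSymbols

end NspNecklace

end

open NspNecklace in
theorem mainTheorem8 (p : ℕ) [Fact p.Prime] (hp : 3 < p)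
    (k : Type*) [Field k] [IsAlgClosed k] [DecidableEq k]
    (h2 : (2 : k) ≠ 0) (h3 : (3 : k) ≠ 0) (hpk : (p : k) ≠ 0)
    (γ : (GaloisField p 2)ˣ) (hγ : ∀ x, x ∈ Subgroup.zpowers γ)
    (b : Module.Basis (Fin 2) (ZMod p) (GaloisField p 2)) :
    ((ellipticPoints p k γ 2).Finite ∧
      ((ellipticPoints p k γ 2).ncard : ℚ) = ((p : ℚ) + 1) / 2 - legendreSym p (-1) ∧
      (p ≡ 1 [MOD 4] → ((ellipticPoints p k γ 2).ncard : ℚ) = ((p : ℚ) - 1) / 2) ∧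
      (p ≡ 3 [MOD 4] → ((ellipticPoints p k γ 2).ncard : ℚ) = ((p : ℚ) + 3) / 2)) ∧
    ((ellipticPoints p k γ 3).Finite ∧
      ((ellipticPoints p k γ 3).ncard : ℚ) = 1 / 2 - 1 / 2 * (legendreSym p (-3) : ℚ) ∧
      (p ≡ 1 [MOD 3] → (ellipticPoints p k γ 3).ncard = 0) ∧
      (p ≡ 2 [MOD 3] → (ellipticPoints p k γ 3).ncard = 1)) ∧
    (∀ r, r = 2 ∨ r = 3 →
      (ellipticLevelPoints p k (Subgroup.normalizer (nonsplitCartan p b : Set _)) r).Finite ∧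
      (ellipticLevelPoints p k (Subgroup.normalizer (nonsplitCartan p b : Set _)) r).ncard =
        (ellipticPoints p k γ r).ncard) := by
  obtain ⟨t, n, h⟩ := HasTraceNorm.exists hp hγ
  obtain ⟨hfin₂, hcard₂⟩ := h.ellipticPoints_two h2 h3 hpk
  obtain ⟨hfin₃, hcard₃⟩ := h.ellipticPoints_three hp h2 h3 hpk
  have hq₂ : 2 * ((ellipticPoints p k γ 2).ncard : ℚ) = p + 1 - 2 * legendreSym p (-1) := by
    exact_mod_cast hcard₂
  refine ⟨⟨hfin₂, by linarith, fun hp4 => ?_, fun hp4 => ?_⟩,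
    ⟨hfin₃, ?_, fun hp3 => ?_, fun hp3 => ?_⟩, ?_⟩
  · rw [legendreSym_neg_one_of_mod_four_eq_one hp4, Int.cast_one] at hq₂
    linarith
  · rw [legendreSym_neg_one_of_mod_four_eq_three hp4, Int.cast_neg, Int.cast_one] at hq₂
    linarith
  · have hq₃ : 2 * ((ellipticPoints p k γ 3).ncard : ℚ) = 1 - legendreSym p (-3) := by
      exact_mod_cast hcard₃
    linarith
  · rw [legendreSym_neg_three_of_mod_three_eq_one hp hp3] at hcard₃
    omega
  · rw [legendreSym_neg_three_of_mod_three_eq_two hp hp3] at hcard₃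
    omega
  · rintro r (rfl | rfl)
    · exact h.ncard_ellipticLevelPoints b hfin₂
    · exact h.ncard_ellipticLevelPoints b hfin₃
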